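/- Let $p$ be a prime, $N\ge 1$ an integer prime to $p$, $\Gamma=\Gamma_1(N)\cap\Gamma_0(p)$, $L$ a finite extension of $\mathbb{Q}_p$, and $k\ge 0$ an integer. Let $S_0(p)$ be the monoid of matrices $\begin{pmatrix} a&b\\c&d\end{pmatrix}\in \mathrm{GL}_2(\mathbb{Q})$ with entries in $\mathbb{Z}_{(p)}$, $p\nmid a$ and $p\mid c$. For $r>0$ let $\mathcal{A}[r](L)$ be the Banach space of functions $\mathbb{Z}_p\to L$ that are locally analytic of radius $r$. Let $\mathcal{D}^\dagger(L)=\varprojlim_{r\to 0^+}\mathcal{D}[r](L)$, where $\mathcal{D}[r](L)$ is the Banach dual of $\mathcal{A}[r](L)$. For $m\in\mathbb{Z}$ let $\mathcal{D}_m^\dagger$ be $\mathcal{D}^\dagger(L)$ with the right action of $S_0(p)$ given by $(\mu_{|\gamma})(f)=\mu(\gamma\cdot_m f)$, where $(\gamma\cdot_m f)(z)=(a-cz)^m f\left(\frac{dz-b}{a-cz}\right)$. Let $\Delta$ be the group of divisors on $\mathbb{P}^1(\mathbb{Q})$ and $\Delta^0$ the subgroup of divisors of degree $0$. For a right $S_0(p)$-module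 $V$, the monoid $S_0(p)$ acts on $\mathrm{Hom}(\Delta,V)$ and on $\mathrm{Hom}(\Delta^0,V)$ by $\phi_{|\gamma}(D)=\phi(\gamma D)_{|\gamma}$. Put $\mathrm{Symb}_\Gamma(V)=\mathrm{Hom}(\Delta^0,V)^\Gamma$, and let $\mathrm{BSymb}_\Gamma(V)$ be the image of $\mathrm{Hom}(\Delta,V)^\Gamma$ in it under restriction. For $s\in S_0(p)$ the Hecke operator $[\Gamma s\Gamma]$ is $\Phi\mapsto\sum_i\Phi_{|s_i}$, where $\Gamma s\Gamma=\coprod_i\Gamma s_i$. In particular $T_\ell$ ($\ell\nmid Np$ prime) and $U_\ell$ ($\ell\mid Np$ prime) are given by $s=\begin{pmatrix}1&0\\0&\ell\end{pmatrix}$, the diamond operators by $s\in\Gamma_0(Np)$, and the involution $\iota$ by $s=\begin{pmatrix}1&0\\0&-1\end{pmatrix}$. Let $\mathrm{BSymb}_\Gamma(\mathcal{D}_m^\dagger)^{\mathrm{ord}}$ (respectively $\mathrm{BSymb}_\Gamma(\mathcal{D}_k^\dagger)^{\mathrm{crit}}$) be the linear span of the vectors of $\mathrm{BSymb}_\Gamma(\mathcal{D}_m^\dagger)$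 (respectively of $\mathrm{BSymb}_\Gamma(\mathcal{D}_k^\dagger)$) that are killed by $P(U_p)$ for some non-zero $P\in L[X]$ all of whose roots in $\bar L$ have $p$-adic valuation $0$ (respectively $k+1$), where the valuation of $p$ is $1$. Let $\Theta_k$ be the map on $\mathcal{D}^\dagger(L)$ given by $(\Theta_k\mu)(f)=\mu\left(\frac{d^{k+1}f}{dz^{k+1}}\right)$, and write $\Theta_k$ also for the induced map $\Phi\mapsto\Theta_k\circ\Phi$ on $\mathrm{Hom}(\Delta^0,\mathcal{D}^\dagger(L))$. **Theorem.** (1) The map $\Theta_k$ restricts to an $L$-linear isomorphism $$\Theta_k\colon \mathrm{BSymb}_\Gamma(\mathcal{D}_{-2-k}^\dagger)^{\mathrm{ord}}\longrightarrow \mathrm{BSymb}_\Gamma(\mathcal{D}_k^\dagger)^{\mathrm{crit}}.$$ It is Hecke-equivariant up to the twist by $\det^{k+1}$: for all $s\in S_0(p)$ and all $\Phi$ in the source, $$(\Theta_k\Phi)_{|[\Gamma s\Gamma]}=\det(s)^{k+1}\,\Theta_k\left(\Phi_{|[\Gamma s\Gamma]}\right).$$ Moreover the source and the target are stable under all the operators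 $T_\ell$ and $U_\ell$, the diamond operators and $\iota$. (2) Let $\phi\in\mathrm{Hom}(\Delta,\mathcal{D}_k^\dagger)^\Gamma$ have its restriction to $\Delta^0$ in $\mathrm{BSymb}_\Gamma(\mathcal{D}_k^\dagger)^{\mathrm{crit}}$, and let $C_0=\mathbb{Q}\cap\mathbb{Z}_p$. Then $\phi(c)=0$ for every cusp $c\notin C_0$, and for every cusp $c\in C_0$ the value $\phi(c)$ is an $L$-multiple of $\delta_{c,k+1}\colon f\mapsto \frac{d^{k+1}f}{dz^{k+1}}(c)$. -/

import Mathlib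

namespace OMS

open Filter Topology

section LocallyAnalytic

variable {p : ℕ} [Fact p.Prime] {L : Type*} [NormedField L] [NormedAlgebra ℚ_[p] L]

/-- `f` is given on the closed ball of `ℤ_p` with centre `e` and radius `r` by the power series
`∑ aₙ (z - e)ⁿ`, which converges on the closed disc of radius `r` (that is, `‖aₙ‖ rⁿ → 0`). -/
def HasExpansion (r : ℝ) (f : ℤ_[p] → L) (e : ℤ_[p]) (a : ℕ → L) : Prop :=
  Tendsto (fun n => ‖a n‖ * r ^ n) atTop (𝓝 0) ∧
    ∀ z : ℤ_[p], ‖z - e‖ ≤ r → HasSum (fun n => (((z - e : ℤ_[p]) : ℚ_[p]) ^ n) • a n) (f z)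

/-- Membership in `A[r](L)`: functions `ℤ_p → L` that are locally analytic of radius `r`. -/
def IsAnalyticOfRadius (r : ℝ) (f : ℤ_[p] → L) : Prop :=
  ∀ e : ℤ_[p], ∃ a : ℕ → L, HasExpansion r f e a

/-- `f ∈ A[r](L)` and its norm in the Banach space `A[r](L)`, the supremum over all centres `e` and
all `n` of `‖aₙ(e)‖ rⁿ`, is at most `M`. -/
def AnalyticNormLE (r : ℝ) (f : ℤ_[p] → L) (M : ℝ) : Prop :=
  ∀ e : ℤ_[p], ∃ a : ℕ → L, HasExpansion r f e a ∧ ∀ n, ‖a n‖ * r ^ n ≤ M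

theorem HasExpansion.mono {r r' : ℝ} {f : ℤ_[p] → L} {e : ℤ_[p]} {a : ℕ → L}
    (h : HasExpansion r f e a) (h0 : 0 ≤ r') (hr : r' ≤ r) : HasExpansion r' f e a := by
  refine ⟨squeeze_zero (fun n => by positivity) (fun n => ?_) h.1,
    fun z hz => h.2 z (hz.trans hr)⟩
  gcongr

theorem IsAnalyticOfRadius.mono {r r' : ℝ} {f : ℤ_[p] → L}
    (h : IsAnalyticOfRadius r f) (h0 : 0 ≤ r') (hr : r' ≤ r) : IsAnalyticOfRadius r' f :=
  fun e => (h e).imp fun _ ha => ha.mono h0 hr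

theorem AnalyticNormLE.isAnalyticOfRadius {r M : ℝ} {f : ℤ_[p] → L}
    (h : AnalyticNormLE r f M) : IsAnalyticOfRadius r f :=
  fun e => (h e).imp fun _ ha => ha.1

theorem HasExpansion.add {r : ℝ} {f g : ℤ_[p] → L} {e : ℤ_[p]} {a b : ℕ → L} (h0 : 0 ≤ r)
    (hf : HasExpansion r f e a) (hg : HasExpansion r g e b) :
    HasExpansion r (f + g) e (a + b) := by
  refine ⟨?_, fun z hz => ?_⟩
  · refine squeeze_zero (fun n => by positivity) (fun n => ?_)
      (by simpa using hf.1.add hg.1)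
    rw [← add_mul]
    exact mul_le_mul_of_nonneg_right (norm_add_le _ _) (by positivity)
  · simpa [smul_add] using (hf.2 z hz).add (hg.2 z hz)

theorem HasExpansion.smul {r : ℝ} {f : ℤ_[p] → L} {e : ℤ_[p]} {a : ℕ → L}
    (c : L) (hf : HasExpansion r f e a) : HasExpansion r (c • f) e (c • a) := by
  refine ⟨?_, fun z hz => ?_⟩
  · simpa [norm_mul, mul_assoc] using hf.1.const_mul ‖c‖
  · have := (hf.2 z hz).const_smul c
    simpa [smul_comm c] using this

variable (p L) in
/-- The `L`-vector space of locally analytic functions `ℤ_p → L`, the union of the `A[r](L)` over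
all `r > 0`. -/
def LocAn : Submodule L (ℤ_[p] → L) where
  carrier := {f | ∃ r : ℝ, 0 < r ∧ IsAnalyticOfRadius r f}
  zero_mem' := ⟨1, one_pos, fun e => ⟨0, by simp [HasExpansion]⟩⟩
  add_mem' := by
    rintro f g ⟨r, hr, hf⟩ ⟨s, hs, hg⟩
    have h0 : 0 < min r s := lt_min hr hs
    refine ⟨min r s, h0, fun e => ?_⟩
    obtain ⟨a, ha⟩ := hf.mono h0.le (min_le_left r s) e
    obtain ⟨b, hb⟩ := hg.mono h0.le (min_le_right r s) e
    exact ⟨a + b, ha.add h0.le hb⟩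
  smul_mem' := by
    rintro c f ⟨r, hr, hf⟩
    exact ⟨r, hr, fun e => (hf e).elim fun a ha => ⟨c • a, ha.smul c⟩⟩

variable (p L) in
/-- The space of distributions `𝒟†(L) = lim_{r → 0⁺} 𝒟[r](L)`, where `𝒟[r](L)` is the Banach dual of
`A[r](L)`: the linear forms on locally analytic functions whose restriction to every `A[r](L)`,
`r > 0`, is continuous. -/
def Distr : Submodule L (Module.Dual L (LocAn p L)) where
  carrier := {μ | ∀ r : ℝ, 0 < r → ∃ B : ℝ, ∀ (f : LocAn p L) (M : ℝ),
    AnalyticNormLE r (f : ℤ_[p] → L) M → ‖μ f‖ ≤ B * M}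
  zero_mem' := fun r _ => ⟨0, fun f M _ => by simp⟩
  add_mem' := by
    intro μ ν hμ hν r hr
    obtain ⟨B, hB⟩ := hμ r hr
    obtain ⟨C, hC⟩ := hν r hr
    refine ⟨B + C, fun f M hf => ?_⟩
    rw [add_mul]
    exact (norm_add_le _ _).trans (add_le_add (hB f M hf) (hC f M hf))
  smul_mem' := by
    intro c μ hμ r hr
    obtain ⟨B, hB⟩ := hμ r hr
    refine ⟨‖c‖ * B, fun f M hf => ?_⟩
    rw [LinearMap.smul_apply, norm_smul, mul_assoc]
    exact mul_le_mul_of_nonneg_left (hB f M hf) (norm_nonneg c)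

/-- The derivative `df/dz` of a function on `ℤ_p` (the derivative at the points of the open subset
`ℤ_p` of `ℚ_p` of the extension of `f` by zero). -/
noncomputable def zDeriv (f : ℤ_[p] → L) : ℤ_[p] → L := fun z =>
  deriv (Function.extend (fun x : ℤ_[p] => (x : ℚ_[p])) f 0) (z : ℚ_[p])

theorem extend_coe_apply {p : ℕ} [Fact p.Prime] {L : Type*} [NormedField L] (f : ℤ_[p] → L) (z : ℤ_[p]) :
    Function.extend (fun x : ℤ_[p] => (x : ℚ_[p])) f 0 (z : ℚ_[p]) = f z :=
  Function.Injective.extend_apply Subtype.val_injective f 0 z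

theorem HasExpansion.hasFPowerSeriesOnBall {r : ℝ} (hr : 0 < r) {f : ℤ_[p] → L} {e : ℤ_[p]}
    {a : ℕ → L} (h : HasExpansion r f e a) :
    HasFPowerSeriesOnBall (Function.extend (fun x : ℤ_[p] => (x : ℚ_[p])) f 0)
      (fun n => ContinuousMultilinearMap.mkPiRing ℚ_[p] (Fin n) (a n)) (e : ℚ_[p])
      (ENNReal.ofReal (min r 1)) := by
  have h0 : 0 < min r 1 := lt_min hr one_pos
  refine ⟨?_, by simpa using h0, ?_⟩
  · rw [ENNReal.ofReal]
    apply FormalMultilinearSeries.le_radius_of_tendsto (l := 0)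
    have := (h.mono h0.le (min_le_left r 1)).1
    simpa [ContinuousMultilinearMap.norm_mkPiRing, Real.coe_toNNReal _ h0.le] using this
  · intro y hy
    have hy' : ‖y‖ < min r 1 := by
      rw [Metric.eball_ofReal] at hy
      simpa using hy
    set t : ℤ_[p] := ⟨y, (hy'.trans_le (min_le_right r 1)).le⟩ with ht
    have hz := h.2 (e + t) (by
      rw [add_sub_cancel_left]
      exact (hy'.trans_le (min_le_left r 1)).le)
    have he : ((e : ℚ_[p]) + y) = ((e + t : ℤ_[p]) : ℚ_[p]) := by
      rw [PadicInt.coe_add]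
    rw [he, extend_coe_apply]
    rw [add_sub_cancel_left] at hz
    simpa using hz

theorem HasExpansion.zDeriv [CompleteSpace L] {r M : ℝ} (hr : 0 < r) {f : ℤ_[p] → L} {e : ℤ_[p]}
    {a : ℕ → L} (h : HasExpansion r f e a) :
    HasExpansion (min r 1 / 2) (zDeriv f) e (fun n => ((n + 1 : ℕ) : L) * a (n + 1)) ∧
    ((∀ n, ‖a n‖ * r ^ n ≤ M) →
      ∀ n, ‖((n + 1 : ℕ) : L) * a (n + 1)‖ * (min r 1 / 2) ^ n ≤ (min r 1 / 2)⁻¹ * M) := by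
  have h1 : 0 < min r 1 := lt_min hr one_pos
  have h0 : 0 < min r 1 / 2 := by positivity
  have hle : min r 1 / 2 ≤ r := by linarith [min_le_left r 1]
  have hn : ∀ n : ℕ, ‖(n : L)‖ ≤ 1 := fun n => by
    rw [← map_natCast (algebraMap ℚ_[p] L) n, norm_algebraMap']
    exact_mod_cast PadicInt.norm_le_one (n : ℤ_[p])
  have key : ∀ n, ‖((n + 1 : ℕ) : L) * a (n + 1)‖ * (min r 1 / 2) ^ n ≤
      (min r 1 / 2)⁻¹ * (‖a (n + 1)‖ * (min r 1 / 2) ^ (n + 1)) := fun n => by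
    rw [pow_succ, norm_mul]
    have : (min r 1 / 2)⁻¹ * (‖a (n + 1)‖ * ((min r 1 / 2) ^ n * (min r 1 / 2))) =
      ‖a (n + 1)‖ * (min r 1 / 2) ^ n := by field_simp
    rw [this]
    gcongr
    exact mul_le_of_le_one_left (norm_nonneg _) (hn _)
  refine ⟨⟨?_, fun z hz => ?_⟩, fun hM n => (key n).trans ?_⟩
  · refine squeeze_zero (fun n => by positivity) key ?_
    have := ((h.mono h0.le hle).1.comp (tendsto_add_atTop_nat 1)).const_mul (min r 1 / 2)⁻¹
    simpa using this
  · have hF := (h.hasFPowerSeriesOnBall hr).fderiv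
    have hz' : ((z - e : ℤ_[p]) : ℚ_[p]) ∈ Metric.eball (0 : ℚ_[p]) (ENNReal.ofReal (min r 1)) := by
      rw [Metric.eball_ofReal]
      simp only [mem_ball_zero_iff]
      have : ‖((z - e : ℤ_[p]) : ℚ_[p])‖ ≤ min r 1 / 2 := hz
      linarith
    have hs := hF.hasSum hz'
    have hs' := hs.mapL (ContinuousLinearMap.apply ℚ_[p] L (1 : ℚ_[p]))
    have he : (e : ℚ_[p]) + ((z - e : ℤ_[p]) : ℚ_[p]) = z := by simp
    rw [he] at hs'
    refine (congrArg (fun F : ℕ → L => HasSum F (OMS.zDeriv f z)) (funext fun n => ?_)).mpr hs'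
    have hd := FormalMultilinearSeries.derivSeries_coeff_one
      (fun n => ContinuousMultilinearMap.mkPiRing ℚ_[p] (Fin n) (a n)) n
    simp only [ContinuousLinearMap.apply_apply, FormalMultilinearSeries.apply_eq_pow_smul_coeff]
    rw [smul_apply, hd]
    simp only [FormalMultilinearSeries.coeff, ContinuousMultilinearMap.mkPiRing_apply]
    simp [nsmul_eq_mul]
  · gcongr
    refine le_trans ?_ (hM (n + 1))
    gcongr

/-- Locally analytic functions are stable under the derivative, which is linear on them. -/
noncomputable def derivLocAn [FiniteDimensional ℚ_[p] L] : LocAn p L →ₗ[L] LocAn p L where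
  toFun f := ⟨zDeriv (f : ℤ_[p] → L), by
    have := FiniteDimensional.complete ℚ_[p] L
    obtain ⟨r, hr, hf⟩ := f.2
    have h1 : 0 < min r 1 := lt_min hr one_pos
    exact ⟨min r 1 / 2, by positivity, fun e => (hf e).elim fun a ha =>
      ⟨_, (ha.zDeriv (M := 0) hr).1⟩⟩⟩
  map_add' := by
    have := FiniteDimensional.complete ℚ_[p] L
    rintro ⟨f, r, hr, hf⟩ ⟨g, s, hs, hg⟩
    ext z
    obtain ⟨a, ha⟩ := hf z
    obtain ⟨b, hb⟩ := hg z
    have hF := (ha.hasFPowerSeriesOnBall hr).differentiableOn.differentiableAt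
      (Metric.eball_mem_nhds _ (by simp [hr]))
    have hG := (hb.hasFPowerSeriesOnBall hs).differentiableOn.differentiableAt
      (Metric.eball_mem_nhds _ (by simp [hs]))
    have := deriv_add hF hG
    rw [← Function.extend_add] at this
    simpa [zDeriv] using this
  map_smul' := by
    have := FiniteDimensional.complete ℚ_[p] L
    rintro c ⟨f, r, hr, hf⟩
    ext z
    obtain ⟨a, ha⟩ := hf z
    have hF := (ha.hasFPowerSeriesOnBall hr).differentiableOn.differentiableAt
      (Metric.eball_mem_nhds _ (by simp [hr]))
    have := deriv_const_smul c hF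
    have hE : c • Function.extend (fun x : ℤ_[p] => (x : ℚ_[p])) f 0 =
        Function.extend (fun x : ℤ_[p] => (x : ℚ_[p])) (c • f) 0 := by
      rw [← Function.extend_smul, smul_zero]
    rw [hE] at this
    simpa [zDeriv] using this

/-- The derivation of distributions, `μ ↦ (f ↦ μ (df/dz))`. -/
noncomputable def derivDistr [FiniteDimensional ℚ_[p] L] : Distr p L →ₗ[L] Distr p L :=
  (derivLocAn (p := p) (L := L)).dualMap.restrict (by
    have := FiniteDimensional.complete ℚ_[p] L
    intro μ hμ r hr
    have h1 : 0 < min r 1 := lt_min hr one_pos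
    obtain ⟨B, hB⟩ := hμ (min r 1 / 2) (by positivity)
    refine ⟨B * (min r 1 / 2)⁻¹, fun f M hf => ?_⟩
    rw [mul_assoc]
    refine hB (derivLocAn f) _ fun e => ?_
    obtain ⟨a, ha, hM⟩ := hf e
    exact ⟨_, (ha.zDeriv (M := M) hr).1, (ha.zDeriv hr).2 hM⟩)

end LocallyAnalytic

section PowerSeriesEval
variable {p : ℕ} [Fact p.Prime]

/-- `q(t) = v` for a power series `q` with coefficients in `ℤ_p`. -/
def EvalsTo (q : PowerSeries ℤ_[p]) (t v : ℤ_[p]) : Prop :=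
  HasSum (fun m => PowerSeries.coeff m q * t ^ m) v

theorem summable_norm_eval (q : PowerSeries ℤ_[p]) {t : ℤ_[p]} (ht : ‖t‖ < 1) :
    Summable fun m => ‖PowerSeries.coeff m q * t ^ m‖ := by
  refine Summable.of_nonneg_of_le (fun _ => norm_nonneg _) (fun m => ?_)
    (summable_geometric_of_lt_one (norm_nonneg t) ht)
  rw [norm_mul, norm_pow]
  exact mul_le_of_le_one_left (by positivity) (PadicInt.norm_le_one _)

theorem exists_evalsTo (q : PowerSeries ℤ_[p]) {t : ℤ_[p]} (ht : ‖t‖ < 1) :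
    ∃ v, EvalsTo q t v :=
  (summable_norm_eval q ht).of_norm

theorem EvalsTo.mul {q q' : PowerSeries ℤ_[p]} {t v v' : ℤ_[p]} (ht : ‖t‖ < 1)
    (h : EvalsTo q t v) (h' : EvalsTo q' t v') : EvalsTo (q * q') t (v * v') := by
  have h1 := summable_norm_eval q ht
  have h2 := summable_norm_eval q' ht
  have := (summable_norm_sum_mul_antidiagonal_of_summable_norm h1 h2).of_norm.hasSum
  rw [← tsum_mul_tsum_eq_tsum_sum_antidiagonal_of_summable_norm h1 h2] at this
  rw [← h.tsum_eq, ← h'.tsum_eq]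
  refine (congrArg (fun F : ℕ → ℤ_[p] => HasSum F _) (funext fun n => ?_)).mpr this
  rw [PowerSeries.coeff_mul, Finset.sum_mul]
  refine Finset.sum_congr rfl fun x hx => ?_
  rw [← Finset.HasAntidiagonal.mem_antidiagonal.mp hx, pow_add]
  ring

theorem evalsTo_C (c t : ℤ_[p]) : EvalsTo (PowerSeries.C c) t c := by
  have := hasSum_ite_eq (0 : ℕ) c
  refine (congrArg (fun F : ℕ → ℤ_[p] => HasSum F _) (funext fun n => ?_)).mpr this
  rw [PowerSeries.coeff_C]
  split_ifs with h <;> simp [h]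

theorem evalsTo_X (t : ℤ_[p]) : EvalsTo PowerSeries.X t t := by
  have := hasSum_ite_eq (1 : ℕ) t
  refine (congrArg (fun F : ℕ → ℤ_[p] => HasSum F _) (funext fun n => ?_)).mpr this
  rw [PowerSeries.coeff_X]
  split_ifs with h <;> simp [h]

theorem EvalsTo.sub {q q' : PowerSeries ℤ_[p]} {t v v' : ℤ_[p]}
    (h : EvalsTo q t v) (h' : EvalsTo q' t v') : EvalsTo (q - q') t (v - v') := by
  have := HasSum.sub h h'
  refine (congrArg (fun F : ℕ → ℤ_[p] => HasSum F _) (funext fun n => ?_)).mpr this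
  simp [sub_mul]

theorem EvalsTo.unique {q : PowerSeries ℤ_[p]} {t v v' : ℤ_[p]}
    (h : EvalsTo q t v) (h' : EvalsTo q t v') : v = v' := HasSum.unique h h'

theorem EvalsTo.pow {q : PowerSeries ℤ_[p]} {t v : ℤ_[p]} (ht : ‖t‖ < 1)
    (h : EvalsTo q t v) (n : ℕ) : EvalsTo (q ^ n) t (v ^ n) := by
  induction n with
  | zero => simpa using evalsTo_C 1 t
  | succ n ih => rw [pow_succ, pow_succ]; exact ih.mul ht h

theorem EvalsTo.units_inv {q : (PowerSeries ℤ_[p])ˣ} {t : ℤ_[p]} {v : ℤ_[p]ˣ} (ht : ‖t‖ < 1)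
    (h : EvalsTo (q : PowerSeries ℤ_[p]) t v) :
    EvalsTo ((q⁻¹ : (PowerSeries ℤ_[p])ˣ) : PowerSeries ℤ_[p]) t ((v⁻¹ : ℤ_[p]ˣ) : ℤ_[p]) := by
  obtain ⟨w, hw⟩ := exists_evalsTo ((q⁻¹ : (PowerSeries ℤ_[p])ˣ) : PowerSeries ℤ_[p]) ht
  have h1 := h.mul ht hw
  rw [Units.mul_inv] at h1
  have h2 : (v : ℤ_[p]) * w = 1 := h1.unique (by simpa using evalsTo_C 1 t)
  rwa [Units.inv_eq_of_mul_eq_one_right h2]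

theorem EvalsTo.units_zpow {q : (PowerSeries ℤ_[p])ˣ} {t : ℤ_[p]} {v : ℤ_[p]ˣ} (ht : ‖t‖ < 1)
    (h : EvalsTo (q : PowerSeries ℤ_[p]) t v) (k : ℤ) :
    EvalsTo ((q ^ k : (PowerSeries ℤ_[p])ˣ) : PowerSeries ℤ_[p]) t ((v ^ k : ℤ_[p]ˣ) : ℤ_[p]) := by
  obtain ⟨n, rfl | rfl⟩ := k.eq_nat_or_neg
  · simpa using h.pow ht n
  · have := (h.units_inv ht).pow ht n
    simpa [zpow_neg] using this

end PowerSeriesEval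

section Substitution
variable {p : ℕ} [Fact p.Prime] {L : Type*} [NormedField L] [NormedAlgebra ℚ_[p] L]

/-- If, near `e`, `g(e + t) = j(t) f(e' + t h(t))` with power series `j`, `h` over `ℤ_p`, then an
expansion of `f` at `e'` gives one of `g` at `e`. -/
theorem HasExpansion.subst [CompleteSpace L] {r M : ℝ} (hr : 0 < r) {f g : ℤ_[p] → L}
    {e e' : ℤ_[p]} {a : ℕ → L} (hf : HasExpansion r f e' a) (hM : ∀ n, ‖a n‖ * r ^ n ≤ M)
    (j h : PowerSeries ℤ_[p])
    (hg : ∀ t : ℤ_[p], ‖t‖ < 1 → ∃ J H : ℤ_[p], EvalsTo j t J ∧ EvalsTo h t H ∧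
      g (e + t) = ((J : ℤ_[p]) : ℚ_[p]) • f (e' + t * H)) :
    ∃ b : ℕ → L, HasExpansion (min r 1 / 4) g e b ∧ ∀ n, ‖b n‖ * (min r 1 / 4) ^ n ≤ M := by
  have hs0 : 0 < min r 1 := lt_min hr one_pos
  set s := min r 1 with hs
  have hs1 : s ≤ 1 := min_le_right r 1
  have hfs := hf.mono hs0.le (min_le_left r 1)
  have hMs : ∀ n, ‖a n‖ * s ^ n ≤ M := fun n => by
    refine le_trans ?_ (hM n)
    gcongr
    exact min_le_left r 1
  have hM0 : 0 ≤ M := le_trans (by positivity) (hM 0)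
  let c : ℕ → ℕ → ℤ_[p] := fun n l => PowerSeries.coeff l (j * h ^ n)
  let b : ℕ → L := fun m => ∑ x ∈ Finset.HasAntidiagonal.antidiagonal m, ((c x.1 x.2 : ℤ_[p]) : ℚ_[p]) • a x.1
  have hc : ∀ n l, ‖((c n l : ℤ_[p]) : ℚ_[p])‖ ≤ 1 := fun n l => PadicInt.norm_le_one _
  have hterm : ∀ n l, ‖((c n l : ℤ_[p]) : ℚ_[p]) • a n‖ * (s / 4) ^ (n + l) ≤
      M * ((1 / 4) ^ n * (1 / 4) ^ l) := fun n l => by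
    rw [norm_smul]
    have h1 : ‖a n‖ * (s / 4) ^ (n + l) = (‖a n‖ * s ^ n) * s ^ l * ((1 / 4) ^ n * (1 / 4) ^ l) := by
      rw [← pow_add, div_pow, pow_add s, div_pow]; ring
    calc ‖((c n l : ℤ_[p]) : ℚ_[p])‖ * ‖a n‖ * (s / 4) ^ (n + l)
        ≤ 1 * ‖a n‖ * (s / 4) ^ (n + l) := by gcongr; exact hc n l
      _ = (‖a n‖ * s ^ n) * s ^ l * ((1 / 4) ^ n * (1 / 4) ^ l) := by rw [one_mul, h1]
      _ ≤ M * 1 * ((1 / 4) ^ n * (1 / 4) ^ l) := by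
          gcongr
          · exact hMs n
          · exact pow_le_one₀ hs0.le hs1
      _ = _ := by ring
  have hb : ∀ m, ‖b m‖ * (s / 4) ^ m ≤ M * ((m + 1) * (1 / 4) ^ m) := fun m => by
    calc ‖b m‖ * (s / 4) ^ m
        ≤ (∑ x ∈ Finset.HasAntidiagonal.antidiagonal m, ‖((c x.1 x.2 : ℤ_[p]) : ℚ_[p]) • a x.1‖) * (s / 4) ^ m := by
          gcongr; exact norm_sum_le _ _
      _ = ∑ x ∈ Finset.HasAntidiagonal.antidiagonal m,
            ‖((c x.1 x.2 : ℤ_[p]) : ℚ_[p]) • a x.1‖ * (s / 4) ^ (x.1 + x.2) := by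
          rw [Finset.sum_mul]
          refine Finset.sum_congr rfl fun x hx => ?_
          rw [Finset.HasAntidiagonal.mem_antidiagonal.mp hx]
      _ ≤ ∑ x ∈ Finset.HasAntidiagonal.antidiagonal m, M * (1 / 4) ^ m := by
          refine Finset.sum_le_sum fun x hx => (hterm _ _).trans_eq ?_
          rw [← pow_add, Finset.HasAntidiagonal.mem_antidiagonal.mp hx]
      _ = _ := by
          rw [Finset.sum_const, Finset.Nat.card_antidiagonal]
          simp; ring
  refine ⟨b, ⟨?_, fun z hz => ?_⟩, fun m => (hb m).trans ?_⟩
  · refine squeeze_zero (fun n => by positivity) hb ?_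
    have h1 := tendsto_self_mul_const_pow_of_lt_one (r := (1 / 4 : ℝ)) (by norm_num) (by norm_num)
    have h2 := tendsto_pow_atTop_nhds_zero_of_lt_one (r := (1 / 4 : ℝ)) (by norm_num) (by norm_num)
    have := (h1.add h2).const_mul M
    simp only [add_zero, mul_zero] at this
    refine this.congr fun n => ?_
    ring
  · obtain ⟨t, rfl⟩ : ∃ t, z = e + t := ⟨z - e, by ring⟩
    rw [add_sub_cancel_left] at hz ⊢
    have ht : ‖t‖ < 1 := by linarith
    obtain ⟨J, H, hJ, hH, hgt⟩ := hg t ht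
    rw [hgt]
    have hball : ‖(e' + t * H) - e'‖ ≤ s := by
      rw [add_sub_cancel_left, norm_mul]
      calc ‖t‖ * ‖H‖ ≤ ‖t‖ * 1 := by gcongr; exact PadicInt.norm_le_one H
        _ ≤ s := by linarith
    have hsum := (hfs.2 _ hball).const_smul ((J : ℤ_[p]) : ℚ_[p])
    rw [add_sub_cancel_left] at hsum
    let F : ℕ × ℕ → L := fun x =>
      ((c x.1 x.2 : ℤ_[p]) : ℚ_[p]) • ((t : ℚ_[p]) ^ (x.1 + x.2) • a x.1)
    have hF : Summable F := by
      have hgeo : Summable fun n : ℕ => (1 / 4 : ℝ) ^ n :=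
        summable_geometric_of_lt_one (by norm_num) (by norm_num)
      have hprod := (hgeo.mul_of_nonneg hgeo (fun _ => by positivity)
        (fun _ => by positivity)).mul_left M
      refine Summable.of_norm_bounded hprod fun x => ?_
      refine le_trans ?_ (hterm x.1 x.2)
      change ‖((c x.1 x.2 : ℤ_[p]) : ℚ_[p]) • ((t : ℚ_[p]) ^ (x.1 + x.2) • a x.1)‖ ≤ _
      rw [smul_comm, norm_smul, norm_pow, mul_comm]
      have : ‖(t : ℚ_[p])‖ ≤ s / 4 := hz
      gcongr
    have hrow : ∀ n, HasSum (fun l => F (n, l))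
        (((J : ℤ_[p]) : ℚ_[p]) • (((t * H : ℤ_[p]) : ℚ_[p]) ^ n • a n)) := fun n => by
      have h1 := hJ.mul ht (hH.pow ht n)
      have h2 := h1.map (PadicInt.Coe.ringHom (p := p)) continuous_subtype_val
      have h3 := (h2.mul_left ((t : ℚ_[p]) ^ n)).smul_const (a n)
      have he : ((t : ℚ_[p]) ^ n * PadicInt.Coe.ringHom (J * H ^ n)) • a n =
          ((J : ℤ_[p]) : ℚ_[p]) • (((t * H : ℤ_[p]) : ℚ_[p]) ^ n • a n) := by
        rw [smul_smul]
        congr 1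
        have hcoe : PadicInt.Coe.ringHom (J * H ^ n) = ((J * H ^ n : ℤ_[p]) : ℚ_[p]) := rfl
        rw [hcoe]
        push_cast
        ring
      rw [he] at h3
      refine (congrArg (fun F : ℕ → L => HasSum F _) (funext fun l => ?_)).mpr h3
      change ((c n l : ℤ_[p]) : ℚ_[p]) • ((t : ℚ_[p]) ^ (n + l) • a n) = _
      rw [smul_smul]
      congr 1
      change ((c n l : ℤ_[p]) : ℚ_[p]) * (t : ℚ_[p]) ^ (n + l) =
        (t : ℚ_[p]) ^ n * ((c n l * t ^ l : ℤ_[p]) : ℚ_[p])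
      push_cast
      ring
    have htot : HasSum F (((J : ℤ_[p]) : ℚ_[p]) • f (e' + t * H)) := by
      have h1 := hF.hasSum.prod_fiberwise hrow
      rw [hsum.unique h1]
      exact hF.hasSum
    have hanti := (Finset.HasAntidiagonal.sigmaAntidiagonalEquivProd (A := ℕ)).hasSum_iff.mpr htot
    have hfin := hanti.sigma (fun m => hasSum_fintype _)
    refine (congrArg (fun F : ℕ → L => HasSum F _) (funext fun m => ?_)).mpr hfin
    rw [Finset.sum_coe_sort_eq_attach, Finset.smul_sum]
    rw [← Finset.sum_attach]
    refine Finset.sum_congr rfl fun x _ => ?_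
    change _ = ((c x.1.1 x.1.2 : ℤ_[p]) : ℚ_[p]) • ((t : ℚ_[p]) ^ (x.1.1 + x.1.2) • a x.1.1)
    rw [Finset.HasAntidiagonal.mem_antidiagonal.mp x.2, smul_comm]
  · have : ((m : ℝ) + 1) * (1 / 4) ^ m ≤ 1 := by
      have h1 : (m : ℝ) + 1 ≤ 4 ^ m := by
        have := one_add_mul_le_pow (a := (3 : ℝ)) (by norm_num) m
        norm_num at this
        linarith [Nat.cast_nonneg (α := ℝ) m]
      rw [one_div, inv_pow, ← div_eq_mul_inv]
      exact (div_le_one (by positivity)).mpr h1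
    calc M * (((m : ℝ) + 1) * (1 / 4) ^ m) ≤ M * 1 := by gcongr
      _ = M := mul_one M

end Substitution

section WeightAction
open scoped MatrixGroups

variable {p : ℕ} [Fact p.Prime]

variable (p) in
/-- The monoid `S₀(p)` of invertible rational matrices `(a b; c d)` with entries in
`ℤ_(p) = ℚ ∩ ℤ_p`, with `p ∤ a` and `p ∣ c`. -/
noncomputable def S0 : Submonoid (GL (Fin 2) ℚ) where
  carrier := {γ | (∀ i j, ‖((γ i j : ℚ) : ℚ_[p])‖ ≤ 1) ∧ ‖((γ 0 0 : ℚ) : ℚ_[p])‖ = 1 ∧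
    ‖((γ 1 0 : ℚ) : ℚ_[p])‖ < 1}
  one_mem' := by
    refine ⟨fun i j => ?_, by simp, by simp⟩
    fin_cases i <;> fin_cases j <;> simp
  mul_mem' := by
    rintro γ δ ⟨h1, h2, h3⟩ ⟨h4, h5, h6⟩
    have hint : ∀ i j, ‖(((γ * δ) i j : ℚ) : ℚ_[p])‖ ≤ 1 := fun i j => by
      simp only [Units.val_mul, Matrix.mul_apply, Fin.sum_univ_two, Rat.cast_add, Rat.cast_mul]
      refine (Padic.nonarchimedean _ _).trans (max_le ?_ ?_) <;> rw [norm_mul]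
      · exact mul_le_one₀ (h1 _ _) (norm_nonneg _) (h4 _ _)
      · exact mul_le_one₀ (h1 _ _) (norm_nonneg _) (h4 _ _)
    refine ⟨hint, ?_, ?_⟩
    · simp only [Units.val_mul, Matrix.mul_apply, Fin.sum_univ_two, Rat.cast_add, Rat.cast_mul]
      have ha : ‖((γ 0 0 : ℚ) : ℚ_[p]) * ((δ 0 0 : ℚ) : ℚ_[p])‖ = 1 := by rw [norm_mul, h2, h5, one_mul]
      have hb : ‖((γ 0 1 : ℚ) : ℚ_[p]) * ((δ 1 0 : ℚ) : ℚ_[p])‖ < 1 := by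
        rw [norm_mul]
        exact mul_lt_one_of_nonneg_of_lt_one_right (h1 _ _) (norm_nonneg _) h6
      rw [Padic.add_eq_max_of_ne (by rw [ha]; exact hb.ne'), ha]
      exact max_eq_left hb.le
    · simp only [Units.val_mul, Matrix.mul_apply, Fin.sum_univ_two, Rat.cast_add, Rat.cast_mul]
      refine (Padic.nonarchimedean _ _).trans_lt (max_lt ?_ ?_) <;> rw [norm_mul]
      · exact mul_lt_one_of_nonneg_of_lt_one_left (norm_nonneg _) h3 (h4 _ _)
      · exact mul_lt_one_of_nonneg_of_lt_one_right (h1 _ _) (norm_nonneg _) h6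

/-- The entries of an element of `S₀(p)` as `p`-adic integers. -/
noncomputable def s0Entry (γ : S0 p) (i j : Fin 2) : ℤ_[p] := ⟨(((γ : GL (Fin 2) ℚ) i j : ℚ) : ℚ_[p]), γ.2.1 i j⟩

theorem s0IsUnitDenom (γ : S0 p) (z : ℤ_[p]) : IsUnit (s0Entry γ 0 0 - s0Entry γ 1 0 * z) := by
  rw [PadicInt.isUnit_iff]
  have ha : ‖s0Entry γ 0 0‖ = 1 := γ.2.2.1
  have hc : ‖-(s0Entry γ 1 0 * z)‖ < 1 := by
    rw [norm_neg, norm_mul]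
    exact mul_lt_one_of_nonneg_of_lt_one_left (norm_nonneg _) γ.2.2.2 (PadicInt.norm_le_one z)
  rw [sub_eq_add_neg, PadicInt.norm_add_eq_max_of_ne (by rw [ha]; exact hc.ne'), ha]
  exact max_eq_left hc.le

/-- `a - c z ∈ ℤ_p^×` for `γ = (a b; c d) ∈ S₀(p)` and `z ∈ ℤ_p`. -/
noncomputable def s0Denom (γ : S0 p) (z : ℤ_[p]) : ℤ_[p]ˣ := (s0IsUnitDenom γ z).unit

theorem s0Denom_val (γ : S0 p) (z : ℤ_[p]) :
    (s0Denom γ z : ℤ_[p]) = s0Entry γ 0 0 - s0Entry γ 1 0 * z := rfl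

/-- `(d z - b) / (a - c z) ∈ ℤ_p` for `γ = (a b; c d) ∈ S₀(p)` and `z ∈ ℤ_p`. -/
noncomputable def s0Moebius (γ : S0 p) (z : ℤ_[p]) : ℤ_[p] :=
  (s0Entry γ 1 1 * z - s0Entry γ 0 1) * ((s0Denom γ z)⁻¹ : ℤ_[p]ˣ)

theorem s0Entry_mul (γ δ : S0 p) (i j : Fin 2) :
    s0Entry (γ * δ) i j = s0Entry γ i 0 * s0Entry δ 0 j + s0Entry γ i 1 * s0Entry δ 1 j := by
  apply Subtype.val_injective
  simp [s0Entry, Matrix.mul_apply, Fin.sum_univ_two]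
  rfl

theorem s0Denom_mul_moebius (γ : S0 p) (z : ℤ_[p]) :
    (s0Denom γ z : ℤ_[p]) * s0Moebius γ z = s0Entry γ 1 1 * z - s0Entry γ 0 1 := by
  rw [s0Moebius, mul_comm, mul_assoc, Units.inv_mul, mul_one]

theorem s0Denom_mul (γ δ : S0 p) (z : ℤ_[p]) :
    s0Denom (γ * δ) z = s0Denom γ z * s0Denom δ (s0Moebius γ z) := by
  apply Units.ext
  rw [Units.val_mul, s0Denom_val δ, mul_sub, mul_left_comm, s0Denom_mul_moebius, s0Denom_val,
    s0Denom_val, s0Entry_mul, s0Entry_mul]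
  ring

theorem s0Moebius_mul (γ δ : S0 p) (z : ℤ_[p]) :
    s0Moebius (γ * δ) z = s0Moebius δ (s0Moebius γ z) := by
  have h : ((s0Denom (γ * δ) z : ℤ_[p]ˣ) : ℤ_[p]) * s0Moebius (γ * δ) z =
      ((s0Denom (γ * δ) z : ℤ_[p]ˣ) : ℤ_[p]) * s0Moebius δ (s0Moebius γ z) := by
    rw [s0Denom_mul_moebius, s0Denom_mul, Units.val_mul, mul_assoc, s0Denom_mul_moebius, mul_sub,
      mul_left_comm, s0Denom_mul_moebius, s0Denom_val, s0Entry_mul, s0Entry_mul]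
    ring
  exact (Units.mul_right_inj _).mp h

theorem s0Denom_one (z : ℤ_[p]) : s0Denom (1 : S0 p) z = 1 := by
  apply Units.ext
  rw [s0Denom_val]
  have h1 : s0Entry (1 : S0 p) 0 0 = 1 := Subtype.val_injective (by simp [s0Entry])
  have h2 : s0Entry (1 : S0 p) 1 0 = 0 := Subtype.val_injective (by simp [s0Entry])
  simp [h1, h2]

theorem s0Moebius_one (z : ℤ_[p]) : s0Moebius (1 : S0 p) z = z := by
  have h1 : s0Entry (1 : S0 p) 1 1 = 1 := Subtype.val_injective (by simp [s0Entry])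
  have h2 : s0Entry (1 : S0 p) 0 1 = 0 := Subtype.val_injective (by simp [s0Entry])
  simp [s0Moebius, s0Denom_one, h1, h2]

variable {L : Type*} [NormedField L] [NormedAlgebra ℚ_[p] L]

/-- The left action of weight `k`: `(γ ·ₖ f)(z) = (a - c z)ᵏ f((d z - b) / (a - c z))`. -/
noncomputable def weightAct (k : ℤ) (γ : S0 p) (f : ℤ_[p] → L) : ℤ_[p] → L := fun z =>
  (((s0Denom γ z ^ k : ℤ_[p]ˣ) : ℤ_[p]) : ℚ_[p]) • f (s0Moebius γ z)

theorem HasExpansion.weightAct [CompleteSpace L] (k : ℤ) (γ : S0 p) {r M : ℝ} (hr : 0 < r)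
    {f : ℤ_[p] → L} {e : ℤ_[p]} {a : ℕ → L} (hf : HasExpansion r f (s0Moebius γ e) a)
    (hM : ∀ n, ‖a n‖ * r ^ n ≤ M) :
    ∃ b : ℕ → L, HasExpansion (min r 1 / 4) (weightAct k γ f) e b ∧
      ∀ n, ‖b n‖ * (min r 1 / 4) ^ n ≤ M := by
  -- the power series `(a - c e) - c X`, a unit of `ℤ_p⟦X⟧`
  let q0 : PowerSeries ℤ_[p] :=
    PowerSeries.C (s0Denom γ e : ℤ_[p]) - PowerSeries.C (s0Entry γ 1 0) * PowerSeries.X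
  have hq0 : IsUnit q0 := by
    rw [PowerSeries.isUnit_iff_constantCoeff]
    simp [q0]
  let q : (PowerSeries ℤ_[p])ˣ := hq0.unit
  have hq : ∀ t : ℤ_[p], ‖t‖ < 1 → EvalsTo (q : PowerSeries ℤ_[p]) t (s0Denom γ (e + t)) := by
    intro t ht
    have := (evalsTo_C (s0Denom γ e : ℤ_[p]) t).sub ((evalsTo_C (s0Entry γ 1 0) t).mul ht (evalsTo_X t))
    have he : (s0Denom γ (e + t) : ℤ_[p]) = (s0Denom γ e : ℤ_[p]) - s0Entry γ 1 0 * t := by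
      rw [s0Denom_val, s0Denom_val]; ring
    rw [he]
    exact this
  let D : ℤ_[p] := (s0Entry γ 0 0 * s0Entry γ 1 1 - s0Entry γ 0 1 * s0Entry γ 1 0) *
    ((s0Denom γ e)⁻¹ : ℤ_[p]ˣ)
  refine hf.subst hr hM ((q ^ k : (PowerSeries ℤ_[p])ˣ) : PowerSeries ℤ_[p])
    (PowerSeries.C D * ((q⁻¹ : (PowerSeries ℤ_[p])ˣ) : PowerSeries ℤ_[p])) fun t ht =>
    ⟨_, _, (hq t ht).units_zpow ht k, (evalsTo_C D t).mul ht ((hq t ht).units_inv ht), ?_⟩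
  have hm : s0Moebius γ (e + t) =
      s0Moebius γ e + t * (D * ((s0Denom γ (e + t))⁻¹ : ℤ_[p]ˣ)) := by
    have h1 := s0Denom_mul_moebius γ (e + t)
    have h2 := s0Denom_mul_moebius γ e
    have h3 : (s0Denom γ e : ℤ_[p]) * ((s0Denom γ e)⁻¹ : ℤ_[p]ˣ) = 1 := Units.mul_inv _
    have h4 : (s0Denom γ (e + t) : ℤ_[p]) * ((s0Denom γ (e + t))⁻¹ : ℤ_[p]ˣ) = 1 := Units.mul_inv _
    apply (Units.mul_right_inj (s0Denom γ (e + t))).mp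
    apply (Units.mul_right_inj (s0Denom γ e)).mp
    rw [h1]
    have h5 : (s0Denom γ e : ℤ_[p]) * ((s0Denom γ (e + t) : ℤ_[p]) *
        (s0Moebius γ e + t * (D * ((s0Denom γ (e + t))⁻¹ : ℤ_[p]ˣ)))) =
        (s0Denom γ (e + t) : ℤ_[p]) * ((s0Denom γ e : ℤ_[p]) * s0Moebius γ e) +
        t * (s0Entry γ 0 0 * s0Entry γ 1 1 - s0Entry γ 0 1 * s0Entry γ 1 0) *
        ((s0Denom γ e : ℤ_[p]) * ((s0Denom γ e)⁻¹ : ℤ_[p]ˣ)) *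
        ((s0Denom γ (e + t) : ℤ_[p]) * ((s0Denom γ (e + t))⁻¹ : ℤ_[p]ˣ)) := by
      simp only [D]; ring
    rw [h5, h2, h3, h4, s0Denom_val, s0Denom_val]
    ring
  rw [OMS.weightAct, hm]

/-- The weight `k` action on locally analytic functions. -/
noncomputable def weightActLocAn [FiniteDimensional ℚ_[p] L] (k : ℤ) (γ : S0 p) :
    LocAn p L →ₗ[L] LocAn p L where
  toFun f := ⟨weightAct k γ (f : ℤ_[p] → L), by
    have := FiniteDimensional.complete ℚ_[p] L
    obtain ⟨r, hr, hf⟩ := f.2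
    have h1 : 0 < min r 1 := lt_min hr one_pos
    refine ⟨min r 1 / 4, by positivity, fun e => ?_⟩
    obtain ⟨a, ha⟩ := hf (s0Moebius γ e)
    obtain ⟨M, hM⟩ := ha.1.bddAbove_range
    obtain ⟨b, hb, -⟩ := ha.weightAct k γ hr (M := M) fun n => hM ⟨n, rfl⟩
    exact ⟨b, hb⟩⟩
  map_add' f g := by
    ext z
    simp [weightAct]
  map_smul' c f := by
    ext z
    simp [weightAct]

/-- The right action of weight `k` of an element of `S₀(p)` on distributions,
`(μ|γ)(f) = μ(γ ·ₖ f)`. -/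
noncomputable def weightActDistr [FiniteDimensional ℚ_[p] L] (k : ℤ) (γ : S0 p) :
    Distr p L →ₗ[L] Distr p L :=
  (weightActLocAn (L := L) k γ).dualMap.restrict (by
    have := FiniteDimensional.complete ℚ_[p] L
    intro μ hμ r hr
    have h1 : 0 < min r 1 := lt_min hr one_pos
    obtain ⟨B, hB⟩ := hμ (min r 1 / 4) (by positivity)
    refine ⟨B, fun f M hf => hB (weightActLocAn k γ f) _ fun e => ?_⟩
    obtain ⟨a, ha, hM⟩ := hf (s0Moebius γ e)
    exact ha.weightAct k γ hr hM)

variable (L) in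
/-- `𝒟ₖ†(L)`: the right `S₀(p)`-module of distributions with the action of weight `k`. -/
noncomputable def distrRep [FiniteDimensional ℚ_[p] L] (k : ℤ) :
    S0 p →* (Module.End L (Distr p L))ᵐᵒᵖ where
  toFun γ := MulOpposite.op (weightActDistr k γ)
  map_one' := by
    apply MulOpposite.unop_injective
    refine LinearMap.ext fun μ => Subtype.ext (LinearMap.ext fun f => ?_)
    change (μ : Module.Dual L (LocAn p L)) (weightActLocAn k 1 f) = (μ : Module.Dual L (LocAn p L)) f
    congr 1
    ext z
    simp [weightActLocAn, weightAct, s0Denom_one, s0Moebius_one]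
  map_mul' γ δ := by
    apply MulOpposite.unop_injective
    refine LinearMap.ext fun μ => Subtype.ext (LinearMap.ext fun f => ?_)
    change (μ : Module.Dual L (LocAn p L)) (weightActLocAn k (γ * δ) f) =
      (μ : Module.Dual L (LocAn p L)) (weightActLocAn k γ (weightActLocAn k δ f))
    congr 1
    ext z
    simp [weightActLocAn, weightAct, s0Denom_mul, s0Moebius_mul, mul_zpow, mul_smul]

/-- The Dirac distribution `f ↦ f(z)`. -/
def dirac (z : ℤ_[p]) : Distr p L :=
  ⟨{ toFun := fun f => (f : ℤ_[p] → L) z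
     map_add' := fun _ _ => rfl
     map_smul' := fun _ _ => rfl }, fun r hr => ⟨1, fun f M hf => by
      obtain ⟨a, ha, hM⟩ := hf z
      have h1 := ha.2 z (by simpa using hr.le)
      have h2 : HasSum (fun n : ℕ => (((z - z : ℤ_[p]) : ℚ_[p]) ^ n) • a n) (a 0) := by
        convert hasSum_single (f := fun n : ℕ => (((z - z : ℤ_[p]) : ℚ_[p]) ^ n) • a n) 0 ?_ using 1
        · simp
        · intro n hn
          simp [hn]
      have h3 : (f : ℤ_[p] → L) z = a 0 := h1.unique h2
      simpa [h3] using hM 0⟩⟩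

/-- The distribution `δ_{z,j} : f ↦ (dʲf/dzʲ)(z)`. -/
noncomputable def diracDeriv [FiniteDimensional ℚ_[p] L] (z : ℤ_[p]) (j : ℕ) : Distr p L :=
  (derivDistr ^ j) (dirac z)

end WeightAction

section ModularSymbols
open scoped MatrixGroups

/-- Divisors on `ℙ¹(ℚ) = ℚ ∪ {∞}`. -/
abbrev CuspDiv : Type := OnePoint ℚ →₀ ℤ

/-- The group `Δ⁰` of divisors of degree `0`. -/
noncomputable def CuspDiv0 : AddSubgroup CuspDiv := (Finsupp.degree : CuspDiv →+ ℤ).ker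

/-- The left action of `GL₂(ℚ)` on divisors induced by `x ↦ (a x + b) / (c x + d)`. -/
noncomputable def divAct : GL (Fin 2) ℚ →* AddMonoid.End CuspDiv where
  toFun γ := Finsupp.mapDomain.addMonoidHom (γ • ·)
  map_one' := by
    refine AddMonoidHom.ext fun D => ?_
    change Finsupp.mapDomain ((1 : GL (Fin 2) ℚ) • ·) D = D
    simp only [one_smul]
    exact Finsupp.mapDomain_id
  map_mul' γ δ := by
    refine AddMonoidHom.ext fun D => ?_
    change Finsupp.mapDomain ((γ * δ) • ·) D =
      Finsupp.mapDomain (γ • ·) (Finsupp.mapDomain (δ • ·) D)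
    rw [← Finsupp.mapDomain_comp]
    simp only [Function.comp_def, mul_smul]

/-- The left action of `GL₂(ℚ)` on divisors of degree `0`. -/
noncomputable def div0Act : GL (Fin 2) ℚ →* AddMonoid.End CuspDiv0 where
  toFun γ := ((divAct γ).comp CuspDiv0.subtype).codRestrict CuspDiv0 fun D => by
    have hD : Finsupp.degree (D : CuspDiv) = 0 := D.2
    change Finsupp.degree (Finsupp.mapDomain (γ • ·) (D : CuspDiv)) = 0
    rw [← hD]
    simp
  map_one' := by
    refine AddMonoidHom.ext fun D => Subtype.ext ?_
    change divAct 1 (D : CuspDiv) = D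
    rw [map_one]; rfl
  map_mul' γ δ := by
    refine AddMonoidHom.ext fun D => Subtype.ext ?_
    change divAct (γ * δ) (D : CuspDiv) = divAct γ (divAct δ (D : CuspDiv))
    rw [map_mul]; rfl

variable {L : Type*} [Field L] {V W : Type*} [AddCommGroup V] [Module L V]
  [AddCommGroup W] [Module L W] {S : Submonoid (GL (Fin 2) ℚ)}

/-- For a group `A` with a left action `τ` and a right `S`-module `(V, ρ)`, the right `S`-module
`Hom(A, V)` with the action `(φ|γ)(D) = φ(γ D)|γ`. -/
def homRep {A : Type*} [AddCommGroup A] (τ : GL (Fin 2) ℚ →* AddMonoid.End A)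
    (ρ : S →* (Module.End L V)ᵐᵒᵖ) : S →* (Module.End L (A →+ V))ᵐᵒᵖ where
  toFun γ := MulOpposite.op
    { toFun := fun φ => ((ρ γ).unop.toAddMonoidHom.comp φ).comp (τ γ)
      map_add' := fun φ ψ => AddMonoidHom.ext fun D => map_add (ρ γ).unop _ _
      map_smul' := fun c φ => AddMonoidHom.ext fun D => map_smul (ρ γ).unop _ _ }
  map_one' := by
    apply MulOpposite.unop_injective
    refine LinearMap.ext fun φ => AddMonoidHom.ext fun D => ?_
    change (ρ 1).unop (φ (τ 1 D)) = φ D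
    rw [map_one, map_one]; rfl
  map_mul' γ δ := by
    apply MulOpposite.unop_injective
    refine LinearMap.ext fun φ => AddMonoidHom.ext fun D => ?_
    change (ρ (γ * δ)).unop (φ (τ (γ * δ : GL (Fin 2) ℚ) D)) =
      (ρ δ).unop ((ρ γ).unop (φ (τ γ (τ δ D))))
    rw [map_mul, map_mul]; rfl

/-- The invariants `W^Γ` of a right `S`-module `(W, σ)`. -/
def invariants (σ : S →* (Module.End L W)ᵐᵒᵖ) (Γ : Subgroup (GL (Fin 2) ℚ)) : Submodule L W where
  carrier := {w | ∀ γ : S, (γ : GL (Fin 2) ℚ) ∈ Γ → (σ γ).unop w = w}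
  zero_mem' := fun γ _ => map_zero _
  add_mem' := fun {v w} hv hw γ hγ => by rw [map_add, hv γ hγ, hw γ hγ]
  smul_mem' := fun c w hw γ hγ => by rw [map_smul, hw γ hγ]

/-- A system of representatives of the right cosets `Γ s'` contained in the double coset `Γ s Γ`
(for `Γ ⊆ S`). -/
def cosetReps (Γ : Subgroup (GL (Fin 2) ℚ)) (s : S) : Set S :=
  {r | (r : GL (Fin 2) ℚ) ∈ DoubleCoset.doubleCoset (s : GL (Fin 2) ℚ) Γ Γ ∧
    (Quotient.mk (QuotientGroup.rightRel Γ) (r : GL (Fin 2) ℚ)).out = r}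

/-- The Hecke operator `[Γ s Γ] : w ↦ ∑ᵢ w|sᵢ`, where `Γ s Γ = ∐ᵢ Γ sᵢ`. On the invariants `W^Γ`,
where it is used, it does not depend on the choice of the representatives `sᵢ`. -/
noncomputable def hecke (σ : S →* (Module.End L W)ᵐᵒᵖ) (Γ : Subgroup (GL (Fin 2) ℚ)) (s : S) :
    Module.End L W :=
  ∑ᶠ r ∈ cosetReps Γ s, (σ r).unop

/-- The module of modular symbols `Symb_Γ(V) = Hom(Δ⁰, V)^Γ`. -/
noncomputable def Symb (ρ : S →* (Module.End L V)ᵐᵒᵖ) (Γ : Subgroup (GL (Fin 2) ℚ)) :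
    Submodule L (CuspDiv0 →+ V) :=
  invariants (homRep div0Act ρ) Γ

variable (L V) in
/-- The restriction map `Hom(Δ, V) → Hom(Δ⁰, V)`. -/
noncomputable def restrictDiv0 : (CuspDiv →+ V) →ₗ[L] (CuspDiv0 →+ V) where
  toFun φ := φ.comp CuspDiv0.subtype
  map_add' _ _ := rfl
  map_smul' _ _ := rfl

/-- The module of boundary modular symbols `BSymb_Γ(V)`: the image of
`Hom(Δ, V)^Γ → Symb_Γ(V)`. -/
noncomputable def BSymb (ρ : S →* (Module.End L V)ᵐᵒᵖ) (Γ : Subgroup (GL (Fin 2) ℚ)) :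
    Submodule L (CuspDiv0 →+ V) :=
  (invariants (homRep divAct ρ) Γ).map (restrictDiv0 L V)

end ModularSymbols

section OverconvergentBoundary
open scoped MatrixGroups

variable (p : ℕ) [Fact p.Prime] (N : ℕ)

/-- `Γ = Γ₁(N) ∩ Γ₀(p)`, as a subgroup of `GL₂(ℚ)`. -/
noncomputable def levelGroup : Subgroup (GL (Fin 2) ℚ) :=
  (CongruenceSubgroup.Gamma1 N ⊓ CongruenceSubgroup.Gamma0 p).map
    (Matrix.SpecialLinearGroup.mapGL ℚ)

/-- The matrix `(1 0; 0 p)`, defining `U_p`, as an element of `S₀(p)`. -/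
noncomputable def upMatrix : S0 p :=
  ⟨Matrix.GeneralLinearGroup.mkOfDetNeZero !![1, 0; 0, (p : ℚ)] (by
    simp [(Fact.out : p.Prime).ne_zero]), by
    refine ⟨fun i j => ?_, ?_, ?_⟩
    · have hp : ‖(p : ℚ_[p])‖ ≤ 1 := Padic.norm_p_lt_one.le
      fin_cases i <;> fin_cases j <;>
        simp [Matrix.GeneralLinearGroup.mkOfDetNeZero, -Padic.norm_p, hp]
    · simp [Matrix.GeneralLinearGroup.mkOfDetNeZero]
    · simp [Matrix.GeneralLinearGroup.mkOfDetNeZero]⟩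

/-- The elements `s` of `S₀(p)` for which `[Γ s Γ]` is one of the standard operators: `T_ℓ` (for
`ℓ ∤ N p`) and `U_ℓ` (for `ℓ ∣ N p`) for `s = (1 0; 0 ℓ)`, the diamond operators `⟨a⟩` for
`s ∈ Γ₀(N p)`, and the involution `ι` for `s = (1 0; 0 -1)`. -/
def IsStandardHecke (s : S0 p) : Prop :=
  (∃ ℓ : ℕ, ℓ.Prime ∧
    ((s : GL (Fin 2) ℚ) : Matrix (Fin 2) (Fin 2) ℚ) = !![1, 0; 0, (ℓ : ℚ)]) ∨
  (s : GL (Fin 2) ℚ) ∈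
    (CongruenceSubgroup.Gamma0 (N * p)).map (Matrix.SpecialLinearGroup.mapGL ℚ) ∨
  ((s : GL (Fin 2) ℚ) : Matrix (Fin 2) (Fin 2) ℚ) = !![1, 0; 0, -1]

variable (L : Type*) [NormedField L] [NormedAlgebra ℚ_[p] L] [FiniteDimensional ℚ_[p] L]

/-- The right `S₀(p)`-module `Hom(Δ⁰, 𝒟ₖ†(L))`. -/
noncomputable def distrHomRep (k : ℤ) : S0 p →* (Module.End L (CuspDiv0 →+ Distr p L))ᵐᵒᵖ :=
  homRep div0Act (distrRep L k)

/-- The Hecke operator `[Γ s Γ]` on overconvergent modular symbols of weight `k`. -/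
noncomputable def heckeDistr (k : ℤ) (s : S0 p) : Module.End L (CuspDiv0 →+ Distr p L) :=
  hecke (distrHomRep p L k) (levelGroup p N) s

/-- `BSymb_Γ(𝒟ₖ†)^{slope ν}`: the linear span of the vectors of `BSymb_Γ(𝒟ₖ†)` that are killed by
`P(U_p)` for some non-zero `P ∈ L[X]` all of whose roots in `L̄` have `p`-adic valuation `ν` (that
is, absolute value `p^{-ν}` for the absolute value of `L̄` that extends the one of `ℚ_p`). -/
noncomputable def BSymbSlope (k : ℤ) (ν : ℕ) : Submodule L (CuspDiv0 →+ Distr p L) :=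
  Submodule.span L {Φ | Φ ∈ BSymb (distrRep (p := p) L k) (levelGroup p N) ∧
    ∃ P : Polynomial L, P ≠ 0 ∧
      (∀ x ∈ P.aroots (AlgebraicClosure L),
        spectralNorm ℚ_[p] (AlgebraicClosure L) x = ((p : ℝ) ^ ν)⁻¹) ∧
      (Polynomial.aeval (heckeDistr p N L k (upMatrix p)) P) Φ = 0}

/-- The ordinary part `BSymb_Γ(𝒟ₖ†)^{ord}`. -/
noncomputable def BSymbOrd (k : ℤ) : Submodule L (CuspDiv0 →+ Distr p L) := BSymbSlope p N L k 0

/-- The critical part `BSymb_Γ(𝒟ₖ†)^{crit}`, `k ≥ 0`. -/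
noncomputable def BSymbCrit (k : ℕ) : Submodule L (CuspDiv0 →+ Distr p L) :=
  BSymbSlope p N L k (k + 1)

/-- The map `Θₖ`, induced by the `(k+1)`-st iterate of the derivation of distributions, on
symbols: `Θₖ(Φ)(D)(f) = Φ(D)(d^{k+1}f/dz^{k+1})`. -/
noncomputable def theta (k : ℕ) : (CuspDiv0 →+ Distr p L) →ₗ[L] (CuspDiv0 →+ Distr p L) where
  toFun Φ := ((derivDistr ^ (k + 1) : Module.End L (Distr p L)).toAddMonoidHom).comp Φ
  map_add' Φ Ψ := by ext D; simp
  map_smul' c Φ := by ext D; simp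

end OverconvergentBoundary

end OMS

/-! A Γ-invariant homomorphism φ on Δ is determined by its values φ(c) at the cusps, and φ(c) is
fixed by the stabiliser of c in Γ, which contains unipotent matrices tending p-adically to 1.
Expanding the invariance to first order along such a sequence shows that φ(c) kills the image of a
first-order differential operator (`apply_lieAct_eq_zero`). If c is ∞ or lies outside C₀, a matrix
of S₀(p) brings the situation to upper unipotents, the operator is f ↦ -f', and it is surjective on
locally analytic functions because constants of integration may be chosen ball by ball; hence φ(c) =
0. If c ∈ C₀, translation to 0 gives lower unipotents and the operator f ↦ z²f' - mzf. Its image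
contains every g whose Taylor coefficients at 0 of degree 0 and, when m ≥ 0, of degree m + 1 vanish.
Hence φ(c) is a multiple of δ_c for m < 0, and a combination of δ_c and δ_{c,k+1} for m = k ≥ 0.

Next comes U_p. Of the p terms of (U_p φ)(c) only the one with (c + i)/p ∈ ℤ_p survives, and the
test function (z - c)^ν is carried to p^ν (z - (c + i)/p)^ν. If p^n ≡ 1 mod N, then n steps lead to
a cusp that is Γ-equivalent to c by a matrix with automorphy factor 1 there. So U_p^n fixes the
δ_c-component and multiplies the δ_{c,k+1}-component by p^{n(k+1)} (`exists_upDiv_pow_apply_eq`).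
Consequently the ordinary part in negative weight is all of BSymb (`BSymbOrd_eq`), and by a Bézout
argument between X^n - 1 and a polynomial with roots of valuation k + 1, the critical part consists
of the symbols without δ_c-components (`BSymbCrit_eq`). Restriction to Δ⁰ loses nothing, since φ(∞)
= 0.

Finally Θ_k sends δ_c to δ_{c,k+1}. It is injective because differentiation of functions is
surjective, and Bol's identity (`derivLocAn_pow_weightActLocAn`) intertwines weights -2-k and k up
to det^{k+1}. A critical symbol therefore lifts cusp by cusp, and injectivity makes the lift
Γ-invariant. -/

namespace OMS

open Filter Topology

/-! ### Gauss norms of power series over ℤ_p. -/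

section GaussBound
variable {p : ℕ} [Fact p.Prime]

/-- The Gauss norm of radius `s` of the power series `q` is at most `B`. -/
def GaussLE (s B : ℝ) (q : PowerSeries ℤ_[p]) : Prop :=
  ∀ l, ‖PowerSeries.coeff l q‖ * s ^ l ≤ B

theorem gaussLE_one_of_le_one {s : ℝ} (h0 : 0 ≤ s) (h1 : s ≤ 1) (q : PowerSeries ℤ_[p]) :
    GaussLE s 1 q := fun l =>
  mul_le_one₀ (PadicInt.norm_le_one _) (by positivity) (pow_le_one₀ h0 h1)

theorem GaussLE.mono {s B B' : ℝ} {q : PowerSeries ℤ_[p]} (h : GaussLE s B q) (hB : B ≤ B') :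
    GaussLE s B' q := fun l => (h l).trans hB

theorem GaussLE.nonneg {s B : ℝ} {q : PowerSeries ℤ_[p]} (h : GaussLE s B q) : 0 ≤ B :=
  le_trans (by simp) (h 0)

theorem GaussLE.add {s B : ℝ} {q q' : PowerSeries ℤ_[p]} (h0 : 0 ≤ s) (h : GaussLE s B q)
    (h' : GaussLE s B q') : GaussLE s B (q + q') := fun l => by
  rw [map_add]
  calc _ ≤ max ‖PowerSeries.coeff l q‖ ‖PowerSeries.coeff l q'‖ * s ^ l := by
        gcongr; exact PadicInt.nonarchimedean _ _
    _ ≤ B := by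
        rw [max_mul_of_nonneg _ _ (by positivity)]
        exact max_le (h l) (h' l)

theorem GaussLE.neg {s B : ℝ} {q : PowerSeries ℤ_[p]} (h : GaussLE s B q) : GaussLE s B (-q) :=
  fun l => by simpa using h l

theorem GaussLE.sub {s B : ℝ} {q q' : PowerSeries ℤ_[p]} (h0 : 0 ≤ s) (h : GaussLE s B q)
    (h' : GaussLE s B q') : GaussLE s B (q - q') := by
  rw [sub_eq_add_neg]; exact h.add h0 h'.neg

/-- By the ultrametric inequality, a coefficient of the product is bounded by its largest term, so
no factor for the number of terms appears. -/
theorem GaussLE.mul {s B B' : ℝ} {q q' : PowerSeries ℤ_[p]} (h0 : 0 < s) (h : GaussLE s B q)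
    (h' : GaussLE s B' q') : GaussLE s (B * B') (q * q') := fun l => by
  have hB := h.nonneg
  have hB' := h'.nonneg
  rw [← le_div_iff₀ (by positivity), PowerSeries.coeff_mul]
  refine IsUltrametricDist.norm_sum_le_of_forall_le_of_nonneg (by positivity) fun x hx => ?_
  rw [le_div_iff₀ (by positivity), ← Finset.HasAntidiagonal.mem_antidiagonal.mp hx, pow_add,
    norm_mul]
  calc _ = (‖PowerSeries.coeff x.1 q‖ * s ^ x.1) * (‖PowerSeries.coeff x.2 q'‖ * s ^ x.2) := by ring
    _ ≤ B * B' := by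
      gcongr
      · exact h _
      · exact h' _

theorem GaussLE.pow {s B : ℝ} {q : PowerSeries ℤ_[p]} (h0 : 0 < s) (h1 : s ≤ 1)
    (h : GaussLE s B q) (n : ℕ) : GaussLE s (B ^ n) (q ^ n) := by
  induction n with
  | zero => simpa using gaussLE_one_of_le_one h0.le h1 1
  | succ n ih => rw [pow_succ, pow_succ]; exact ih.mul h0 h

theorem gaussLE_C {s : ℝ} (c : ℤ_[p]) : GaussLE s ‖c‖ (PowerSeries.C c) := fun l => by
  rw [PowerSeries.coeff_C]
  split_ifs with h <;> simp [h]

theorem gaussLE_X {s : ℝ} (h0 : 0 ≤ s) : GaussLE s s (PowerSeries.X : PowerSeries ℤ_[p]) :=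
    fun l => by
  rw [PowerSeries.coeff_X]
  split_ifs with h <;> simp [h, h0]

theorem EvalsTo.add {q q' : PowerSeries ℤ_[p]} {t v v' : ℤ_[p]}
    (h : EvalsTo q t v) (h' : EvalsTo q' t v') : EvalsTo (q + q') t (v + v') := by
  have := HasSum.add h h'
  refine (congrArg (fun F : ℕ → ℤ_[p] => HasSum F _) (funext fun n => ?_)).mpr this
  simp [add_mul]

end GaussBound

/-! ### Local analyticity as a pointwise condition. -/

section LocalCriterion

theorem nhds_coe_eq_map {p : ℕ} [Fact p.Prime] (e : ℤ_[p]) :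
    𝓝 (e : ℚ_[p]) = Filter.map (fun z : ℤ_[p] => (z : ℚ_[p])) (𝓝 e) :=
  (((PadicInt.isOpenEmbedding_coe).map_nhds_eq e)).symm

variable {p : ℕ} [Fact p.Prime] {L : Type*} [NormedField L]

/-- The extension by zero of a function on `ℤ_p` to `ℚ_p`. -/
noncomputable abbrev ext0 (f : ℤ_[p] → L) : ℚ_[p] → L :=
  Function.extend (fun x : ℤ_[p] => (x : ℚ_[p])) f 0

theorem ext0_coe (f : ℤ_[p] → L) (z : ℤ_[p]) : ext0 f (z : ℚ_[p]) = f z := extend_coe_apply f z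

theorem ext0_eventuallyEq {f : ℤ_[p] → L} {F : ℚ_[p] → L} {e : ℤ_[p]}
    (h : ∀ᶠ z in 𝓝 e, f z = F z) : ext0 f =ᶠ[𝓝 (e : ℚ_[p])] F := by
  rw [Filter.EventuallyEq, nhds_coe_eq_map, Filter.eventually_map]
  filter_upwards [h] with z hz
  rw [ext0_coe, hz]

variable [NormedAlgebra ℚ_[p] L]

/-- A function that is, near `e`, a sum `∑ Pₙ(t) aₙ` of power series over `ℤ_p` with geometrically
decreasing Gauss norms, has an expansion at `e`. -/
theorem exists_hasExpansion_of_hasSum [CompleteSpace L] {s M : ℝ} (hs0 : 0 < s)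
    {g : ℤ_[p] → L} {e : ℤ_[p]} {a : ℕ → L} {P : ℕ → PowerSeries ℤ_[p]}
    (hM : ∀ n l, ‖a n‖ * (‖PowerSeries.coeff l (P n)‖ * s ^ l) ≤ M * (1 / 2) ^ n)
    (hg : ∀ t : ℤ_[p], ‖t‖ ≤ s / 2 → ∃ v : ℕ → ℤ_[p], (∀ n, EvalsTo (P n) t (v n)) ∧
      HasSum (fun n => ((v n : ℤ_[p]) : ℚ_[p]) • a n) (g (e + t))) :
    ∃ b : ℕ → L, HasExpansion (s / 2) g e b ∧ ∀ l, ‖b l‖ * (s / 2) ^ l ≤ 2 * M := by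
  have hM0 : 0 ≤ M := by
    have := hM 0 0
    simp only [pow_zero, mul_one] at this
    exact le_trans (by positivity) this
  let c : ℕ → ℕ → L := fun n l => ((PowerSeries.coeff l (P n) : ℤ_[p]) : ℚ_[p]) • a n
  have hc : ∀ n l, ‖c n l‖ * s ^ l ≤ M * (1 / 2) ^ n := fun n l => by
    refine le_trans (le_of_eq ?_) (hM n l)
    simp only [c, norm_smul]
    change ‖PowerSeries.coeff l (P n)‖ * _ * _ = _
    ring
  have hc' : ∀ l n, ‖c n l‖ ≤ M / s ^ l * (1 / 2) ^ n := fun l n => by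
    have := hc n l
    rw [← le_div_iff₀ (by positivity)] at this
    refine this.trans (le_of_eq (by ring))
  have hgeo : HasSum (fun n : ℕ => (1 / 2 : ℝ) ^ n) 2 := hasSum_geometric_two
  have hsum : ∀ l, Summable fun n => c n l := fun l =>
    Summable.of_norm_bounded (hgeo.summable.mul_left (M / s ^ l)) (hc' l)
  -- The double series ∑ c n l t^l is summed over n first. The geometric factor gives the 2 in the
  -- bound 2M, and halving the radius makes the double series absolutely summable.
  let b : ℕ → L := fun l => ∑' n, c n l
  have hb : ∀ l, ‖b l‖ * (s / 2) ^ l ≤ 2 * M * (1 / 2) ^ l := fun l => by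
    have h1 : ‖b l‖ ≤ M / s ^ l * 2 :=
      tsum_of_norm_bounded (hgeo.mul_left (M / s ^ l)) (hc' l)
    calc ‖b l‖ * (s / 2) ^ l ≤ M / s ^ l * 2 * (s / 2) ^ l := by gcongr
      _ = 2 * M * (1 / 2) ^ l := by rw [div_pow, div_pow]; field_simp; ring
  refine ⟨b, ⟨?_, fun z hz => ?_⟩, fun l => (hb l).trans ?_⟩
  · refine squeeze_zero (fun n => by positivity) hb ?_
    have := (tendsto_pow_atTop_nhds_zero_of_lt_one (r := (1 / 2 : ℝ)) (by norm_num)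
      (by norm_num)).const_mul (2 * M)
    simpa using this
  · obtain ⟨t, rfl⟩ : ∃ t, z = e + t := ⟨z - e, by ring⟩
    rw [add_sub_cancel_left] at hz ⊢
    obtain ⟨v, hv, hgt⟩ := hg t hz
    let F : ℕ × ℕ → L := fun x => ((t : ℚ_[p]) ^ x.2) • c x.1 x.2
    have hF : Summable F := by
      have hprod := (hgeo.summable.mul_of_nonneg hgeo.summable (fun _ => by positivity)
        (fun _ => by positivity)).mul_left M
      refine Summable.of_norm_bounded hprod fun x => ?_
      simp only [F, norm_smul, norm_pow]
      have h1 : ‖(t : ℚ_[p])‖ ≤ s / 2 := hz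
      calc ‖(t : ℚ_[p])‖ ^ x.2 * ‖c x.1 x.2‖ ≤ (s / 2) ^ x.2 * ‖c x.1 x.2‖ := by gcongr
        _ = (‖c x.1 x.2‖ * s ^ x.2) * (1 / 2) ^ x.2 := by rw [div_pow, div_pow]; ring
        _ ≤ (M * (1 / 2) ^ x.1) * (1 / 2) ^ x.2 := mul_le_mul_of_nonneg_right (hc _ _) (by positivity)
        _ = _ := by ring
    have hrow : ∀ n, HasSum (fun l => F (n, l)) (((v n : ℤ_[p]) : ℚ_[p]) • a n) := fun n => by
      have h2 := (hv n).map (PadicInt.Coe.ringHom (p := p)) continuous_subtype_val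
      have h3 := h2.smul_const (a n)
      refine (congrArg (fun F : ℕ → L => HasSum F _) (funext fun l => ?_)).mpr h3
      change ((t : ℚ_[p]) ^ l) • ((PowerSeries.coeff l (P n) : ℤ_[p]) : ℚ_[p]) • a n =
        ((PowerSeries.coeff l (P n) * t ^ l : ℤ_[p]) : ℚ_[p]) • a n
      rw [smul_smul]
      push_cast
      ring_nf
    have htot : HasSum F (g (e + t)) := by
      rw [hgt.unique (hF.hasSum.prod_fiberwise hrow)]
      exact hF.hasSum
    have hswap := (Equiv.prodComm ℕ ℕ).hasSum_iff.mpr htot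
    exact hswap.prod_fiberwise fun l => (hsum l).hasSum.const_smul ((t : ℚ_[p]) ^ l)
  · exact mul_le_of_le_one_right (by positivity) (pow_le_one₀ (by norm_num) (by norm_num))

theorem HasExpansion.exists_bound {r : ℝ} {f : ℤ_[p] → L} {e : ℤ_[p]} {a : ℕ → L}
    (h : HasExpansion r f e a) : ∃ M, ∀ n, ‖a n‖ * r ^ n ≤ M := by
  obtain ⟨M, hM⟩ := h.1.bddAbove_range
  exact ⟨M, fun n => hM ⟨n, rfl⟩⟩

/-- Each (z - e)ⁿ is re-expanded as ((e' - e) + t)ⁿ. With s = min r 1 / 2 both summands have Gauss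
norm at most s, so the n-th power has norm at most sⁿ, and the gap between s and r supplies the
factor (1/2)ⁿ. -/
theorem HasExpansion.recenter [CompleteSpace L] {r M : ℝ} (hr : 0 < r) {f : ℤ_[p] → L}
    {e e' : ℤ_[p]} {a : ℕ → L} (h : HasExpansion r f e a) (hM : ∀ n, ‖a n‖ * r ^ n ≤ M)
    (he : ‖e' - e‖ ≤ min r 1 / 2) :
    ∃ b : ℕ → L, HasExpansion (min r 1 / 2 / 2) f e' b ∧
      ∀ n, ‖b n‖ * (min r 1 / 2 / 2) ^ n ≤ 2 * M := by
  have hs : 0 < min r 1 := lt_min hr one_pos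
  have hs1 : min r 1 ≤ 1 := min_le_right _ _
  have hsr : min r 1 ≤ r := min_le_left _ _
  refine exists_hasExpansion_of_hasSum (a := a)
    (P := fun n => (PowerSeries.C (e' - e) + PowerSeries.X) ^ n) (by positivity)
    (fun n l => ?_) fun t ht => ⟨fun n => (e' - e + t) ^ n, fun n => ?_, ?_⟩
  · have hG : GaussLE (min r 1 / 2) (min r 1 / 2)
        (PowerSeries.C (e' - e) + PowerSeries.X : PowerSeries ℤ_[p]) :=
      ((gaussLE_C _).mono he).add (by positivity) (gaussLE_X (by positivity))
    calc _ ≤ ‖a n‖ * (min r 1 / 2) ^ n := by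
          gcongr
          exact hG.pow (by positivity) (by linarith) n l
      _ = ‖a n‖ * (min r 1) ^ n * (1 / 2) ^ n := by rw [div_pow, div_pow]; ring
      _ ≤ ‖a n‖ * r ^ n * (1 / 2) ^ n := by gcongr
      _ ≤ _ := by gcongr; exact hM n
  · have ht1 : ‖t‖ < 1 := by linarith
    exact ((evalsTo_C _ t).add (evalsTo_X t)).pow ht1 n
  · have hz := h.2 (e' + t) (by
      have h1 : e' + t - e = (e' - e) + t := by ring
      rw [h1]
      refine (PadicInt.nonarchimedean _ _).trans (max_le ?_ ?_) <;> linarith)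
    refine (congrArg (fun F : ℕ → L => HasSum F _) (funext fun n => ?_)).mpr hz
    have h1 : e' + t - e = (e' - e) + t := by ring
    rw [h1, PadicInt.coe_pow]

/-- A function with an expansion of positive radius at every point lies in some `A[r](L)`. -/
theorem exists_analyticNormLE [CompleteSpace L] {f : ℤ_[p] → L}
    (h : ∀ e, ∃ r : ℝ, 0 < r ∧ ∃ a, HasExpansion r f e a) :
    ∃ r : ℝ, 0 < r ∧ ∃ M, AnalyticNormLE r f M := by
  suffices H : ∃ r : ℝ, 0 < r ∧ ∃ M, ∀ e ∈ (Set.univ : Set ℤ_[p]), ∃ a : ℕ → L,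
      HasExpansion r f e a ∧ ∀ n, ‖a n‖ * r ^ n ≤ M by
    obtain ⟨r, hr, M, H⟩ := H
    exact ⟨r, hr, M, fun e => H e trivial⟩
  -- Compactness of ℤ_p: a common radius and bound exist near each point by recentring, and survive
  -- finite unions by taking the smaller radius and the larger bound.
  refine isCompact_univ.induction_on (p := fun S => ∃ r : ℝ, 0 < r ∧ ∃ M, ∀ e ∈ S, ∃ a : ℕ → L,
      HasExpansion r f e a ∧ ∀ n, ‖a n‖ * r ^ n ≤ M) ⟨1, one_pos, 0, by simp⟩ ?_ ?_ ?_
  · rintro S T hST ⟨r, hr, M, H⟩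
    exact ⟨r, hr, M, fun e he => H e (hST he)⟩
  · rintro S T ⟨r, hr, M, H⟩ ⟨r', hr', M', H'⟩
    have h0 : 0 < min r r' := lt_min hr hr'
    refine ⟨min r r', h0, max M M', ?_⟩
    rintro e (he | he)
    · obtain ⟨a, ha, hM⟩ := H e he
      refine ⟨a, ha.mono h0.le (min_le_left _ _), fun n => le_trans ?_ ((hM n).trans (le_max_left _ _))⟩
      gcongr
      exact min_le_left _ _
    · obtain ⟨a, ha, hM⟩ := H' e he
      refine ⟨a, ha.mono h0.le (min_le_right _ _), fun n => le_trans ?_ ((hM n).trans (le_max_right _ _))⟩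
      gcongr
      exact min_le_right _ _
  · intro e _
    obtain ⟨r, hr, a, ha⟩ := h e
    obtain ⟨M, hM⟩ := ha.exists_bound
    have h0 : 0 < min r 1 / 2 := by have := lt_min hr one_pos; positivity
    refine ⟨Metric.closedBall e (min r 1 / 2),
      mem_nhdsWithin_of_mem_nhds (Metric.closedBall_mem_nhds e h0), min r 1 / 2 / 2,
      by positivity, 2 * M, fun e' he' => ?_⟩
    exact ha.recenter hr hM (by rwa [Metric.mem_closedBall, dist_eq_norm] at he')

/-- Since ℤ_p is compact, the radius may depend on the point; membership in the union of the
`A[r](L)` becomes a local question. -/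
theorem mem_locAn_iff_forall [CompleteSpace L] {f : ℤ_[p] → L} :
    f ∈ LocAn p L ↔ ∀ e, ∃ r : ℝ, 0 < r ∧ ∃ a, HasExpansion r f e a := by
  constructor
  · rintro ⟨r, hr, hf⟩ e
    exact ⟨r, hr, hf e⟩
  · intro h
    obtain ⟨r, hr, M, hf⟩ := exists_analyticNormLE h
    exact ⟨r, hr, hf.isAnalyticOfRadius⟩

theorem exists_hasExpansion_iff_analyticAt {f : ℤ_[p] → L} {e : ℤ_[p]} :
    (∃ r : ℝ, 0 < r ∧ ∃ a, HasExpansion r f e a) ↔ AnalyticAt ℚ_[p] (ext0 f) (e : ℚ_[p]) := by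
  constructor
  · rintro ⟨r, hr, a, ha⟩
    exact (ha.hasFPowerSeriesOnBall hr).analyticAt
  · rintro ⟨P, R, hP⟩
    obtain ⟨r, hr0, hr⟩ := ENNReal.lt_iff_exists_nnreal_btwn.mp hP.r_pos
    have hr0' : 0 < (r : ℝ) := by exact_mod_cast hr0
    obtain ⟨r', hr'0, hr'r⟩ := exists_between hr0'
    refine ⟨r', hr'0, P.coeff, ?_, fun z hz => ?_⟩
    · have := P.isLittleO_one_of_lt_radius (hr.trans_le hP.r_le)
      have h1 : Tendsto (fun n => ‖P n‖ * (r : ℝ) ^ n) atTop (𝓝 0) := by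
        simpa using this.tendsto_div_nhds_zero
      refine squeeze_zero (fun n => by positivity) (fun n => ?_) h1
      rw [← FormalMultilinearSeries.norm_apply_eq_norm_coef]
      gcongr
    · have h1 : ((z - e : ℤ_[p]) : ℚ_[p]) ∈ Metric.eball (0 : ℚ_[p]) R := by
        rw [mem_eball_zero_iff]
        refine lt_of_lt_of_le ?_ hr.le
        rw [← ofReal_norm, ENNReal.ofReal_lt_coe_iff (norm_nonneg _)]
        exact lt_of_le_of_lt (show ‖((z - e : ℤ_[p]) : ℚ_[p])‖ ≤ r' from hz) hr'r
      have h2 := hP.hasSum h1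
      have he : (e : ℚ_[p]) + ((z - e : ℤ_[p]) : ℚ_[p]) = z := by simp
      rw [he, ext0_coe] at h2
      simpa using h2

/-- This gives access to the calculus of analytic functions on ℚ_p: products, powers and derivatives
need no estimates by hand. -/
theorem mem_locAn_iff_analyticAt [CompleteSpace L] {f : ℤ_[p] → L} :
    f ∈ LocAn p L ↔ ∀ e : ℤ_[p], AnalyticAt ℚ_[p] (ext0 f) (e : ℚ_[p]) := by
  simp_rw [mem_locAn_iff_forall, exists_hasExpansion_iff_analyticAt]

theorem mem_locAn_of_analyticAt [CompleteSpace L] {F : ℚ_[p] → L}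
    (h : ∀ e : ℤ_[p], AnalyticAt ℚ_[p] F (e : ℚ_[p])) : (fun z : ℤ_[p] => F z) ∈ LocAn p L :=
  mem_locAn_iff_analyticAt.mpr fun e =>
    (h e).congr (ext0_eventuallyEq (Eventually.of_forall fun _ => rfl)).symm

end LocalCriterion

end OMS

namespace OMS

open Filter Topology

/-! ### Expansions to second order in a small parameter h. -/

section SecondOrder
variable {p : ℕ} [Fact p.Prime]

/-- For l ≥ 0 this is the binomial theorem. For l < 0 it is applied to u⁻¹ = 1 + h(x u⁻¹), and the
same relation is used again to replace u⁻¹ by 1 in the linear term. -/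
theorem exists_units_zpow_expansion {R : Type*} [CommRing R] (u : Rˣ) (h x : R)
    (hu : (u : R) = 1 - h * x) (l : ℤ) :
    ∃ w : R, ((u ^ l : Rˣ) : R) = 1 - l * (h * x) + h ^ 2 * w := by
  obtain ⟨n, rfl | rfl⟩ := l.eq_nat_or_neg
  · obtain ⟨k, hk⟩ := Polynomial.powAddExpansion 1 (-(h * x)) n
    refine ⟨k * x ^ 2, ?_⟩
    rw [zpow_natCast, Units.val_pow_eq_pow_val, hu, sub_eq_add_neg, hk]
    simp
    ring
  · have h1 : ((u⁻¹ : Rˣ) : R) = 1 + h * (x * ((u⁻¹ : Rˣ) : R)) := by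
      have := u.mul_inv
      rw [hu] at this
      linear_combination this
    obtain ⟨k, hk⟩ := Polynomial.powAddExpansion 1 (h * (x * ((u⁻¹ : Rˣ) : R))) n
    refine ⟨k * (x * ((u⁻¹ : Rˣ) : R)) ^ 2 + n * (x * (x * ((u⁻¹ : Rˣ) : R))), ?_⟩
    rw [zpow_neg, zpow_natCast, ← inv_pow, Units.val_pow_eq_pow_val]
    nth_rewrite 1 [h1]
    rw [hk]
    simp
    have h2 : ((u⁻¹ : Rˣ) : R) = 1 + h * x + h ^ 2 * (x * (x * ((u⁻¹ : Rˣ) : R))) := by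
      linear_combination (1 + h * x) * h1
    linear_combination (n * h * x) * h1

/-- The point is the size of the remainder: the binomial terms of Q are homogeneous of degree n - 2
in two series of Gauss norm at most s. The decay in n lets these expansions be summed against the
Taylor coefficients of f. The bound is written sⁿ / s² so that it makes sense for n < 2. -/
theorem exists_add_pow_expansion {s : ℝ} (h0 : 0 < s) (h1 : s ≤ 1) (h : ℤ_[p]) (hs : ‖h‖ ≤ s)
    (y : PowerSeries ℤ_[p]) (n : ℕ) :
    ∃ Q : PowerSeries ℤ_[p], GaussLE s (s ^ n / s ^ 2) Q ∧
      (PowerSeries.X + PowerSeries.C h * y) ^ n = PowerSeries.X ^ n +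
        (n : PowerSeries ℤ_[p]) * PowerSeries.X ^ (n - 1) * (PowerSeries.C h * y) + (PowerSeries.C h * y) ^ 2 * Q := by
  have hX : GaussLE s s (PowerSeries.X : PowerSeries ℤ_[p]) := gaussLE_X h0.le
  have hY : GaussLE s s (PowerSeries.X + PowerSeries.C h * y) := by
    refine hX.add h0.le ?_
    simpa using ((gaussLE_C h).mono hs).mul h0 (gaussLE_one_of_le_one h0.le h1 y)
  induction n with
  | zero => exact ⟨0, fun l => by simp; positivity, by simp⟩
  | succ n ih =>
    obtain ⟨Q, hQ, he⟩ := ih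
    -- With Y = hy, this is the recursion for the coefficient of Y² in (Xⁿ + nXⁿ⁻¹Y + Y²Q)(X + Y).
    refine ⟨Q * (PowerSeries.X + PowerSeries.C h * y) +
      (n : PowerSeries ℤ_[p]) * PowerSeries.X ^ (n - 1), ?_, ?_⟩
    · refine GaussLE.add h0.le ((hQ.mul h0 hY).mono (by rw [pow_succ]; apply le_of_eq; ring)) ?_
      rcases n with _ | n
      · intro l; simp; positivity
      · refine ((gaussLE_one_of_le_one h0.le h1 _).mul h0 (hX.pow h0 h1 n)).mono ?_
        rw [one_mul, pow_add, pow_add]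
        apply le_of_eq
        field_simp
    · rw [pow_succ, he]
      rcases n with _ | n
      · simp
        ring
      · simp only [add_tsub_cancel_right]
        push_cast
        ring

/-- The second-order expansion in `h` of `(1 - h x)ˡ (X + h y)ⁿ`. -/
theorem exists_second_order_expansion {s : ℝ} (h0 : 0 < s) (h1 : s ≤ 1) (h : ℤ_[p]) (hs : ‖h‖ ≤ s)
    (x y : PowerSeries ℤ_[p]) (u : (PowerSeries ℤ_[p])ˣ)
    (hu : (u : PowerSeries ℤ_[p]) = 1 - PowerSeries.C h * x) (l : ℤ) (n : ℕ) :
    ∃ W : PowerSeries ℤ_[p], GaussLE s (s ^ n / s ^ 2) W ∧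
      ((u ^ l : (PowerSeries ℤ_[p])ˣ) : PowerSeries ℤ_[p]) *
          (PowerSeries.X + PowerSeries.C h * y) ^ n =
        PowerSeries.X ^ n + PowerSeries.C h *
          (PowerSeries.C (n : ℤ_[p]) * PowerSeries.X ^ (n - 1) * y -
            PowerSeries.C (l : ℤ_[p]) * x * PowerSeries.X ^ n) + PowerSeries.C h ^ 2 * W := by
  obtain ⟨R, hR⟩ := exists_units_zpow_expansion u (PowerSeries.C h) x hu l
  obtain ⟨Q, hQ, he⟩ := exists_add_pow_expansion h0 h1 h hs y n
  have hX : GaussLE s s (PowerSeries.X : PowerSeries ℤ_[p]) := gaussLE_X h0.le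
  have hY : GaussLE s s (PowerSeries.X + PowerSeries.C h * y) := by
    refine hX.add h0.le ?_
    simpa using ((gaussLE_C h).mono hs).mul h0 (gaussLE_one_of_le_one h0.le h1 y)
  have hG : ∀ (q q' : PowerSeries ℤ_[p]) (B : ℝ), GaussLE s B q' → GaussLE s B (q * q') :=
    fun q q' B hq => by simpa using (gaussLE_one_of_le_one h0.le h1 q).mul h0 hq
  have hs2 : s ^ n ≤ s ^ n / s ^ 2 :=
    le_div_self (by positivity) (by positivity) (pow_le_one₀ h0.le h1)
  -- W collects every term of the product of the two expansions that is divisible by h². The factor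
  -- `if n = 0 then 0 else 1` changes nothing, because of the coefficient n; it disposes of the
  -- truncated exponent n - 1 at n = 0.
  refine ⟨y ^ 2 * Q - ((l : PowerSeries ℤ_[p]) * x * (n : PowerSeries ℤ_[p]) * y) * PowerSeries.X ^ (n - 1) * (if n = 0 then 0 else 1) +
    R * (PowerSeries.X + PowerSeries.C h * y) ^ n -
    ((l : PowerSeries ℤ_[p]) * PowerSeries.C h * x * y ^ 2) * Q, ?_, ?_⟩
  · refine GaussLE.sub h0.le (GaussLE.add h0.le (GaussLE.sub h0.le (hG _ _ _ hQ) ?_)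
      (hG R _ _ ((hY.pow h0 h1 n).mono hs2))) (hG _ _ _ hQ)
    rcases n with _ | n
    · intro i; simp; positivity
    · simp only [add_tsub_cancel_right]
      simp
      refine hG _ _ _ ((hX.pow h0 h1 n).mono ?_)
      rw [le_div_iff₀ (by positivity), ← pow_add]
      exact pow_le_pow_of_le_one h0.le h1 (by omega)
  · rw [hR, he]
    rcases n with _ | n
    · simp
      ring
    · simp
      ring

end SecondOrder

/-! ### From invariance under a sequence of matrices to an infinitesimal condition. -/

section LieAction
variable {p : ℕ} [Fact p.Prime] {L : Type*} [NormedField L] [NormedAlgebra ℚ_[p] L]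

/-- The infinitesimal action of weight `m` of the vector field `η`, with automorphy factor `ξ`. -/
noncomputable def lieAct (m : ℤ) (ξ η : ℤ_[p] → ℤ_[p]) (f : ℤ_[p] → L) : ℤ_[p] → L := fun z =>
  ((η z : ℤ_[p]) : ℚ_[p]) • zDeriv f z - ((m * ξ z : ℤ_[p]) : ℚ_[p]) • f z

theorem HasExpansion.hasSum_zDeriv [CompleteSpace L] {r : ℝ} (hr : 0 < r) {f : ℤ_[p] → L}
    {e : ℤ_[p]} {a : ℕ → L} (h : HasExpansion r f e a) {t : ℤ_[p]} (ht : ‖t‖ ≤ min r 1 / 2) :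
    HasSum (fun n : ℕ => ((n * t ^ (n - 1) : ℤ_[p]) : ℚ_[p]) • a n) (OMS.zDeriv f (e + t)) := by
  have h1 := (h.zDeriv (M := 0) hr).1.2 (e + t) (by rwa [add_sub_cancel_left])
  rw [← hasSum_nat_add_iff' 1]
  simp only [Finset.range_one, Finset.sum_singleton, CharP.cast_eq_zero, zero_mul,
    PadicInt.coe_zero, zero_smul, sub_zero]
  refine (congrArg (fun F : ℕ → L => HasSum F _) (funext fun n => ?_)).mpr h1
  rw [add_sub_cancel_left, add_tsub_cancel_right, PadicInt.coe_mul, PadicInt.coe_pow, mul_comm,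
    mul_smul]
  congr 1
  rw [PadicInt.coe_natCast, Algebra.smul_def, map_natCast]

/-- Second-order estimate for the action of matrices near `1`. -/
theorem AnalyticNormLE.weightAct_sub [CompleteSpace L] {r M : ℝ} (hr : 0 < r) {f : ℤ_[p] → L}
    (hf : AnalyticNormLE r f M) (m : ℤ) (γ : S0 p) (h : ℤ_[p]) (hh : ‖h‖ ≤ min r 1 / 2)
    (ξ η : ℤ_[p] → ℤ_[p])
    (hs : ∀ e : ℤ_[p], ∃ x y : PowerSeries ℤ_[p], ∀ t : ℤ_[p], ‖t‖ < 1 →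
      EvalsTo x t (ξ (e + t)) ∧ EvalsTo y t (η (e + t) - ξ (e + t) * t))
    (hden : ∀ z, (s0Denom γ z : ℤ_[p]) = 1 - h * ξ z)
    (hmoeb : ∀ z, (s0Denom γ z : ℤ_[p]) * s0Moebius γ z = z + h * (η z - ξ z * z)) :
    AnalyticNormLE (min r 1 / 2 / 2)
      (OMS.weightAct m γ f - f - ((h : ℤ_[p]) : ℚ_[p]) • lieAct m ξ η f)
      (2 * (‖h‖ ^ 2 * (M / (min r 1 / 2) ^ 2))) := by
  intro e
  obtain ⟨a, ha, hM⟩ := hf e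
  obtain ⟨x, y, hxy⟩ := hs e
  have hs0 : 0 < min r 1 := lt_min hr one_pos
  have hs1 : min r 1 ≤ 1 := min_le_right _ _
  have hsr : min r 1 ≤ r := min_le_left _ _
  set s := min r 1 / 2 with hs
  have hs0' : 0 < s := by positivity
  have hs1' : s ≤ 1 := by linarith
  have hh1 : ‖h‖ < 1 := by linarith
  have hunit : IsUnit (1 - PowerSeries.C h * x) := by
    rw [PowerSeries.isUnit_iff_constantCoeff, PadicInt.isUnit_iff]
    simp only [map_sub, map_one, map_mul, PowerSeries.constantCoeff_C]
    have h1 : ‖-(h * PowerSeries.constantCoeff x)‖ < 1 := by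
      rw [norm_neg, norm_mul]
      exact mul_lt_one_of_nonneg_of_lt_one_left (norm_nonneg _) hh1 (PadicInt.norm_le_one _)
    rw [sub_eq_add_neg, PadicInt.norm_add_eq_max_of_ne (by rw [norm_one]; exact h1.ne'), norm_one]
    exact max_eq_left h1.le
  have hu : (hunit.unit : PowerSeries ℤ_[p]) = 1 - PowerSeries.C h * x := rfl
  -- Writing u for the denominator a - cz and w for the Möbius image of e + t, one has u^m (w - e)ⁿ
  -- = u^{m-n} (u(w - e))ⁿ, and u(w - e) = t + h(η - ξt). Hence the exponent m - n and the series y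
  -- of η - ξt.
  choose W hWG hW using fun n : ℕ =>
    exists_second_order_expansion hs0' hs1' h hh x y hunit.unit hu (m - n) n
  refine exists_hasExpansion_of_hasSum (a := a) (P := fun n => PowerSeries.C (h ^ 2) * W n) hs0'
    (fun n l => ?_) fun t ht => ?_
  · have h1 := ((gaussLE_C (s := s) (h ^ 2)).mul hs0' (hWG n)) l
    calc _ ≤ ‖a n‖ * (‖h ^ 2‖ * (s ^ n / s ^ 2)) := by gcongr
      _ = ‖h‖ ^ 2 * ((‖a n‖ * (min r 1) ^ n) / s ^ 2) * (1 / 2) ^ n := by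
        rw [norm_pow, hs, div_pow _ _ n, div_pow 1 2 n]; ring
      _ ≤ ‖h‖ ^ 2 * ((‖a n‖ * r ^ n) / s ^ 2) * (1 / 2) ^ n := by gcongr
      _ ≤ _ := by gcongr; exact hM n
  · have ht1 : ‖t‖ < 1 := by linarith
    have hts : ‖t‖ ≤ s := by linarith
    obtain ⟨hx, hy⟩ := hxy t ht1
    choose w hw using fun n => exists_evalsTo (W n) ht1
    refine ⟨fun n => h ^ 2 * w n, fun n => (evalsTo_C _ t).mul ht1 (hw n), ?_⟩
    have hden' : EvalsTo (hunit.unit : PowerSeries ℤ_[p]) t (s0Denom γ (e + t)) := by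
      rw [hden, hu]
      simpa using (evalsTo_C 1 t).sub ((evalsTo_C h t).mul ht1 hx)
    have hmo : (s0Denom γ (e + t) : ℤ_[p]) * (s0Moebius γ (e + t) - e) =
        t + h * (η (e + t) - ξ (e + t) * t) := by
      rw [mul_sub, hmoeb, hden]; ring
    have hval : ∀ n : ℕ, ((s0Denom γ (e + t) ^ m : ℤ_[p]ˣ) : ℤ_[p]) *
        (s0Moebius γ (e + t) - e) ^ n = t ^ n + h * (n * t ^ (n - 1) *
          (η (e + t) - ξ (e + t) * t) - ((m - n : ℤ) : ℤ_[p]) * ξ (e + t) * t ^ n) +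
          h ^ 2 * w n := fun n => by
      have e1 := (hden'.units_zpow ht1 (m - n)).mul ht1
        (((evalsTo_X t).add ((evalsTo_C h t).mul ht1 hy)).pow ht1 n)
      have e2 := (((evalsTo_X t).pow ht1 n).add ((evalsTo_C h t).mul ht1
        ((((evalsTo_C (n : ℤ_[p]) t).mul ht1 ((evalsTo_X t).pow ht1 (n - 1))).mul ht1 hy).sub
        (((evalsTo_C ((m - n : ℤ) : ℤ_[p]) t).mul ht1 hx).mul ht1 ((evalsTo_X t).pow ht1 n))))).add
        (((evalsTo_C h t).pow ht1 2).mul ht1 (hw n))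
      rw [← hW n] at e2
      rw [← e1.unique e2, ← hmo, mul_pow, ← mul_assoc, ← Units.val_pow_eq_pow_val,
        ← Units.val_mul, ← zpow_natCast, ← zpow_add, sub_add_cancel]
    have hball : ‖s0Moebius γ (e + t) - e‖ ≤ r := by
      have h1 : ‖s0Moebius γ (e + t) - e‖ =
          ‖(s0Denom γ (e + t) : ℤ_[p]) * (s0Moebius γ (e + t) - e)‖ := by
        rw [norm_mul, PadicInt.norm_units, one_mul]
      rw [h1, hmo]
      refine (PadicInt.nonarchimedean _ _).trans (max_le (by linarith) ?_)
      rw [norm_mul]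
      exact (mul_le_of_le_one_right (norm_nonneg _) (PadicInt.norm_le_one _)).trans (by linarith)
    have s1 := (ha.2 _ hball).const_smul
      (((s0Denom γ (e + t) ^ m : ℤ_[p]ˣ) : ℤ_[p]) : ℚ_[p])
    have s2 := ha.2 (e + t) (by rw [add_sub_cancel_left]; linarith)
    have s3 := ha.hasSum_zDeriv hr hts
    have s4 := (s1.sub s2).sub (((s3.const_smul ((η (e + t) : ℤ_[p]) : ℚ_[p])).sub
      (s2.const_smul ((m * ξ (e + t) : ℤ_[p]) : ℚ_[p]))).const_smul ((h : ℤ_[p]) : ℚ_[p]))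
    refine (congrArg (fun F : ℕ → L => HasSum F _) (funext fun n => ?_)).mpr s4
    simp only [smul_smul, ← sub_smul]
    congr 1
    rw [add_sub_cancel_left]
    have h5 := hval n
    -- In the term linear in h, the nξtⁿ from the exponent m - n cancels the one from n tⁿ⁻¹(η -
    -- ξt), leaving n tⁿ⁻¹η - mξtⁿ, the n-th term of `lieAct`. At n = 0 the truncated exponent is
    -- harmless.
    have h6 : t ^ n * (n : ℤ_[p]) = n * t ^ (n - 1) * t := by
      rcases n with _ | n
      · simp
      · rw [add_tsub_cancel_right, pow_succ]; ring
    rw [← PadicInt.coe_pow, ← PadicInt.coe_pow, ← PadicInt.coe_mul, ← PadicInt.coe_mul,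
      ← PadicInt.coe_mul, ← PadicInt.coe_sub, ← PadicInt.coe_sub, ← PadicInt.coe_mul,
      ← PadicInt.coe_sub]
    refine congrArg (fun w : ℤ_[p] => (w : ℚ_[p])) ?_
    rw [h5]
    push_cast
    linear_combination (-h * ξ (e + t)) * h6

variable [FiniteDimensional ℚ_[p] L]

/-- A distribution that is invariant under matrices tending to `1` is killed by their infinitesimal
generator. -/
theorem apply_lieAct_eq_zero (m : ℤ) (γ : ℕ → S0 p) (h : ℕ → ℤ_[p]) (h0 : ∀ j, h j ≠ 0)
    (hlim : Tendsto h atTop (𝓝 0)) (ξ η : ℤ_[p] → ℤ_[p])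
    (hs : ∀ e : ℤ_[p], ∃ x y : PowerSeries ℤ_[p], ∀ t : ℤ_[p], ‖t‖ < 1 →
      EvalsTo x t (ξ (e + t)) ∧ EvalsTo y t (η (e + t) - ξ (e + t) * t))
    (hden : ∀ j z, (s0Denom (γ j) z : ℤ_[p]) = 1 - h j * ξ z)
    (hmoeb : ∀ j z, (s0Denom (γ j) z : ℤ_[p]) * s0Moebius (γ j) z = z + h j * (η z - ξ z * z))
    (μ : Distr p L) (hμ : ∀ j, weightActDistr m (γ j) μ = μ) (f g : LocAn p L)
    (hg : (g : ℤ_[p] → L) = lieAct m ξ η f) : (μ : Module.Dual L (LocAn p L)) g = 0 := by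
  have := FiniteDimensional.complete ℚ_[p] L
  obtain ⟨r, hr, M, hf⟩ := exists_analyticNormLE (mem_locAn_iff_forall.mp f.2)
  have hs0 : 0 < min r 1 := lt_min hr one_pos
  obtain ⟨B, hB⟩ := μ.2 (min r 1 / 2 / 2) (by positivity)
  set C : ℝ := B * (2 * (M / (min r 1 / 2) ^ 2)) with hC
  have hnorm : Tendsto (fun j => ‖h j‖) atTop (𝓝 0) := tendsto_zero_iff_norm_tendsto_zero.mp hlim
  -- By invariance μ kills γf - f, so on the second-order remainder μ takes the value -h μ(g). The
  -- remainder is O(‖h‖²) in norm; dividing by ‖h‖ leaves ‖μ(g)‖ ≤ C‖h‖.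
  have hev : ∀ᶠ j in atTop, ‖(μ : Module.Dual L (LocAn p L)) g‖ ≤ C * ‖h j‖ := by
    filter_upwards [hnorm.eventually (eventually_le_nhds (show (0 : ℝ) < min r 1 / 2 by positivity))]
      with j hj
    have h1 := hf.weightAct_sub hr m (γ j) (h j) hj ξ η hs (hden j) (hmoeb j)
    let F : LocAn p L := weightActLocAn m (γ j) f - f -
      (algebraMap ℚ_[p] L ((h j : ℤ_[p]) : ℚ_[p])) • g
    have hF : (F : ℤ_[p] → L) =
        weightAct m (γ j) (f : ℤ_[p] → L) - (f : ℤ_[p] → L) -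
          ((h j : ℤ_[p]) : ℚ_[p]) • lieAct m ξ η (f : ℤ_[p] → L) := by
      rw [← hg]
      funext z
      simp only [F, Submodule.coe_sub, Submodule.coe_smul, Pi.sub_apply, Algebra.smul_def]
      rfl
    have h2 := hB F _ (by rw [hF]; exact h1)
    have h3 : (μ : Module.Dual L (LocAn p L)) (weightActLocAn m (γ j) f) =
        (μ : Module.Dual L (LocAn p L)) f :=
      LinearMap.congr_fun (congrArg Subtype.val (hμ j)) f
    have h4 : (μ : Module.Dual L (LocAn p L)) F =
        -((algebraMap ℚ_[p] L ((h j : ℤ_[p]) : ℚ_[p])) * (μ : Module.Dual L (LocAn p L)) g) := by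
      simp only [F, map_sub, map_smul, h3, sub_self, zero_sub, smul_eq_mul]
    rw [h4, norm_neg, norm_mul, norm_algebraMap'] at h2
    have h5 : 0 < ‖h j‖ := norm_pos_iff.mpr (h0 j)
    have h6 : ‖h j‖ * ‖(μ : Module.Dual L (LocAn p L)) g‖ ≤ ‖h j‖ * (C * ‖h j‖) := by
      refine h2.trans (le_of_eq ?_)
      rw [hC]; ring
    exact le_of_mul_le_mul_left h6 h5
  have hlim0 : Tendsto (fun j => C * ‖h j‖) atTop (𝓝 0) := by simpa using hnorm.const_mul C
  exact norm_le_zero_iff.mp (ge_of_tendsto hlim0 hev)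

end LieAction

end OMS

namespace OMS

open Filter Topology

/-! ### Gluing local solutions on ℤ_p. -/

section Glue
variable {p : ℕ} [Fact p.Prime]

/-- A local property of germs that can be achieved near every point of `ℤ_p` can be achieved
globally. -/
theorem exists_forall_of_locally {α : Type*} (Q : (ℤ_[p] → α) → ℤ_[p] → Prop)
    (hQ : ∀ f g z, f =ᶠ[𝓝 z] g → Q f z → Q g z) (hloc : ∀ e, ∃ f, ∀ᶠ z in 𝓝 e, Q f z) :
    ∃ f, ∀ z, Q f z := by
  choose F hF using hloc
  obtain ⟨δ, hδ, hball⟩ := lebesgue_number_lemma_of_metric (isCompact_univ (X := ℤ_[p]))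
    (c := fun e => interior {z | Q (F e) z}) (fun e => isOpen_interior)
    (fun e _ => Set.mem_iUnion.mpr ⟨e, mem_interior_iff_mem_nhds.mpr (hF e)⟩)
  choose i hi using fun x : ℤ_[p] => hball x trivial
  -- In an ultrametric space "distance less than δ" is an equivalence relation with open classes.
  -- One local solution is chosen per class, and no compatibility between classes is required.
  let S : Setoid ℤ_[p] :=
    { r := fun x y => dist x y < δ
      iseqv := ⟨fun x => by simpa using hδ, fun {x y} h => by rwa [dist_comm],
        fun {x y z} h h' => (dist_triangle_max x y z).trans_lt (max_lt h h')⟩ }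
  let rep : ℤ_[p] → ℤ_[p] := fun x => (Quotient.mk S x).out
  have hrep : ∀ x, dist (rep x) x < δ := fun x => Quotient.mk_out (s := S) x
  refine ⟨fun z => F (i (rep z)) z, fun z => ?_⟩
  refine hQ (F (i (rep z))) _ z ?_ ?_
  · filter_upwards [Metric.ball_mem_nhds z hδ] with w hw
    have : rep w = rep z := by
      simp only [rep]
      rw [Quotient.sound (s := S) (a := w) (b := z) hw]
    rw [this]
  · refine interior_subset (hi (rep z) ?_)
    rw [Metric.mem_ball, dist_comm]
    exact hrep z

end Glue

/-! ### Primitives of locally analytic functions. -/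

section Primitive
variable {p : ℕ} [Fact p.Prime]

/-- The power of p dividing j is at most |j|. So dividing the n-th Taylor coefficient by an integer
linear in n costs only linear growth, which a smaller radius absorbs. -/
theorem inv_norm_intCast_le {j : ℤ} (hj : j ≠ 0) : ‖(j : ℚ_[p])‖⁻¹ ≤ |(j : ℝ)| := by
  have hj' : (j : ℚ_[p]) ≠ 0 := by exact_mod_cast hj
  have h1 : ‖(j : ℚ_[p])‖ = (p : ℝ) ^ (-(padicValInt p j : ℤ)) := by
    rw [Padic.norm_eq_zpow_neg_valuation hj', Padic.valuation_intCast]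
  rw [h1, zpow_neg, inv_inv, zpow_natCast]
  have h2 : ((p ^ padicValInt p j : ℕ) : ℤ) ∣ j := by
    push_cast
    exact padicValInt_dvd j
  have h3 := Int.le_of_dvd (abs_pos.mpr hj) ((dvd_abs _ _).mpr h2)
  exact_mod_cast h3

theorem norm_inv_intCast_le (p : ℕ) [Fact p.Prime] {L : Type*} [NormedField L]
    [NormedAlgebra ℚ_[p] L] {j : ℤ} (hj : j ≠ 0) : ‖((j : L))⁻¹‖ ≤ |(j : ℝ)| := by
  rw [norm_inv, ← map_intCast (algebraMap ℚ_[p] L) j, norm_algebraMap']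
  exact inv_norm_intCast_le hj

variable {L : Type*} [NormedField L]

theorem ext0_eventuallyEq_of_eventuallyEq {f g : ℤ_[p] → L} {z : ℤ_[p]} (h : f =ᶠ[𝓝 z] g) :
    ext0 f =ᶠ[𝓝 (z : ℚ_[p])] ext0 g :=
  ext0_eventuallyEq (h.mono fun w hw => by rw [hw, ext0_coe])

variable [NormedAlgebra ℚ_[p] L]

/-- Halving the radius turns linear growth into geometric decay. -/
theorem exists_hasExpansion_of_coeff_bound [CompleteSpace L] {ρ A : ℝ} (hρ : 0 < ρ) {b : ℕ → L}
    (hb : ∀ n, ‖b n‖ * ρ ^ n ≤ A * (n + 1)) (e : ℤ_[p]) :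
    ∃ f : ℤ_[p] → L, HasExpansion (ρ / 2) f e b := by
  have hb' : ∀ n, ‖b n‖ * (ρ / 2) ^ n ≤ A * (n + 1) * (1 / 2) ^ n := fun n => by
    have : ‖b n‖ * (ρ / 2) ^ n = ‖b n‖ * ρ ^ n * (1 / 2) ^ n := by rw [div_pow, div_pow]; ring
    rw [this]
    exact mul_le_mul_of_nonneg_right (hb n) (by positivity)
  have hS : Summable fun n : ℕ => A * ((n : ℝ) + 1) * (1 / 2) ^ n := by
    have h1 := summable_pow_mul_geometric_of_norm_lt_one 1 (r := (1 / 2 : ℝ)) (by norm_num)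
    have h2 := summable_geometric_of_lt_one (r := (1 / 2 : ℝ)) (by norm_num) (by norm_num)
    refine ((h1.add h2).mul_left A).congr fun n => ?_
    ring
  refine ⟨fun z => ∑' n, (((z - e : ℤ_[p]) : ℚ_[p]) ^ n) • b n,
    squeeze_zero (fun n => by positivity) hb' hS.tendsto_atTop_zero, fun z hz => ?_⟩
  refine (Summable.of_norm_bounded hS fun n => le_trans ?_ (hb' n)).hasSum
  rw [norm_smul, norm_pow, mul_comm]
  have : ‖((z - e : ℤ_[p]) : ℚ_[p])‖ ≤ ρ / 2 := hz
  gcongr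

theorem zDeriv_congr {f g : ℤ_[p] → L} {z : ℤ_[p]} (h : f =ᶠ[𝓝 z] g) :
    zDeriv f z = zDeriv g z := (ext0_eventuallyEq_of_eventuallyEq h).deriv_eq

theorem zDeriv_eq_deriv {f : ℤ_[p] → L} {F : ℚ_[p] → L} {z : ℤ_[p]} (h : ∀ᶠ w in 𝓝 z, f w = F w) :
    zDeriv f z = deriv F z := (ext0_eventuallyEq h).deriv_eq

theorem eventually_analyticAt_ext0 [CompleteSpace L] {f : ℤ_[p] → L} {e : ℤ_[p]}
    (h : AnalyticAt ℚ_[p] (ext0 f) (e : ℚ_[p])) :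
    ∀ᶠ z : ℤ_[p] in 𝓝 e, AnalyticAt ℚ_[p] (ext0 f) (z : ℚ_[p]) := by
  have := h.eventually_analyticAt
  rwa [nhds_coe_eq_map, Filter.eventually_map] at this

theorem exists_local_primitive [CompleteSpace L] {k : ℤ_[p] → L} {e : ℤ_[p]}
    (hk : AnalyticAt ℚ_[p] (ext0 k) (e : ℚ_[p])) :
    ∃ f : ℤ_[p] → L, ∀ᶠ z : ℤ_[p] in 𝓝 e, AnalyticAt ℚ_[p] (ext0 f) (z : ℚ_[p]) ∧
      zDeriv f z = k z := by
  obtain ⟨r, hr, a, ha⟩ := exists_hasExpansion_iff_analyticAt.mpr hk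
  obtain ⟨M, hM⟩ := ha.exists_bound
  have hM0 : 0 ≤ M := le_trans (by positivity) (hM 0)
  -- Termwise integration. At n = 0 the convention 0⁻¹ = 0 makes the constant term vanish.
  let b : ℕ → L := fun n => ((n : ℤ) : L)⁻¹ * a (n - 1)
  obtain ⟨f, hf⟩ := exists_hasExpansion_of_coeff_bound (A := r * M) hr (b := b) (fun n => by
    rcases n with _ | n
    · simp [b]; positivity
    · have h1 : ‖(((n + 1 : ℕ) : ℤ) : L)⁻¹‖ ≤ |(((n + 1 : ℕ) : ℤ) : ℝ)| :=
        norm_inv_intCast_le p (by positivity)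
      have h2 : |(((n + 1 : ℕ) : ℤ) : ℝ)| = n + 1 := by
        rw [abs_of_nonneg (by positivity)]; push_cast; rfl
      rw [h2] at h1
      calc ‖b (n + 1)‖ * r ^ (n + 1) = ‖(((n + 1 : ℕ) : ℤ) : L)⁻¹‖ * r * (‖a n‖ * r ^ n) := by
            simp only [b, norm_mul, add_tsub_cancel_right, pow_succ]; ring
        _ ≤ (n + 1) * r * M := by gcongr; exact hM n
        _ ≤ r * M * ((n + 1 : ℕ) + 1) := by push_cast; nlinarith [mul_nonneg hr.le hM0]) e
  have hr2 : 0 < r / 2 := by positivity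
  refine ⟨f, (eventually_analyticAt_ext0
    (exists_hasExpansion_iff_analyticAt.mp ⟨_, hr2, _, hf⟩)).and ?_⟩
  have h0 : 0 < min (r / 2) 1 / 2 := by have := lt_min hr2 one_pos; positivity
  filter_upwards [Metric.closedBall_mem_nhds e h0] with z hz
  rw [Metric.mem_closedBall, dist_eq_norm] at hz
  have h1 := (hf.zDeriv (M := 0) hr2).1.2 z hz
  have h2 := ha.2 z (hz.trans (by linarith [min_le_left (r / 2) 1]))
  refine h1.unique ((congrArg (fun F : ℕ → L => HasSum F _) (funext fun n => ?_)).mp h2)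
  have hne : ((n + 1 : ℕ) : L) ≠ 0 := by
    have := algebraRat.charZero ℚ_[p]
    have : CharZero L := charZero_of_injective_algebraMap (algebraMap ℚ_[p] L).injective
    exact Nat.cast_ne_zero.mpr (Nat.succ_ne_zero n)
  simp only [b, add_tsub_cancel_right]
  rw [Int.cast_natCast, mul_inv_cancel_left₀ hne]

/-- Solvability of a first-order differential equation `E(z, f, f') = 0` by locally analytic
functions, from local solvability. -/
theorem exists_locAn_of_locally [CompleteSpace L] (E : ℤ_[p] → L → L → Prop)
    (hE : ∀ e : ℤ_[p], ∃ f : ℤ_[p] → L, ∀ᶠ z : ℤ_[p] in 𝓝 e,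
      AnalyticAt ℚ_[p] (ext0 f) (z : ℚ_[p]) ∧ E z (f z) (zDeriv f z)) :
    ∃ f : LocAn p L, ∀ z, E z ((f : ℤ_[p] → L) z) (zDeriv (f : ℤ_[p] → L) z) := by
  obtain ⟨f, hf⟩ := exists_forall_of_locally
    (fun (f : ℤ_[p] → L) z => AnalyticAt ℚ_[p] (ext0 f) (z : ℚ_[p]) ∧ E z (f z) (zDeriv f z))
    (fun f g z h hf => ⟨hf.1.congr (ext0_eventuallyEq_of_eventuallyEq h), by
      rw [← h.eq_of_nhds, ← zDeriv_congr h]; exact hf.2⟩) hE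
  exact ⟨⟨f, mem_locAn_iff_analyticAt.mpr fun e => (hf e).1⟩, fun z => (hf z).2⟩

/-- Primitives exist near each point and glue without obstruction because ℤ_p is totally
disconnected. By duality, derivation of distributions, and hence Θ_k, is injective. -/
theorem derivLocAn_surjective [FiniteDimensional ℚ_[p] L] :
    Function.Surjective (derivLocAn (p := p) (L := L)) := fun g => by
  have := FiniteDimensional.complete ℚ_[p] L
  obtain ⟨f, hf⟩ := exists_locAn_of_locally (fun z _ d => d = (g : ℤ_[p] → L) z)
    fun e => exists_local_primitive (mem_locAn_iff_analyticAt.mp g.2 e)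
  exact ⟨f, Subtype.ext (funext hf)⟩

theorem derivDistr_injective [FiniteDimensional ℚ_[p] L] :
    Function.Injective (derivDistr (p := p) (L := L)) := fun μ ν h => by
  refine Subtype.ext (LinearMap.ext fun f => ?_)
  obtain ⟨g, rfl⟩ := derivLocAn_surjective f
  exact LinearMap.congr_fun (congrArg Subtype.val h) g

theorem HasExpansion.apply_center {r : ℝ} (hr : 0 ≤ r) {f : ℤ_[p] → L} {e : ℤ_[p]} {a : ℕ → L}
    (h : HasExpansion r f e a) : f e = a 0 := by
  have h1 := h.2 e (by simpa using hr)
  refine h1.unique ?_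
  convert hasSum_single (f := fun n : ℕ => (((e - e : ℤ_[p]) : ℚ_[p]) ^ n) • a n) 0 ?_ using 1
  · simp
  · intro n hn
    simp [hn]

theorem HasExpansion.iterate_zDeriv [CompleteSpace L] {r : ℝ} (hr : 0 < r) {f : ℤ_[p] → L}
    {e : ℤ_[p]} {a : ℕ → L} (h : HasExpansion r f e a) (j : ℕ) :
    ∃ r' : ℝ, 0 < r' ∧ HasExpansion r' (OMS.zDeriv^[j] f) e
      (fun n => ((n + 1).ascFactorial j : L) * a (n + j)) := by
  induction j with
  | zero => exact ⟨r, hr, by simpa using h⟩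
  | succ j ih =>
    obtain ⟨r', hr', h'⟩ := ih
    refine ⟨min r' 1 / 2, by have := lt_min hr' one_pos; positivity, ?_⟩
    rw [Function.iterate_succ_apply']
    refine (congrArg (HasExpansion (min r' 1 / 2) _ e) (funext fun n => ?_)).mpr
      (h'.zDeriv (M := 0) hr').1
    rw [← mul_assoc, ← Nat.cast_mul, Nat.succ_ascFactorial, Nat.ascFactorial_succ]
    congr 2
    ring

end Primitive

end OMS

namespace OMS

open Filter Topology

/-! ### The differential equation z²f' - mzf = g and unipotent invariance. -/

section LieEquation
variable {p : ℕ} [Fact p.Prime] {L : Type*} [NormedField L] [NormedAlgebra ℚ_[p] L]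

/-- Away from 0 the operator is z^{m+2} · d/dz · z^{-m}, so f = z^m H with H a primitive of z^{-m-2}
g. -/
theorem exists_local_lieAct_eq_of_ne_zero [CompleteSpace L] (m : ℤ) {g : ℤ_[p] → L} {e : ℤ_[p]}
    (hg : AnalyticAt ℚ_[p] (ext0 g) (e : ℚ_[p])) (he : e ≠ 0) :
    ∃ f : ℤ_[p] → L, ∀ᶠ z : ℤ_[p] in 𝓝 e, AnalyticAt ℚ_[p] (ext0 f) (z : ℚ_[p]) ∧
      lieAct m (fun z : ℤ_[p] => z) (fun z => z ^ 2) f z = g z := by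
  have hcoe : ∀ {z : ℤ_[p]}, z ≠ 0 → (z : ℚ_[p]) ≠ 0 := fun hz => by
    simpa using hz
  have hz : ∀ {z : ℤ_[p]} (n : ℤ), z ≠ 0 → AnalyticAt ℚ_[p] (fun w : ℚ_[p] => w ^ n) (z : ℚ_[p]) :=
    fun n hz => analyticAt_id.zpow (hcoe hz)
  let k : ℤ_[p] → L := fun z => ((z : ℚ_[p]) ^ (-m - 2)) • g z
  have hk : AnalyticAt ℚ_[p] (ext0 k) (e : ℚ_[p]) :=
    ((hz (-m - 2) he).smul hg).congr (ext0_eventuallyEq (Eventually.of_forall fun z => by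
      simp [k, ext0_coe])).symm
  obtain ⟨H, hH⟩ := exists_local_primitive hk
  refine ⟨fun z => ((z : ℚ_[p]) ^ m) • H z, ?_⟩
  filter_upwards [hH, isOpen_ne.mem_nhds he] with z hz1 hz0
  have hz0' := hcoe hz0
  have heq : ext0 (fun z : ℤ_[p] => ((z : ℚ_[p]) ^ m) • H z) =ᶠ[𝓝 (z : ℚ_[p])]
      fun w => (w ^ m) • ext0 H w :=
    ext0_eventuallyEq (Eventually.of_forall fun z => by simp [ext0_coe])
  refine ⟨((hz m hz0).smul hz1.1).congr heq.symm, ?_⟩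
  have hd : zDeriv (fun z : ℤ_[p] => ((z : ℚ_[p]) ^ m) • H z) z =
      ((z : ℚ_[p]) ^ m) • zDeriv H z + (m * (z : ℚ_[p]) ^ (m - 1)) • H z := by
    rw [zDeriv, heq.deriv_eq, deriv_fun_smul (hz m hz0).differentiableAt hz1.1.differentiableAt,
      deriv_zpow, ext0_coe]
    rfl
  rw [lieAct, hd, hz1.2]
  simp only [k, smul_add, smul_smul, PadicInt.coe_mul, PadicInt.coe_pow, PadicInt.coe_intCast]
  have e1 : (z : ℚ_[p]) ^ 2 * ((z : ℚ_[p]) ^ m * (z : ℚ_[p]) ^ (-m - 2)) = 1 := by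
    rw [← zpow_add₀ hz0', ← zpow_natCast, ← zpow_add₀ hz0',
      show ((2 : ℕ) : ℤ) + (m + (-m - 2)) = 0 by push_cast; ring, zpow_zero]
  have e2 : (z : ℚ_[p]) ^ 2 * (m * (z : ℚ_[p]) ^ (m - 1)) = m * z * (z : ℚ_[p]) ^ m := by
    rw [zpow_sub_one₀ hz0']
    field_simp
  rw [e1, e2, one_smul, add_sub_cancel_right]

/-- On f = ∑ bₙzⁿ the operator gives ∑ (n - m) bₙ z^{n+1}. The only obstructions are the constant
term and, when m ≥ 0, the degree m + 1, where n - m = 0. -/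
theorem exists_local_lieAct_eq_zero [CompleteSpace L] (m : ℤ) {g : ℤ_[p] → L} {r : ℝ} (hr : 0 < r)
    {a : ℕ → L} (hg : HasExpansion (p := p) r g 0 a) (h0 : a 0 = 0) (hm : ∀ k : ℕ, m = k → a (k + 1) = 0) :
    ∃ f : ℤ_[p] → L, ∀ᶠ z : ℤ_[p] in 𝓝 0, AnalyticAt ℚ_[p] (ext0 f) (z : ℚ_[p]) ∧
      lieAct m (fun z : ℤ_[p] => z) (fun z => z ^ 2) f z = g z := by
  obtain ⟨M, hM⟩ := hg.exists_bound
  have hM0 : 0 ≤ M := le_trans (by positivity) (hM 0)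
  -- At n = m the convention 0⁻¹ = 0 gives b m = 0, consistent with the hypothesis that the
  -- coefficient of degree m + 1 vanishes. Elsewhere |n - m| ≤ (1 + |m|)(n + 1) bounds the inverse.
  let b : ℕ → L := fun n => (((n - m : ℤ)) : L)⁻¹ * a (n + 1)
  obtain ⟨f, hf⟩ := exists_hasExpansion_of_coeff_bound (p := p) (A := (1 + |(m : ℝ)|) * (M / r)) hr (b := b)
    (fun n => by
      have h3 : ‖a (n + 1)‖ * r ^ n ≤ M / r := by
        rw [le_div_iff₀ hr, mul_assoc, ← pow_succ]
        exact hM (n + 1)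
      by_cases hnm : (n - m : ℤ) = 0
      · simp only [b, hnm, Int.cast_zero, inv_zero, zero_mul, norm_zero]
        positivity
      · have h1 : ‖(((n - m : ℤ)) : L)⁻¹‖ ≤ |((n - m : ℤ) : ℝ)| := norm_inv_intCast_le p hnm
        have h2 : |((n - m : ℤ) : ℝ)| ≤ (1 + |(m : ℝ)|) * (n + 1) := by
          push_cast
          refine (abs_sub _ _).trans ?_
          rw [Nat.abs_cast]
          nlinarith [abs_nonneg (m : ℝ), (Nat.cast_nonneg n : (0 : ℝ) ≤ n),
            mul_nonneg (abs_nonneg (m : ℝ)) (Nat.cast_nonneg n : (0 : ℝ) ≤ n)]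
        calc ‖b n‖ * r ^ n = ‖(((n - m : ℤ)) : L)⁻¹‖ * (‖a (n + 1)‖ * r ^ n) := by
              simp only [b, norm_mul]; ring
          _ ≤ (1 + |(m : ℝ)|) * (n + 1) * (M / r) := by gcongr; exact h1.trans h2
          _ = _ := by ring) 0
  have hr2 : 0 < r / 2 := by positivity
  refine ⟨f, (eventually_analyticAt_ext0
    (exists_hasExpansion_iff_analyticAt.mp ⟨_, hr2, _, hf⟩)).and ?_⟩
  have h0' : 0 < min (r / 2) 1 / 2 := by have := lt_min hr2 one_pos; positivity
  filter_upwards [Metric.closedBall_mem_nhds (0 : ℤ_[p]) h0'] with z hz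
  rw [Metric.mem_closedBall, dist_eq_norm, sub_zero] at hz
  have hle := min_le_left (r / 2) 1
  have h1 := hf.hasSum_zDeriv hr2 hz
  rw [zero_add] at h1
  have h2 := hf.2 z (by rw [sub_zero]; linarith)
  have h3 := hg.2 z (by rw [sub_zero]; linarith)
  rw [← hasSum_nat_add_iff' 1] at h3
  simp only [Finset.range_one, Finset.sum_singleton, h0, smul_zero, sub_zero] at h3
  have h4 := (h1.const_smul ((z ^ 2 : ℤ_[p]) : ℚ_[p])).sub
    (h2.const_smul ((m * z : ℤ_[p]) : ℚ_[p]))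
  refine h4.unique ((congrArg (fun F : ℕ → L => HasSum F _) (funext fun n => ?_)).mp h3)
  have hb : ((n : ℤ) - m : ℚ_[p]) • b n = a (n + 1) := by
    by_cases hnm : (n - m : ℤ) = 0
    · rw [hm n (by omega)]
      simp only [b, hnm, Int.cast_zero, inv_zero, zero_mul, smul_zero]
    · have hne : (((n - m : ℤ)) : L) ≠ 0 := by
        have := charZero_of_injective_algebraMap (algebraMap ℚ_[p] L).injective
        exact Int.cast_ne_zero.mpr hnm
      rw [Algebra.smul_def, ← Int.cast_sub, map_intCast]
      exact mul_inv_cancel_left₀ hne _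
  rw [← hb, smul_smul, smul_smul, smul_smul, sub_zero, ← sub_smul]
  congr 1
  have h6 : (z : ℚ_[p]) * (n * (z : ℚ_[p]) ^ (n - 1)) = n * (z : ℚ_[p]) ^ n := by
    rcases n with _ | n
    · simp
    · rw [add_tsub_cancel_right, pow_succ]; ring
  push_cast
  rw [pow_succ]
  linear_combination (-(z : ℚ_[p])) * h6

variable [FiniteDimensional ℚ_[p] L]

theorem coe_derivLocAn_pow (j : ℕ) (f : LocAn p L) :
    (((derivLocAn ^ j : Module.End L (LocAn p L)) f : LocAn p L) : ℤ_[p] → L) =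
      OMS.zDeriv^[j] (f : ℤ_[p] → L) := by
  induction j with
  | zero => rfl
  | succ j ih => rw [pow_succ', Function.iterate_succ_apply', ← ih]; rfl

/-- Taylor's formula, used to express conditions on coefficients without reference to a chosen
expansion. -/
theorem derivLocAn_pow_apply_center {r : ℝ} (hr : 0 < r) {f : LocAn p L} {e : ℤ_[p]} {a : ℕ → L}
    (h : HasExpansion r (f : ℤ_[p] → L) e a) (j : ℕ) :
    (((derivLocAn ^ j : Module.End L (LocAn p L)) f : LocAn p L) : ℤ_[p] → L) e =
      (j.factorial : L) * a j := by
  have := FiniteDimensional.complete ℚ_[p] L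
  obtain ⟨r', hr', h'⟩ := h.iterate_zDeriv hr j
  rw [coe_derivLocAn_pow, h'.apply_center hr'.le]
  simp [Nat.one_ascFactorial]

/-- The equation `z² f' - m z f = g` is solvable if the coefficients of `g` at `0` of
degrees `0` and, for `m ≥ 0`, `m + 1` vanish. -/
theorem exists_lieAct_eq (m : ℤ) (g : LocAn p L) (h0 : (g : ℤ_[p] → L) 0 = 0)
    (hm : ∀ k : ℕ, m = k →
      (((derivLocAn ^ (k + 1) : Module.End L (LocAn p L)) g : LocAn p L) : ℤ_[p] → L) 0 = 0) :
    ∃ f : LocAn p L, (g : ℤ_[p] → L) = lieAct m (fun z => z) (fun z => z ^ 2) (f : ℤ_[p] → L) := by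
  have := FiniteDimensional.complete ℚ_[p] L
  obtain ⟨f, hf⟩ := exists_locAn_of_locally (L := L) (fun (z : ℤ_[p]) v d => ((z ^ 2 : ℤ_[p]) : ℚ_[p]) • d -
    ((m * z : ℤ_[p]) : ℚ_[p]) • v = (g : ℤ_[p] → L) z) fun e => by
      by_cases he : e = 0
      · subst he
        obtain ⟨r, hr, a, ha⟩ := mem_locAn_iff_forall.mp g.2 0
        have hchar := charZero_of_injective_algebraMap (algebraMap ℚ_[p] L).injective
        refine exists_local_lieAct_eq_zero m hr ha (by rwa [← ha.apply_center hr.le]) fun k hk => ?_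
        have h1 := hm k hk
        rw [derivLocAn_pow_apply_center hr ha] at h1
        exact (mul_eq_zero.mp h1).resolve_left (Nat.cast_ne_zero.mpr (Nat.factorial_ne_zero _))
      · exact exists_local_lieAct_eq_of_ne_zero m (mem_locAn_iff_analyticAt.mp g.2 e) he
  exact ⟨f, funext fun z => (hf z).symm⟩

/-- A distribution invariant under upper unipotent matrices tending to `1` vanishes. -/
theorem eq_zero_of_upper_unipotent_invariant (m : ℤ) (γ : ℕ → S0 p) (h : ℕ → ℤ_[p])
    (h0 : ∀ j, h j ≠ 0) (hlim : Tendsto h atTop (𝓝 0)) (h00 : ∀ j, s0Entry (γ j) 0 0 = 1)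
    (h01 : ∀ j, s0Entry (γ j) 0 1 = h j) (h10 : ∀ j, s0Entry (γ j) 1 0 = 0)
    (h11 : ∀ j, s0Entry (γ j) 1 1 = 1) (μ : Distr p L) (hμ : ∀ j, weightActDistr m (γ j) μ = μ) :
    μ = 0 := by
  refine Subtype.ext (LinearMap.ext fun g => ?_)
  obtain ⟨f, hf⟩ := derivLocAn_surjective (-g)
  -- For (1 h; 0 1) the denominator is 1 and the Möbius map is z ↦ z - h, so ξ = 0 and η = -1; the
  -- generator is -d/dz.
  refine apply_lieAct_eq_zero m γ h h0 hlim (fun _ => 0) (fun _ => -1)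
    (fun e => ⟨PowerSeries.C 0, PowerSeries.C (-1), fun t _ => ⟨evalsTo_C _ _, ?_⟩⟩)
    (fun j z => ?_) (fun j z => ?_) μ hμ f g (funext fun z => ?_)
  · simpa using evalsTo_C (-1 : ℤ_[p]) t
  · rw [s0Denom_val, h00, h10]; ring
  · rw [s0Denom_mul_moebius, h11, h01]; ring
  · have h1 : zDeriv (f : ℤ_[p] → L) z = -(g : ℤ_[p] → L) z :=
      congrFun (congrArg Subtype.val hf) z
    simp [lieAct, h1]

/-- A distribution of weight `m` invariant under lower unipotent matrices tending to `1` depends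
only on the coefficients at `0` of degrees `0` and `m + 1`. -/
theorem apply_eq_zero_of_lower_unipotent_invariant (m : ℤ) (γ : ℕ → S0 p) (h : ℕ → ℤ_[p])
    (h0 : ∀ j, h j ≠ 0) (hlim : Tendsto h atTop (𝓝 0)) (h00 : ∀ j, s0Entry (γ j) 0 0 = 1)
    (h01 : ∀ j, s0Entry (γ j) 0 1 = 0) (h10 : ∀ j, s0Entry (γ j) 1 0 = h j)
    (h11 : ∀ j, s0Entry (γ j) 1 1 = 1) (μ : Distr p L) (hμ : ∀ j, weightActDistr m (γ j) μ = μ)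
    (g : LocAn p L) (hg0 : (g : ℤ_[p] → L) 0 = 0)
    (hm : ∀ k : ℕ, m = k →
      (((derivLocAn ^ (k + 1) : Module.End L (LocAn p L)) g : LocAn p L) : ℤ_[p] → L) 0 = 0) :
    (μ : Module.Dual L (LocAn p L)) g = 0 := by
  obtain ⟨f, hf⟩ := exists_lieAct_eq m g hg0 hm
  -- For (1 0; h 1) the denominator is 1 - hz and the numerator is z, so ξ = z and η = z². At e + t
  -- this gives η - ξt = e(e + t).
  refine apply_lieAct_eq_zero m γ h h0 hlim (fun z => z) (fun z => z ^ 2)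
    (fun e => ⟨PowerSeries.C e + PowerSeries.X, PowerSeries.C e * (PowerSeries.C e + PowerSeries.X),
      fun t ht => ?_⟩) (fun j z => ?_) (fun j z => ?_) μ hμ f g hf
  · have h1 := (evalsTo_C e t).add (evalsTo_X t)
    refine ⟨h1, ?_⟩
    have h2 := (evalsTo_C e t).mul ht h1
    have h3 : (e + t) ^ 2 - (e + t) * t = e * (e + t) := by ring
    rwa [h3]
  · rw [s0Denom_val, h00, h10]
  · rw [s0Denom_mul_moebius, h11, h01]; ring

end LieEquation

/-! ### Shifted powers as test functions, and the classification of invariant distributions. -/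

section ShiftedPowers

theorem dirac_apply {p : ℕ} [Fact p.Prime] {L : Type*} [NormedField L] [NormedAlgebra ℚ_[p] L]
    (z : ℤ_[p]) (f : LocAn p L) :
    ((dirac z : Distr p L) : Module.Dual L (LocAn p L)) f = (f : ℤ_[p] → L) z := rfl

theorem charZero_of_padic (p : ℕ) [Fact p.Prime] (L : Type*) [NormedField L]
    [NormedAlgebra ℚ_[p] L] : CharZero L :=
  charZero_of_injective_algebraMap (algebraMap ℚ_[p] L).injective

variable {p : ℕ} [Fact p.Prime] (L : Type*) [NormedField L] [NormedAlgebra ℚ_[p] L]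
  [FiniteDimensional ℚ_[p] L]

/-- The function `z ↦ (z - c)ⁿ`. -/
noncomputable def shiftPow (c : ℚ_[p]) (n : ℕ) : LocAn p L :=
  ⟨fun z => (((z : ℚ_[p]) - c) ^ n) • (1 : L), by
    have := FiniteDimensional.complete ℚ_[p] L
    exact mem_locAn_of_analyticAt (F := fun w => ((w - c) ^ n) • (1 : L)) fun e =>
      ((analyticAt_id.sub analyticAt_const).pow n).smul analyticAt_const⟩

theorem shiftPow_apply (c : ℚ_[p]) (n : ℕ) (z : ℤ_[p]) :
    (shiftPow L c n : ℤ_[p] → L) z = (((z : ℚ_[p]) - c) ^ n) • (1 : L) := rfl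

theorem derivLocAn_shiftPow_succ (c : ℚ_[p]) (n : ℕ) :
    derivLocAn (shiftPow L c (n + 1)) = ((n + 1 : ℕ) : L) • shiftPow L c n := by
  refine Subtype.ext (funext fun z => ?_)
  change zDeriv _ z = ((n + 1 : ℕ) : L) • (shiftPow L c n : ℤ_[p] → L) z
  rw [zDeriv_eq_deriv (f := (shiftPow L c (n + 1) : ℤ_[p] → L))
    (F := fun w => ((w - c) ^ (n + 1)) • (1 : L)) (Eventually.of_forall fun w => rfl)]
  have h1 : HasDerivAt (fun w : ℚ_[p] => (w - c) ^ (n + 1)) (((n + 1 : ℕ) : ℚ_[p]) * ((z : ℚ_[p]) - c) ^ n * 1)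
      (z : ℚ_[p]) := ((hasDerivAt_id _).sub_const c).pow (n + 1)
  rw [(h1.smul_const (1 : L)).deriv, shiftPow_apply, mul_one, mul_smul, Algebra.smul_def,
    map_natCast, smul_eq_mul]

theorem derivLocAn_shiftPow_zero (c : ℚ_[p]) :
    derivLocAn (shiftPow L c 0) = 0 := by
  refine Subtype.ext (funext fun z => ?_)
  change zDeriv _ z = 0
  rw [zDeriv_eq_deriv (F := fun _ => (1 : L)) (Eventually.of_forall fun w => by
    rw [shiftPow_apply]; simp)]
  simp

theorem derivLocAn_pow_shiftPow (c : ℚ_[p]) (n : ℕ) :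
    (derivLocAn ^ n : Module.End L (LocAn p L)) (shiftPow L c n) =
      (n.factorial : L) • shiftPow L c 0 := by
  induction n with
  | zero => simp
  | succ n ih =>
    rw [pow_succ]
    change (derivLocAn ^ n : Module.End L (LocAn p L)) (derivLocAn (shiftPow L c (n + 1))) = _
    rw [derivLocAn_shiftPow_succ, map_smul, ih, smul_smul, Nat.factorial_succ, Nat.cast_mul]

theorem derivLocAn_pow_succ_shiftPow_zero (c : ℚ_[p]) (n : ℕ) :
    (derivLocAn ^ (n + 1) : Module.End L (LocAn p L)) (shiftPow L c 0) = 0 := by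
  rw [pow_succ]
  change (derivLocAn ^ n : Module.End L (LocAn p L)) (derivLocAn (shiftPow L c 0)) = 0
  rw [derivLocAn_shiftPow_zero, map_zero]

variable {L}

theorem derivDistr_pow_apply (j : ℕ) (μ : Distr p L) (f : LocAn p L) :
    (((derivDistr ^ j : Module.End L (Distr p L)) μ : Distr p L) : Module.Dual L (LocAn p L)) f =
      (μ : Module.Dual L (LocAn p L)) ((derivLocAn ^ j : Module.End L (LocAn p L)) f) := by
  induction j generalizing f with
  | zero => rfl
  | succ j ih =>
    rw [pow_succ', pow_succ]
    exact ih (derivLocAn f)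

theorem diracDeriv_apply (z : ℤ_[p]) (j : ℕ) (f : LocAn p L) :
    ((diracDeriv z j : Distr p L) : Module.Dual L (LocAn p L)) f =
      (((derivLocAn ^ j : Module.End L (LocAn p L)) f : LocAn p L) : ℤ_[p] → L) z :=
  derivDistr_pow_apply j (dirac z) f

theorem derivDistr_pow_injective (j : ℕ) :
    Function.Injective (derivDistr ^ j : Module.End L (Distr p L)) := by
  rw [Module.End.coe_pow]
  exact derivDistr_injective.iterate j

/-- A distribution of weight `k ≥ 0` invariant under lower unipotent matrices tending to `1` is a
combination of `δ₀` and `δ_{0,k+1}`. -/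
theorem exists_eq_dirac_add_diracDeriv (k : ℕ) (γ : ℕ → S0 p) (h : ℕ → ℤ_[p])
    (h0 : ∀ j, h j ≠ 0) (hlim : Tendsto h atTop (𝓝 0)) (h00 : ∀ j, s0Entry (γ j) 0 0 = 1)
    (h01 : ∀ j, s0Entry (γ j) 0 1 = 0) (h10 : ∀ j, s0Entry (γ j) 1 0 = h j)
    (h11 : ∀ j, s0Entry (γ j) 1 1 = 1) (μ : Distr p L) (hμ : ∀ j, weightActDistr k (γ j) μ = μ) :
    ∃ a b : L, μ = a • dirac 0 + b • diracDeriv 0 (k + 1) := by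
  have hchar := charZero_of_padic p L
  have hfac : ((k + 1).factorial : L) ≠ 0 := Nat.cast_ne_zero.mpr (Nat.factorial_ne_zero _)
  refine ⟨(μ : Module.Dual L (LocAn p L)) (shiftPow L 0 0),
    ((k + 1).factorial : L)⁻¹ * (μ : Module.Dual L (LocAn p L)) (shiftPow L 0 (k + 1)), ?_⟩
  refine Subtype.ext (LinearMap.ext fun f => ?_)
  set A := (f : ℤ_[p] → L) 0 with hA
  set B := (((derivLocAn ^ (k + 1) : Module.End L (LocAn p L)) f : LocAn p L) : ℤ_[p] → L) 0 with hB
  -- Subtracting the Taylor terms of f at 0 of degrees 0 and k + 1 puts it among the functions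
  -- killed by μ, so μ sees only f(0) and the (k+1)-st derivative at 0.
  have key := apply_eq_zero_of_lower_unipotent_invariant k γ h h0 hlim h00 h01 h10 h11 μ hμ
    (f - A • shiftPow L 0 0 - (((k + 1).factorial : L)⁻¹ * B) • shiftPow L 0 (k + 1))
    (by simp [shiftPow_apply, hA]) (fun k' hk' => by
      obtain rfl : k = k' := by exact_mod_cast hk'
      rw [map_sub, map_sub, map_smul, map_smul, derivLocAn_pow_shiftPow,
        derivLocAn_pow_succ_shiftPow_zero]
      simp [shiftPow_apply, ← hB]
      field_simp
      simp)
  rw [map_sub, map_sub, map_smul, map_smul, sub_sub, sub_eq_zero] at key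
  rw [key]
  simp only [Submodule.coe_add, Submodule.coe_smul, LinearMap.add_apply, LinearMap.smul_apply,
    dirac_apply, diracDeriv_apply, smul_eq_mul, ← hA, ← hB]
  ring

/-- A distribution of weight `m < 0` invariant under lower unipotent matrices tending to `1` is a
multiple of `δ₀`. -/
theorem exists_eq_smul_dirac {m : ℤ} (hm : m < 0) (γ : ℕ → S0 p) (h : ℕ → ℤ_[p])
    (h0 : ∀ j, h j ≠ 0) (hlim : Tendsto h atTop (𝓝 0)) (h00 : ∀ j, s0Entry (γ j) 0 0 = 1)
    (h01 : ∀ j, s0Entry (γ j) 0 1 = 0) (h10 : ∀ j, s0Entry (γ j) 1 0 = h j)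
    (h11 : ∀ j, s0Entry (γ j) 1 1 = 1) (μ : Distr p L) (hμ : ∀ j, weightActDistr m (γ j) μ = μ) :
    ∃ a : L, μ = a • dirac 0 := by
  refine ⟨(μ : Module.Dual L (LocAn p L)) (shiftPow L 0 0), Subtype.ext (LinearMap.ext fun f => ?_)⟩
  have key := apply_eq_zero_of_lower_unipotent_invariant m γ h h0 hlim h00 h01 h10 h11 μ hμ
    (f - (f : ℤ_[p] → L) 0 • shiftPow L 0 0) (by simp [shiftPow_apply]) (fun k hk => by omega)
  rw [map_sub, map_smul, sub_eq_zero] at key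
  rw [key]
  simp only [Submodule.coe_smul, LinearMap.smul_apply, dirac_apply, smul_eq_mul]
  ring

end ShiftedPowers

end OMS

namespace OMS

open Filter Topology

/-! ### Bol's identity and the action on Dirac distributions. -/

section BolIdentity
open scoped MatrixGroups

variable {p : ℕ} [Fact p.Prime]

theorem PadicInt.coe_units_zpow (u : ℤ_[p]ˣ) (k : ℤ) :
    (((u ^ k : ℤ_[p]ˣ) : ℤ_[p]) : ℚ_[p]) = ((u : ℤ_[p]) : ℚ_[p]) ^ k := by
  have h := congrArg Units.val (map_zpow (Units.map (PadicInt.Coe.ringHom (p := p) : ℤ_[p] →* ℚ_[p])) u k)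
  rw [Units.val_zpow_eq_zpow_val] at h
  exact h

theorem coe_s0Denom_ne_zero (γ : S0 p) (z : ℤ_[p]) :
    ((s0Entry γ 0 0 : ℤ_[p]) : ℚ_[p]) - (s0Entry γ 1 0 : ℤ_[p]) * (z : ℚ_[p]) ≠ 0 := by
  have h : ((s0Denom γ z : ℤ_[p]) : ℚ_[p]) ≠ 0 := by
    simp
  rwa [s0Denom_val, PadicInt.coe_sub, PadicInt.coe_mul] at h

theorem coe_s0Moebius (γ : S0 p) (z : ℤ_[p]) : ((s0Moebius γ z : ℤ_[p]) : ℚ_[p]) =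
    ((s0Entry γ 1 1 : ℤ_[p]) * (z : ℚ_[p]) - (s0Entry γ 0 1 : ℤ_[p])) /
      ((s0Entry γ 0 0 : ℤ_[p]) - (s0Entry γ 1 0 : ℤ_[p]) * (z : ℚ_[p])) := by
  rw [eq_div_iff (coe_s0Denom_ne_zero γ z)]
  have h := congrArg (fun w : ℤ_[p] => (w : ℚ_[p])) (s0Denom_mul_moebius γ z)
  simp only [s0Denom_val, PadicInt.coe_sub, PadicInt.coe_mul] at h
  rw [mul_comm]
  exact h

/-- The determinant of an element of `S₀(p)` as a `p`-adic integer. -/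
noncomputable def s0Det (γ : S0 p) : ℤ_[p] :=
  s0Entry γ 0 0 * s0Entry γ 1 1 - s0Entry γ 0 1 * s0Entry γ 1 0

theorem coe_s0Det (γ : S0 p) : ((s0Det γ : ℤ_[p]) : ℚ_[p]) =
    ((Matrix.det ((γ : GL (Fin 2) ℚ) : Matrix (Fin 2) (Fin 2) ℚ) : ℚ) : ℚ_[p]) := by
  rw [s0Det, Matrix.det_fin_two]
  push_cast
  rfl

variable {L : Type*} [NormedField L] [NormedAlgebra ℚ_[p] L]

/-- The scalar of `L` defined by a `p`-adic integer. -/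
noncomputable abbrev scal (L : Type*) [NormedField L] [NormedAlgebra ℚ_[p] L] : ℤ_[p] →+* L :=
  (algebraMap ℚ_[p] L).comp PadicInt.Coe.ringHom

theorem scal_smul (x : ℤ_[p]) (v : L) : scal L x • v = (x : ℚ_[p]) • v :=
  algebraMap_smul L (x : ℚ_[p]) v

theorem scal_s0Det (γ : S0 p) : scal L (s0Det γ) =
    ((Matrix.det ((γ : GL (Fin 2) ℚ) : Matrix (Fin 2) (Fin 2) ℚ) : ℚ) : L) := by
  have := charZero_of_padic p L
  rw [← map_ratCast (algebraMap ℚ_[p] L), ← coe_s0Det]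
  rfl

variable [FiniteDimensional ℚ_[p] L]

theorem hasDerivAt_ext0 (f : LocAn p L) (z : ℤ_[p]) :
    HasDerivAt (ext0 (f : ℤ_[p] → L)) (zDeriv (f : ℤ_[p] → L) z) (z : ℚ_[p]) := by
  have := FiniteDimensional.complete ℚ_[p] L
  exact (mem_locAn_iff_analyticAt.mp f.2 z).differentiableAt.hasDerivAt

/-- Multiplication of locally analytic functions by `α + β z`. -/
noncomputable def mulAffine (α β : ℤ_[p]) : LocAn p L →ₗ[L] LocAn p L where
  toFun f := ⟨fun z => ((α + β * z : ℤ_[p]) : ℚ_[p]) • (f : ℤ_[p] → L) z, by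
    have := FiniteDimensional.complete ℚ_[p] L
    refine mem_locAn_iff_analyticAt.mpr fun e => ?_
    refine AnalyticAt.congr (f := fun w => ((α : ℚ_[p]) + β * w) • ext0 (f : ℤ_[p] → L) w)
      ((analyticAt_const.add (analyticAt_const.mul analyticAt_id)).smul
        (mem_locAn_iff_analyticAt.mp f.2 e))
      (ext0_eventuallyEq (Eventually.of_forall fun z => ?_)).symm
    rw [ext0_coe, PadicInt.coe_add, PadicInt.coe_mul]⟩
  map_add' f g := by
    ext z
    simp
  map_smul' c f := by
    ext z
    simp

theorem derivLocAn_mulAffine (α β : ℤ_[p]) (f : LocAn p L) :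
    derivLocAn (mulAffine α β f) = mulAffine α β (derivLocAn f) + scal L β • f := by
  refine Subtype.ext (funext fun z => ?_)
  change zDeriv _ z = ((α + β * z : ℤ_[p]) : ℚ_[p]) • zDeriv (f : ℤ_[p] → L) z +
    scal L β • (f : ℤ_[p] → L) z
  rw [zDeriv_eq_deriv (f := (mulAffine α β f : ℤ_[p] → L))
    (F := fun w => ((α : ℚ_[p]) + β * w) • ext0 (f : ℤ_[p] → L) w)
    (Eventually.of_forall fun z => by
      rw [ext0_coe, ← PadicInt.coe_mul, ← PadicInt.coe_add]; rfl)]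
  have h1 : HasDerivAt (fun w : ℚ_[p] => (α : ℚ_[p]) + β * w) ((β : ℚ_[p]) * 1) (z : ℚ_[p]) :=
    ((hasDerivAt_id _).const_mul _).const_add _
  rw [(h1.fun_smul (hasDerivAt_ext0 f z)).deriv, ext0_coe, mul_one, scal_smul]
  push_cast
  rfl

/-- Leibniz' rule stops after two terms, the second derivative of α + βz being zero. -/
theorem derivLocAn_pow_mulAffine (α β : ℤ_[p]) (n : ℕ) (f : LocAn p L) :
    (derivLocAn ^ (n + 1) : Module.End L (LocAn p L)) (mulAffine α β f) =
      mulAffine α β ((derivLocAn ^ (n + 1) : Module.End L (LocAn p L)) f) +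
        (((n + 1 : ℕ) : L) * scal L β) • (derivLocAn ^ n : Module.End L (LocAn p L)) f := by
  induction n generalizing f with
  | zero => simpa using derivLocAn_mulAffine α β f
  | succ n ih =>
    have e : ∀ (k : ℕ) (g : LocAn p L), (derivLocAn ^ (k + 1) : Module.End L (LocAn p L)) g =
      derivLocAn ((derivLocAn ^ k : Module.End L (LocAn p L)) g) := fun k g => by
        rw [pow_succ']; rfl
    rw [e (n + 1), ih, map_add, map_smul, derivLocAn_mulAffine, ← e, ← e, add_assoc, ← add_smul]
    congr 2
    push_cast
    ring

theorem weightActLocAn_apply (m : ℤ) (γ : S0 p) (f : LocAn p L) (z : ℤ_[p]) :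
    (weightActLocAn m γ f : ℤ_[p] → L) z =
      (((s0Denom γ z ^ m : ℤ_[p]ˣ) : ℤ_[p]) : ℚ_[p]) • (f : ℤ_[p] → L) (s0Moebius γ z) := rfl

theorem mulAffine_weightActLocAn (m : ℤ) (γ : S0 p) (f : LocAn p L) :
    mulAffine (s0Entry γ 0 0) (-s0Entry γ 1 0) (weightActLocAn m γ f) =
      weightActLocAn (m + 1) γ f := by
  refine Subtype.ext (funext fun z => ?_)
  rw [weightActLocAn_apply, zpow_add_one, mul_comm, Units.val_mul, s0Denom_val, PadicInt.coe_mul,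
    mul_smul, sub_eq_add_neg, ← neg_mul]
  rfl

/-- Product and chain rule: (a - cz)^m has derivative -mc(a - cz)^{m-1}, and the Möbius map has
derivative det γ · (a - cz)^{-2}. -/
theorem derivLocAn_weightActLocAn (m : ℤ) (γ : S0 p) (f : LocAn p L) :
    derivLocAn (weightActLocAn m γ f) =
      (-(m : L) * scal L (s0Entry γ 1 0)) • weightActLocAn (m - 1) γ f +
        scal L (s0Det γ) • weightActLocAn (m - 2) γ (derivLocAn f) := by
  refine Subtype.ext (funext fun z => ?_)
  set a : ℚ_[p] := ((s0Entry γ 0 0 : ℤ_[p]) : ℚ_[p]) with ha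
  set b : ℚ_[p] := ((s0Entry γ 0 1 : ℤ_[p]) : ℚ_[p]) with hb
  set c : ℚ_[p] := ((s0Entry γ 1 0 : ℤ_[p]) : ℚ_[p]) with hc
  set d : ℚ_[p] := ((s0Entry γ 1 1 : ℤ_[p]) : ℚ_[p]) with hd
  have hden : ∀ (k : ℤ) (w : ℤ_[p]), (((s0Denom γ w ^ k : ℤ_[p]ˣ) : ℤ_[p]) : ℚ_[p]) =
      (a - c * w) ^ k := fun k w => by
    rw [PadicInt.coe_units_zpow, s0Denom_val, PadicInt.coe_sub, PadicInt.coe_mul]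
  have hu : a - c * (z : ℚ_[p]) ≠ 0 := coe_s0Denom_ne_zero γ z
  change zDeriv _ z = (-(m : L) * scal L (s0Entry γ 1 0)) •
      (weightActLocAn (m - 1) γ f : ℤ_[p] → L) z +
    scal L (s0Det γ) • (weightActLocAn (m - 2) γ (derivLocAn f) : ℤ_[p] → L) z
  rw [zDeriv_eq_deriv (f := (weightActLocAn m γ f : ℤ_[p] → L))
    (F := fun w => ((a - c * w) ^ m) • ext0 (f : ℤ_[p] → L) ((d * w - b) / (a - c * w)))
    (Eventually.of_forall fun w => by
      rw [weightActLocAn_apply, ← coe_s0Moebius, ext0_coe, hden])]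
  have h1 : HasDerivAt (fun w : ℚ_[p] => a - c * w) (-(c * 1)) (z : ℚ_[p]) :=
    ((hasDerivAt_id _).const_mul _).const_sub _
  have h2 : HasDerivAt (fun w : ℚ_[p] => d * w - b) (d * 1) (z : ℚ_[p]) :=
    ((hasDerivAt_id _).const_mul _).sub_const _
  have h3 := h2.fun_div h1 hu
  have h4 := (hasDerivAt_zpow m (a - c * (z : ℚ_[p])) (Or.inl hu)).comp (z : ℚ_[p]) h1
  have h5 : HasDerivAt (ext0 (f : ℤ_[p] → L)) (zDeriv (f : ℤ_[p] → L) (s0Moebius γ z))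
      ((d * (z : ℚ_[p]) - b) / (a - c * (z : ℚ_[p]))) := by
    rw [← coe_s0Moebius]
    exact hasDerivAt_ext0 f _
  have h6 := h4.fun_smul (h5.scomp (z : ℚ_[p]) h3)
  refine h6.deriv.trans ?_
  simp only [Function.comp_def]
  rw [← coe_s0Moebius, ext0_coe, weightActLocAn_apply, weightActLocAn_apply, hden, hden, add_comm]
  have hm : -(m : L) * scal L (s0Entry γ 1 0) = algebraMap ℚ_[p] L (-m * c) := by
    rw [map_mul, map_neg, map_intCast]; rfl
  have hD : scal L (s0Det γ) = algebraMap ℚ_[p] L (a * d - b * c) := by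
    rw [ha, hb, hc, hd, ← PadicInt.coe_mul, ← PadicInt.coe_mul, ← PadicInt.coe_sub]; rfl
  rw [hm, hD, algebraMap_smul, algebraMap_smul]
  congr 1
  · rw [smul_smul]
    congr 1
    ring
  · rw [smul_smul, smul_smul]
    change _ = _ • zDeriv (f : ℤ_[p] → L) (s0Moebius γ z)
    congr 1
    rw [zpow_sub₀ hu, mul_div_assoc', mul_div_assoc', div_eq_div_iff (pow_ne_zero 2 hu)
      (zpow_ne_zero 2 hu)]
    simp only [zpow_ofNat]
    ring

/-- Bol's identity. -/
theorem derivLocAn_pow_weightActLocAn (γ : S0 p) (j : ℕ) (f : LocAn p L) :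
    (derivLocAn ^ j : Module.End L (LocAn p L)) (weightActLocAn ((j : ℤ) - 1) γ f) =
      scal L (s0Det γ) ^ j •
        weightActLocAn (-1 - (j : ℤ)) γ ((derivLocAn ^ j : Module.End L (LocAn p L)) f) := by
  induction j with
  | zero => simp
  | succ j ih =>
    -- The action of weight j is (a - cz) times that of weight j - 1, so Leibniz' rule reduces the
    -- (j+1)-st derivative to the induction hypothesis.
    have e1 : weightActLocAn (((j + 1 : ℕ) : ℤ) - 1) γ f =
        mulAffine (s0Entry γ 0 0) (-s0Entry γ 1 0) (weightActLocAn ((j : ℤ) - 1) γ f) := by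
      rw [mulAffine_weightActLocAn, sub_add_cancel, Nat.cast_succ, add_sub_cancel_right]
    have e2 : ∀ g : LocAn p L, (derivLocAn ^ (j + 1) : Module.End L (LocAn p L)) g =
      derivLocAn ((derivLocAn ^ j : Module.End L (LocAn p L)) g) := fun g => by rw [pow_succ']; rfl
    rw [e1, derivLocAn_pow_mulAffine, e2, e2 f, ih, map_smul, derivLocAn_weightActLocAn, map_smul,
      map_add, map_smul, map_smul, mulAffine_weightActLocAn, mulAffine_weightActLocAn,
      show (-1 - (j : ℤ) - 1 + 1) = -1 - (j : ℤ) by ring,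
      show (-1 - (j : ℤ) - 2 + 1) = -1 - ((j + 1 : ℕ) : ℤ) by push_cast; ring, smul_add, smul_smul,
      smul_smul, smul_smul, ← pow_succ, add_right_comm, ← add_smul]
    -- The two terms of weight -1-j carry opposite coefficients ±(j + 1) c det^j: one from Leibniz'
    -- rule, the other from differentiating the automorphy factor. Only the term with j + 1
    -- derivatives of f remains.
    refine (congrArg₂ (· + ·) ?_ rfl).trans (zero_add _)
    rw [map_neg]
    push_cast
    ring_nf
    simp

theorem weightActDistr_apply (m : ℤ) (γ : S0 p) (μ : Distr p L) (f : LocAn p L) :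
    ((weightActDistr m γ μ : Distr p L) : Module.Dual L (LocAn p L)) f =
      (μ : Module.Dual L (LocAn p L)) (weightActLocAn m γ f) := rfl

theorem weightActDistr_derivDistr_pow (k : ℕ) (γ : S0 p) (μ : Distr p L) :
    weightActDistr (k : ℤ) γ ((derivDistr ^ (k + 1) : Module.End L (Distr p L)) μ) =
      scal L (s0Det γ) ^ (k + 1) • (derivDistr ^ (k + 1) : Module.End L (Distr p L))
        (weightActDistr (-2 - (k : ℤ)) γ μ) := by
  refine Subtype.ext (LinearMap.ext fun f => ?_)
  have h := derivLocAn_pow_weightActLocAn γ (k + 1) f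
  rw [show (((k + 1 : ℕ) : ℤ) - 1) = k by push_cast; ring,
    show (-1 - ((k + 1 : ℕ) : ℤ)) = -2 - (k : ℤ) by push_cast; ring] at h
  rw [weightActDistr_apply, derivDistr_pow_apply, h, map_smul, Submodule.coe_smul,
    LinearMap.smul_apply, derivDistr_pow_apply, weightActDistr_apply]

theorem weightActDistr_dirac (m : ℤ) (γ : S0 p) (z : ℤ_[p]) :
    weightActDistr m γ (dirac z : Distr p L) =
      scal L ((s0Denom γ z ^ m : ℤ_[p]ˣ) : ℤ_[p]) • dirac (s0Moebius γ z) := by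
  refine Subtype.ext (LinearMap.ext fun f => ?_)
  rw [weightActDistr_apply, dirac_apply, weightActLocAn_apply, Submodule.coe_smul,
    LinearMap.smul_apply, dirac_apply, scal_smul]

theorem weightActDistr_diracDeriv (k : ℕ) (γ : S0 p) (z : ℤ_[p]) :
    weightActDistr (k : ℤ) γ (diracDeriv z (k + 1) : Distr p L) =
      (scal L (s0Det γ) ^ (k + 1) * scal L ((s0Denom γ z ^ (-2 - (k : ℤ)) : ℤ_[p]ˣ) : ℤ_[p])) •
        diracDeriv (s0Moebius γ z) (k + 1) := by
  rw [diracDeriv, weightActDistr_derivDistr_pow, weightActDistr_dirac, map_smul, smul_smul]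
  rfl

end BolIdentity

end OMS

namespace OMS

open scoped MatrixGroups

/-! ### Double coset operators on invariants. -/

section HeckeAlgebra

variable {L : Type*} [Field L] {W W' : Type*} [AddCommGroup W] [Module L W] [AddCommGroup W']
  [Module L W'] {S : Submonoid (GL (Fin 2) ℚ)} {σ : S →* (Module.End L W)ᵐᵒᵖ}
  {σ' : S →* (Module.End L W')ᵐᵒᵖ} {Γ : Subgroup (GL (Fin 2) ℚ)}

theorem unop_map_mul_apply (x y : S) (w : W) :
    (σ (x * y)).unop w = (σ y).unop ((σ x).unop w) := by
  rw [map_mul]; rfl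

theorem unop_apply_eq_of_mul_inv_mem (hS : ∀ γ ∈ Γ, γ ∈ S) {w : W} (hw : w ∈ invariants σ Γ)
    {x y : S} (h : (x : GL (Fin 2) ℚ) * (y : GL (Fin 2) ℚ)⁻¹ ∈ Γ) : (σ x).unop w = (σ y).unop w := by
  have h1 : x = ⟨_, hS _ h⟩ * y := Subtype.ext (by simp)
  rw [h1, unop_map_mul_apply, hw _ h]

theorem out_mul_inv_mem (g : GL (Fin 2) ℚ) :
    (Quotient.mk (QuotientGroup.rightRel Γ) g).out * g⁻¹ ∈ Γ := by
  have h := Quotient.mk_out (s := QuotientGroup.rightRel Γ) g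
  have h' := QuotientGroup.rightRel_apply.mp h
  simpa using Γ.inv_mem h'

theorem mk_eq_mk_of_mul_inv_mem {g g' : GL (Fin 2) ℚ} (h : g * g'⁻¹ ∈ Γ) :
    Quotient.mk (QuotientGroup.rightRel Γ) g = Quotient.mk (QuotientGroup.rightRel Γ) g' :=
  Quotient.sound (QuotientGroup.rightRel_apply.mpr (by simpa using Γ.inv_mem h))

/-- `r` is a family of representatives of the right cosets of `Γ` in `Γ s Γ`. -/
structure IsCosetReps {ι : Type*} (Γ : Subgroup (GL (Fin 2) ℚ)) (s : S) (r : ι → S) : Prop where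
  mem : ∀ i, (r i : GL (Fin 2) ℚ) ∈ DoubleCoset.doubleCoset (s : GL (Fin 2) ℚ) Γ Γ
  exists_mul_inv_mem : ∀ g ∈ DoubleCoset.doubleCoset (s : GL (Fin 2) ℚ) Γ Γ,
    ∃ i, g * (r i : GL (Fin 2) ℚ)⁻¹ ∈ Γ
  eq_of_mul_inv_mem : ∀ i j, (r i : GL (Fin 2) ℚ) * (r j : GL (Fin 2) ℚ)⁻¹ ∈ Γ → i = j

theorem mul_mem_doubleCoset {s g x : GL (Fin 2) ℚ} (hx : x ∈ Γ)
    (hg : g ∈ DoubleCoset.doubleCoset s Γ Γ) : x * g ∈ DoubleCoset.doubleCoset s Γ Γ := by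
  obtain ⟨a, ha, b, hb, rfl⟩ := DoubleCoset.mem_doubleCoset.mp hg
  exact DoubleCoset.mem_doubleCoset.mpr ⟨x * a, Γ.mul_mem hx ha, b, hb, by group⟩

theorem mul_mem_doubleCoset' {s g x : GL (Fin 2) ℚ} (hx : x ∈ Γ)
    (hg : g ∈ DoubleCoset.doubleCoset s Γ Γ) : g * x ∈ DoubleCoset.doubleCoset s Γ Γ := by
  obtain ⟨a, ha, b, hb, rfl⟩ := DoubleCoset.mem_doubleCoset.mp hg
  exact DoubleCoset.mem_doubleCoset.mpr ⟨a, ha, b * x, Γ.mul_mem hb hx, by group⟩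

theorem isCosetReps_cosetReps (hS : ∀ γ ∈ Γ, γ ∈ S) (s : S) :
    IsCosetReps Γ s (Subtype.val : cosetReps Γ s → S) where
  mem r := r.2.1
  exists_mul_inv_mem g hg := by
    have h1 := out_mul_inv_mem (Γ := Γ) g
    have h2 := mul_mem_doubleCoset h1 hg
    rw [inv_mul_cancel_right] at h2
    have hmem : (Quotient.mk (QuotientGroup.rightRel Γ) g).out ∈ S := by
      obtain ⟨a, ha, b, hb, h⟩ := DoubleCoset.mem_doubleCoset.mp h2
      rw [h]
      exact S.mul_mem (S.mul_mem (hS a ha) s.2) (hS b hb)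
    refine ⟨⟨⟨_, hmem⟩, h2, ?_⟩, ?_⟩
    · simp only [Quotient.out_eq]
    · simpa using Γ.inv_mem h1
  eq_of_mul_inv_mem r r' h := by
    refine Subtype.ext (Subtype.ext ?_)
    rw [← r.2.2, ← r'.2.2, mk_eq_mk_of_mul_inv_mem h]

theorem IsCosetReps.mul_right {ι : Type*} {s : S} {r : ι → S} (h : IsCosetReps Γ s r) {γ : S}
    (hγ : (γ : GL (Fin 2) ℚ) ∈ Γ) : IsCosetReps Γ s (fun i => r i * γ) where
  mem i := mul_mem_doubleCoset' hγ (h.mem i)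
  exists_mul_inv_mem g hg := by
    obtain ⟨i, hi⟩ := h.exists_mul_inv_mem _ (mul_mem_doubleCoset' (Γ.inv_mem hγ) hg)
    refine ⟨i, ?_⟩
    rw [Submonoid.coe_mul, mul_inv_rev, ← mul_assoc]
    exact hi
  eq_of_mul_inv_mem i j hij := by
    refine h.eq_of_mul_inv_mem i j ?_
    rw [Submonoid.coe_mul, Submonoid.coe_mul, mul_inv_rev, ← mul_assoc, mul_inv_cancel_right] at hij
    exact hij

/-- On an invariant vector the summand depends only on the right coset Γr, so any system of
representatives computes the operator. -/
theorem hecke_apply_eq_sum (hS : ∀ γ ∈ Γ, γ ∈ S) {ι : Type*} [Fintype ι] {s : S} {r : ι → S}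
    (h : IsCosetReps Γ s r) {w : W} (hw : w ∈ invariants σ Γ) :
    hecke σ Γ s w = ∑ i, (σ (r i)).unop w := by
  have h0 := isCosetReps_cosetReps hS s
  choose φ hφ using fun i => h0.exists_mul_inv_mem _ (h.mem i)
  have hinj : Function.Injective fun i => (φ i : S) := fun i j hij => by
    refine h.eq_of_mul_inv_mem i j ?_
    have h1 := hφ j
    simp only at hij
    rw [← hij] at h1
    simpa using Γ.mul_mem (hφ i) (Γ.inv_mem h1)
  have hrange : cosetReps Γ s = Set.range fun i => (φ i : S) := by
    refine Set.Subset.antisymm (fun x hx => ?_) (by rintro _ ⟨i, rfl⟩; exact (φ i).2)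
    obtain ⟨i, hi⟩ := h.exists_mul_inv_mem _ hx.1
    refine ⟨i, ?_⟩
    have h1 := Γ.mul_mem hi (hφ i)
    rw [← mul_assoc, inv_mul_cancel_right] at h1
    exact congrArg Subtype.val (h0.eq_of_mul_inv_mem ⟨x, hx⟩ (φ i) h1).symm
  rw [hecke, hrange, finsum_mem_range hinj, finsum_eq_sum_of_fintype, LinearMap.sum_apply]
  exact Finset.sum_congr rfl fun i _ => (unop_apply_eq_of_mul_inv_mem hS hw (hφ i)).symm

theorem hecke_apply (s : S) (hfin : (cosetReps Γ s).Finite) (w : W) :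
    hecke σ Γ s w = ∑ r ∈ hfin.toFinset, (σ r).unop w := by
  rw [hecke, finsum_mem_eq_finite_toFinset_sum _ hfin, LinearMap.sum_apply]

/-- Right multiplication by γ ∈ Γ turns one system of representatives of Γ s Γ into another. -/
theorem hecke_mem_invariants (hS : ∀ γ ∈ Γ, γ ∈ S) (s : S) (hfin : (cosetReps Γ s).Finite) {w : W}
    (hw : w ∈ invariants σ Γ) : hecke σ Γ s w ∈ invariants σ Γ := fun γ hγ => by
  have := hfin.fintype
  have h0 := isCosetReps_cosetReps hS s
  nth_rewrite 1 [hecke_apply_eq_sum hS h0 hw]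
  rw [hecke_apply_eq_sum hS (h0.mul_right hγ) hw, map_sum]
  exact Finset.sum_congr rfl fun i _ => (unop_map_mul_apply _ _ _).symm

/-- Both operators sum over the same chosen representatives, so the comparison is term by term and w
need not be invariant. -/
theorem hecke_intertwine (s : S) (hfin : (cosetReps Γ s).Finite) (T : W →ₗ[L] W') (c : L)
    (h : ∀ r ∈ cosetReps Γ s, ∀ w, (σ' r).unop (T w) = c • T ((σ r).unop w)) (w : W) :
    hecke σ' Γ s (T w) = c • T (hecke σ Γ s w) := by
  rw [hecke_apply s hfin, hecke_apply s hfin, map_sum, Finset.smul_sum]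
  exact Finset.sum_congr rfl fun r hr => h r (hfin.mem_toFinset.mp hr) w

end HeckeAlgebra

/-! ### The group Γ₁(N) ∩ Γ₀(p) and the finiteness of its double cosets. -/

section LevelGroup

open Matrix.SpecialLinearGroup CongruenceSubgroup

variable {p N : ℕ}

theorem mem_levelGroup_iff {g : GL (Fin 2) ℚ} : g ∈ levelGroup p N ↔
    ∃ A B C D : ℤ, (g : Matrix (Fin 2) (Fin 2) ℚ) = !![(A : ℚ), (B : ℚ); (C : ℚ), (D : ℚ)] ∧
      A * D - B * C = 1 ∧ (N : ℤ) ∣ A - 1 ∧ (N : ℤ) ∣ D - 1 ∧ (N : ℤ) ∣ C ∧ (p : ℤ) ∣ C := by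
  constructor
  · rintro ⟨x, ⟨hx1, hx0⟩, rfl⟩
    have h1 := Gamma1_mem N x |>.mp hx1
    have h0 := Gamma0_mem.mp hx0
    refine ⟨x 0 0, x 0 1, x 1 0, x 1 1, ?_, ?_, ?_, ?_, ?_, ?_⟩
    · ext i j
      fin_cases i <;> fin_cases j <;> rfl
    · rw [← Matrix.det_fin_two]; exact x.2
    · rw [← ZMod.intCast_zmod_eq_zero_iff_dvd]; push_cast; rw [h1.1, sub_self]
    · rw [← ZMod.intCast_zmod_eq_zero_iff_dvd]; push_cast; rw [h1.2.1, sub_self]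
    · rw [← ZMod.intCast_zmod_eq_zero_iff_dvd]; exact h1.2.2
    · rw [← ZMod.intCast_zmod_eq_zero_iff_dvd]; exact h0
  · rintro ⟨A, B, C, D, hg, hdet, hA, hD, hC, hC'⟩
    refine ⟨⟨!![A, B; C, D], by rw [Matrix.det_fin_two_of]; exact hdet⟩, ⟨?_, ?_⟩, ?_⟩
    · refine (Gamma1_mem N _).mpr ⟨?_, ?_, ?_⟩
      · have := (ZMod.intCast_zmod_eq_zero_iff_dvd _ N).mpr hA
        push_cast at this
        exact sub_eq_zero.mp this
      · have := (ZMod.intCast_zmod_eq_zero_iff_dvd _ N).mpr hD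
        push_cast at this
        exact sub_eq_zero.mp this
      · exact (ZMod.intCast_zmod_eq_zero_iff_dvd _ N).mpr hC
    · exact Gamma0_mem.mpr ((ZMod.intCast_zmod_eq_zero_iff_dvd _ p).mpr hC')
    · refine Units.ext (hg.symm ▸ ?_)
      ext i j
      fin_cases i <;> fin_cases j <;> rfl

theorem det_of_mem_levelGroup {g : GL (Fin 2) ℚ} (hg : g ∈ levelGroup p N) :
    Matrix.det (g : Matrix (Fin 2) (Fin 2) ℚ) = 1 := by
  obtain ⟨A, B, C, D, hg, hdet, -⟩ := mem_levelGroup_iff.mp hg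
  rw [hg, Matrix.det_fin_two_of]
  exact_mod_cast hdet

theorem mapGL_mem_levelGroup_of_mem_Gamma {x : SL(2, ℤ)} (hx : x ∈ Gamma (N * p)) :
    Matrix.SpecialLinearGroup.mapGL ℚ x ∈ levelGroup p N := by
  have h := Gamma_mem.mp hx
  have hd : ∀ a : ℤ, (a : ZMod (N * p)) = 0 → (N : ℤ) ∣ a ∧ (p : ℤ) ∣ a := fun a ha => by
    have h1 := (ZMod.intCast_zmod_eq_zero_iff_dvd a (N * p)).mp ha
    push_cast at h1
    exact ⟨(Dvd.intro _ rfl).trans h1, (Dvd.intro_left _ rfl).trans h1⟩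
  refine mem_levelGroup_iff.mpr ⟨x 0 0, x 0 1, x 1 0, x 1 1, ?_, ?_, ?_, ?_, (hd _ h.2.2.1).1,
    (hd _ h.2.2.1).2⟩
  · ext i j
    fin_cases i <;> fin_cases j <;> rfl
  · rw [← Matrix.det_fin_two]; exact x.2
  · exact (hd _ (by push_cast; rw [h.1, sub_self])).1
  · exact (hd _ (by push_cast; rw [h.2.2.2, sub_self])).1

variable [Fact p.Prime]

theorem mem_S0_of_mem_levelGroup (g : GL (Fin 2) ℚ) (hg : g ∈ levelGroup p N) : g ∈ S0 p := by
  obtain ⟨A, B, C, D, hg, hdet, -, -, -, hC⟩ := mem_levelGroup_iff.mp hg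
  have hint : ∀ i j, ‖((g i j : ℚ) : ℚ_[p])‖ ≤ 1 := fun i j => by
    rw [hg]
    fin_cases i <;> fin_cases j <;> simpa using Padic.norm_int_le_one _
  refine ⟨hint, le_antisymm (hint 0 0) (not_lt.mp fun h => ?_), ?_⟩
  · rw [hg] at h
    have hA : (p : ℤ) ∣ A := Padic.norm_intCast_lt_one_iff.mp (by simpa using h)
    have h1 : (p : ℤ) ∣ 1 := by
      rw [← hdet]
      exact dvd_sub (Dvd.dvd.mul_right hA _) (Dvd.dvd.mul_left hC _)
    exact (Nat.Prime.one_lt Fact.out).ne' (Nat.dvd_one.mp (by exact_mod_cast h1))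
  · rw [hg]
    simpa using Padic.norm_intCast_lt_one_iff.mpr hC

theorem det_of_mem_cosetReps {s r : S0 p} (hr : r ∈ cosetReps (levelGroup p N) s) :
    Matrix.det ((r : GL (Fin 2) ℚ) : Matrix (Fin 2) (Fin 2) ℚ) =
      Matrix.det ((s : GL (Fin 2) ℚ) : Matrix (Fin 2) (Fin 2) ℚ) := by
  obtain ⟨a, ha, b, hb, h⟩ := DoubleCoset.mem_doubleCoset.mp hr.1
  rw [h, Units.val_mul, Units.val_mul, Matrix.det_mul, Matrix.det_mul, det_of_mem_levelGroup ha,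
    det_of_mem_levelGroup hb, one_mul, mul_one]

/-- Some Γ(M) is conjugated by s into Γ(Np), hence into the level group. So the coset of a·s·b
depends only on b mod M, and SL₂(ℤ/M) is finite. -/
theorem finite_cosetReps (hN : N ≠ 0) (s : S0 p) : (cosetReps (levelGroup p N) s).Finite := by
  have : NeZero (N * p) := ⟨mul_ne_zero hN (Fact.out : p.Prime).ne_zero⟩
  obtain ⟨M, hM, hconj⟩ := exists_Gamma_le_conj (s : GL (Fin 2) ℚ) (N * p)
  have : NeZero M := ⟨hM⟩
  choose a ha b hb h using fun r : cosetReps (levelGroup p N) s =>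
    DoubleCoset.mem_doubleCoset.mp r.2.1
  choose y hy hyb using hb
  let F : cosetReps (levelGroup p N) s → SL(2, ZMod M) := fun r =>
    Matrix.SpecialLinearGroup.map (Int.castRingHom (ZMod M)) (y r)
  have hF : Function.Injective F := fun r r' hrr => by
    refine (isCosetReps_cosetReps mem_S0_of_mem_levelGroup s).eq_of_mul_inv_mem r r' ?_
    have hmem : y r * (y r')⁻¹ ∈ Gamma M := by
      refine Gamma_mem'.mpr ?_
      rw [map_mul, map_inv]
      exact mul_inv_eq_one.mpr hrr
    obtain ⟨x, hx, hx'⟩ := hconj _ hmem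
    have h1 : (s : GL (Fin 2) ℚ) * (b r * (b r')⁻¹) * (s : GL (Fin 2) ℚ)⁻¹ ∈ levelGroup p N := by
      rw [← hyb, ← hyb, ← map_inv, ← map_mul, ← hx']
      exact mapGL_mem_levelGroup_of_mem_Gamma hx
    have h2 := (levelGroup p N).mul_mem ((levelGroup p N).mul_mem (ha r) h1)
      ((levelGroup p N).inv_mem (ha r'))
    rw [h r, h r']
    convert h2 using 1
    group
  exact Set.finite_coe_iff.mp (Finite.of_injective F hF)

end LevelGroup

end OMS

namespace OMS

open Filter Topology
open scoped MatrixGroups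

/-! ### Explicit elements of S₀(p) and their action on cusps. -/

section Matrices
variable {p : ℕ} [Fact p.Prime]

variable (p) in
/-- The conditions on `(a b; c d)` to be in `S₀(p)`. -/
def IsS0 (a b c d : ℚ) : Prop :=
  a * d - b * c ≠ 0 ∧ ‖(a : ℚ_[p])‖ = 1 ∧ ‖(b : ℚ_[p])‖ ≤ 1 ∧ ‖(c : ℚ_[p])‖ < 1 ∧ ‖(d : ℚ_[p])‖ ≤ 1

/-- The element `(a b; c d)` of `S₀(p)`. -/
noncomputable def s0Mk (a b c d : ℚ) (h : IsS0 p a b c d) : S0 p :=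
  ⟨Matrix.GeneralLinearGroup.mkOfDetNeZero !![a, b; c, d] (by
    rw [Matrix.det_fin_two_of]; exact h.1), by
    obtain ⟨-, h1, h2, h3, h4⟩ := h
    refine ⟨fun i j => ?_, h1, h3⟩
    fin_cases i <;> fin_cases j
    exacts [h1.le, h2, h3.le, h4]⟩

theorem coe_s0Mk {a b c d : ℚ} (h : IsS0 p a b c d) :
    ((s0Mk a b c d h : GL (Fin 2) ℚ) : Matrix (Fin 2) (Fin 2) ℚ) = !![a, b; c, d] := rfl

theorem s0_ext {x y : S0 p} (h : ((x : GL (Fin 2) ℚ) : Matrix (Fin 2) (Fin 2) ℚ) =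
    ((y : GL (Fin 2) ℚ) : Matrix (Fin 2) (Fin 2) ℚ)) : x = y := Subtype.ext (Units.ext h)

theorem s0Entry_eq {γ : S0 p} {i j : Fin 2} {x : ℤ_[p]}
    (h : ((((γ : GL (Fin 2) ℚ) : Matrix (Fin 2) (Fin 2) ℚ) i j : ℚ) : ℚ_[p]) = x) :
    s0Entry γ i j = x := Subtype.ext h

theorem smul_coe_eq {g : GL (Fin 2) ℚ} {a b c d x y : ℚ}
    (hg : (g : Matrix (Fin 2) (Fin 2) ℚ) = !![a, b; c, d]) (h0 : c * x + d ≠ 0)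
    (h : a * x + b = y * (c * x + d)) : g • (x : OnePoint ℚ) = (y : OnePoint ℚ) := by
  have h10 : g 1 0 = c := by rw [hg]; rfl
  have h11 : g 1 1 = d := by rw [hg]; rfl
  have h00 : g 0 0 = a := by rw [hg]; rfl
  have h01 : g 0 1 = b := by rw [hg]; rfl
  rw [OnePoint.smul_some_eq_ite, h10, h11, if_neg h0, h00, h01, h, mul_div_cancel_right₀ _ h0]

theorem smul_infty_eq {g : GL (Fin 2) ℚ} {a b d : ℚ}
    (hg : (g : Matrix (Fin 2) (Fin 2) ℚ) = !![a, b; 0, d]) :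
    g • (OnePoint.infty : OnePoint ℚ) = OnePoint.infty := by
  rw [OnePoint.smul_infty_eq_self_iff, hg]; rfl

end Matrices

/-! ### Values of boundary symbols at the cusps. -/

section CuspValues
variable {p : ℕ} [Fact p.Prime] {N : ℕ} {L : Type*} [NormedField L] [NormedAlgebra ℚ_[p] L]
  [FiniteDimensional ℚ_[p] L]

theorem divAct_single (g : GL (Fin 2) ℚ) (x : OnePoint ℚ) (n : ℤ) :
    divAct g (Finsupp.single x n) = Finsupp.single (g • x) n :=
  Finsupp.mapDomain_single

theorem homRep_divAct_apply_single (m : ℤ) (γ : S0 p) (φ : CuspDiv →+ Distr p L) (x : OnePoint ℚ) :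
    (homRep divAct (distrRep L m) γ).unop φ (Finsupp.single x 1) =
      weightActDistr m γ (φ (Finsupp.single ((γ : GL (Fin 2) ℚ) • x) 1)) := by
  rw [← divAct_single]
  rfl

theorem weightActDistr_mul (m : ℤ) (γ δ : S0 p) (μ : Distr p L) :
    weightActDistr m (γ * δ) μ = weightActDistr m δ (weightActDistr m γ μ) := by
  have h : (distrRep L m (γ * δ)).unop μ =
      (distrRep L m δ).unop ((distrRep L m γ).unop μ) := by rw [map_mul]; rfl
  exact h

theorem weightActDistr_one (m : ℤ) (μ : Distr p L) : weightActDistr m (1 : S0 p) μ = μ := by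
  have h : (distrRep L m (1 : S0 p)).unop μ = μ := by rw [map_one]; rfl
  exact h

/-- The boundary symbols `Hom(Δ, 𝒟ₘ†)^Γ`. -/
noncomputable abbrev BdInv (p : ℕ) [Fact p.Prime] (N : ℕ) (L : Type*) [NormedField L]
    [NormedAlgebra ℚ_[p] L] [FiniteDimensional ℚ_[p] L] (m : ℤ) :
    Submodule L (CuspDiv →+ Distr p L) :=
  invariants (homRep divAct (distrRep (p := p) L m)) (levelGroup p N)

/-- Δ is free on the cusps, so invariance may be tested one cusp at a time. -/
theorem mem_bdInv_iff {m : ℤ} {φ : CuspDiv →+ Distr p L} : φ ∈ BdInv p N L m ↔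
    ∀ γ : S0 p, (γ : GL (Fin 2) ℚ) ∈ levelGroup p N → ∀ x : OnePoint ℚ,
      weightActDistr m γ (φ (Finsupp.single ((γ : GL (Fin 2) ℚ) • x) 1)) =
        φ (Finsupp.single x 1) := by
  refine ⟨fun h γ hγ x => ?_, fun h γ hγ => Finsupp.addHom_ext' fun x => AddMonoidHom.ext_int ?_⟩
  · rw [← homRep_divAct_apply_single, h γ hγ]
  · simpa [homRep_divAct_apply_single] using h γ hγ x

/-- The value at `x` of a boundary symbol, moved by `g ∈ S₀(p) ∩ S₀(p)⁻¹`, is invariant under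
`g⁻¹ Γₓ g ∩ S₀(p)`. -/
theorem weightActDistr_conj {m : ℤ} {φ : CuspDiv →+ Distr p L} (hφ : φ ∈ BdInv p N L m)
    {x : OnePoint ℚ} {g γ δ : S0 p} (hδ : (δ : GL (Fin 2) ℚ) ∈ levelGroup p N)
    (hx : (δ : GL (Fin 2) ℚ) • x = x) (h : g * γ = δ * g) :
    weightActDistr m γ (weightActDistr m g (φ (Finsupp.single x 1))) =
      weightActDistr m g (φ (Finsupp.single x 1)) := by
  have h1 := mem_bdInv_iff.mp hφ δ hδ x
  rw [hx] at h1
  rw [← weightActDistr_mul, h, weightActDistr_mul, h1]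

theorem eq_of_mul_eq_one (m : ℤ) {g g' : S0 p} (h : g * g' = 1) (μ : Distr p L) :
    weightActDistr m g' (weightActDistr m g μ) = μ := by
  rw [← weightActDistr_mul, h, weightActDistr_one]

theorem tendsto_const_mul_pow (M : ℤ) :
    Tendsto (fun j : ℕ => ((M * (p : ℤ) ^ j : ℤ) : ℤ_[p])) atTop (𝓝 0) := by
  have h := (tendsto_pow_atTop_nhds_zero_of_norm_lt_one (x := (p : ℤ_[p]))
    (show ‖(p : ℚ_[p])‖ < 1 from Padic.norm_p_lt_one)).const_mul (M : ℤ_[p])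
  simpa using h

theorem isS0_upper {b : ℚ} (hb : ‖(b : ℚ_[p])‖ ≤ 1) : IsS0 p 1 b 0 1 :=
  ⟨by simp, by simp, hb, by simp, by simp⟩

theorem isS0_lower {c : ℚ} (hc : ‖(c : ℚ_[p])‖ < 1) : IsS0 p 1 0 c 1 :=
  ⟨by simp, by simp, by simp, hc, by simp⟩

theorem norm_ratCast_intCast_le_one (n : ℤ) : ‖(((n : ℤ) : ℚ) : ℚ_[p])‖ ≤ 1 := by
  rw [Rat.cast_intCast]; exact Padic.norm_int_le_one n

theorem mul_pow_ne_zero {M : ℤ} (hM : M ≠ 0) (j : ℕ) : ((M * (p : ℤ) ^ j : ℤ) : ℤ_[p]) ≠ 0 := by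
  have hp : (p : ℤ) ≠ 0 := by exact_mod_cast (Fact.out : p.Prime).ne_zero
  exact Int.cast_ne_zero.mpr (mul_ne_zero hM (pow_ne_zero j hp))

theorem eq_zero_of_forall_upper (m : ℤ) {M : ℤ} (hM : M ≠ 0) (μ : Distr p L)
    (hμ : ∀ j : ℕ, weightActDistr m (s0Mk 1 ((M * (p : ℤ) ^ j : ℤ) : ℚ) 0 1
      (isS0_upper (norm_ratCast_intCast_le_one _))) μ = μ) : μ = 0 := by
  refine eq_zero_of_upper_unipotent_invariant m _ (fun j : ℕ => ((M * (p : ℤ) ^ j : ℤ) : ℤ_[p]))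
    (mul_pow_ne_zero hM) (tendsto_const_mul_pow M) (fun j => ?_) (fun j => ?_) (fun j => ?_)
    (fun j => ?_) μ hμ <;> refine s0Entry_eq ?_ <;> simp [coe_s0Mk]

/-- The matrices (1 p^j; 0 1) lie in Γ, fix ∞ and tend to 1. -/
theorem apply_infty_eq_zero {m : ℤ} {φ : CuspDiv →+ Distr p L} (hφ : φ ∈ BdInv p N L m) :
    φ (Finsupp.single OnePoint.infty 1) = 0 := by
  refine eq_zero_of_forall_upper m (M := 1) one_ne_zero _ fun j => ?_
  have h := weightActDistr_conj hφ (x := OnePoint.infty) (g := 1) (γ := s0Mk 1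
    ((1 * (p : ℤ) ^ j : ℤ) : ℚ) 0 1 (isS0_upper (norm_ratCast_intCast_le_one _))) (δ := s0Mk 1
    ((1 * (p : ℤ) ^ j : ℤ) : ℚ) 0 1 (isS0_upper (norm_ratCast_intCast_le_one _)))
    (mem_levelGroup_iff.mpr ⟨1, 1 * (p : ℤ) ^ j, 0, 1, by rw [coe_s0Mk]; simp, by simp, by simp,
      by simp, by simp, by simp⟩) (smul_infty_eq (coe_s0Mk _)) (by rw [one_mul, mul_one])
  simpa [weightActDistr_one] using h

/-- For |c| > 1 the matrix (1 0; c⁻¹ 1) lies in S₀(p), as does its inverse, and sends ∞ to c. It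
conjugates small upper unipotents into the stabiliser of c in Γ, which reduces the claim to the
argument used at ∞. -/
theorem apply_eq_zero_of_one_lt_norm (hN : N ≠ 0) {m : ℤ} {φ : CuspDiv →+ Distr p L}
    (hφ : φ ∈ BdInv p N L m) {c : ℚ} (hc : 1 < ‖(c : ℚ_[p])‖) :
    φ (Finsupp.single (c : OnePoint ℚ) 1) = 0 := by
  have hc0 : c ≠ 0 := by rintro rfl; norm_num at hc
  have hκ : ‖((c⁻¹ : ℚ) : ℚ_[p])‖ < 1 := by
    rw [Rat.cast_inv, norm_inv]; exact inv_lt_one_of_one_lt₀ hc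
  have hκ' : ‖((-c⁻¹ : ℚ) : ℚ_[p])‖ < 1 := by rwa [Rat.cast_neg, norm_neg]
  have hu : c.num ≠ 0 := Rat.num_ne_zero.mpr hc0
  have hM : (N : ℤ) * c.num ^ 2 ≠ 0 := mul_ne_zero (by exact_mod_cast hN) (pow_ne_zero 2 hu)
  have hcu : c⁻¹ * c.num = c.den := by
    have h1 := Rat.mul_den_eq_num c
    rw [← h1]
    field_simp
  suffices H : weightActDistr m (s0Mk 1 0 c⁻¹ 1 (isS0_lower hκ))
      (φ (Finsupp.single (c : OnePoint ℚ) 1)) = 0 by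
    have h1 : s0Mk 1 0 c⁻¹ 1 (isS0_lower hκ) * s0Mk 1 0 (-c⁻¹) 1 (isS0_lower hκ') = 1 := by
      refine s0_ext ?_
      rw [Submonoid.coe_mul, Units.val_mul, coe_s0Mk, coe_s0Mk, Matrix.mul_fin_two]
      simp [Matrix.one_fin_two]
    rw [← eq_of_mul_eq_one m h1 (φ (Finsupp.single (c : OnePoint ℚ) 1)), H, map_zero]
  refine eq_zero_of_forall_upper m hM _ fun j => ?_
  set q : ℤ := (p : ℤ) ^ j with hq
  -- The factor N·num² clears the denominators of h, h/c and h/c² and makes them multiples of N, so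
  -- the conjugated unipotent meets the conditions at N.
  set h : ℚ := (((N : ℤ) * c.num ^ 2 * q : ℤ) : ℚ) with hh
  have e1 : h * c⁻¹ = ((N * (c.num * c.den * q) : ℤ) : ℚ) := by
    rw [hh]; push_cast; rw [← hcu]; ring
  have e2 : c⁻¹ ^ 2 * h = ((N * (c.den ^ 2 * q) : ℤ) : ℚ) := by
    rw [hh]; push_cast; rw [← hcu]; ring
  -- This is (1 0; c⁻¹ 1)(1 h; 0 1)(1 0; -c⁻¹ 1).
  have hmat : IsS0 p (1 - h * c⁻¹) h (-(c⁻¹ ^ 2 * h)) (1 + h * c⁻¹) := by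
    have hhn : ‖(h : ℚ_[p])‖ ≤ 1 := norm_ratCast_intCast_le_one _
    have h3 : ‖((h * c⁻¹ : ℚ) : ℚ_[p])‖ < 1 := by
      rw [Rat.cast_mul, norm_mul]
      exact mul_lt_one_of_nonneg_of_lt_one_right hhn (norm_nonneg _) hκ
    have h3' : ‖-((h * c⁻¹ : ℚ) : ℚ_[p])‖ < 1 := by rwa [norm_neg]
    refine ⟨ne_of_eq_of_ne (by ring) one_ne_zero, ?_, hhn, ?_, ?_⟩
    · rw [Rat.cast_sub, Rat.cast_one, sub_eq_add_neg, Padic.add_eq_max_of_ne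
        (by rw [norm_one]; exact h3'.ne'), norm_one]
      exact max_eq_left h3'.le
    · rw [Rat.cast_neg, norm_neg, Rat.cast_mul, norm_mul, Rat.cast_pow, norm_pow]
      exact mul_lt_one_of_nonneg_of_lt_one_left (by positivity)
        (pow_lt_one₀ (norm_nonneg _) hκ two_ne_zero) hhn
    · rw [e1]
      have := norm_ratCast_intCast_le_one (p := p) (1 + N * (c.num * c.den * q))
      push_cast at this ⊢
      exact this
  refine weightActDistr_conj hφ (δ := s0Mk _ _ _ _ hmat) (mem_levelGroup_iff.mpr
    ⟨1 - N * (c.num * c.den * q), N * c.num ^ 2 * q, -(N * (c.den ^ 2 * q)),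
      1 + N * (c.num * c.den * q), ?_, by ring, ?_, ?_, ?_, ?_⟩) ?_ ?_
  · rw [coe_s0Mk, e1, e2, hh]; push_cast; rfl
  · exact ⟨-(c.num * c.den * q), by ring⟩
  · exact ⟨c.num * c.den * q, by ring⟩
  · exact ⟨-(c.den ^ 2 * q), by ring⟩
  · have h1 := hmat.2.2.2.1
    rw [e2, Rat.cast_neg, norm_neg, Rat.cast_intCast, Padic.norm_intCast_lt_one_iff] at h1
    exact (dvd_neg).mpr h1
  · refine smul_coe_eq (coe_s0Mk _) (ne_of_eq_of_ne ?_ one_ne_zero) ?_ <;> field_simp <;> ring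
  · refine s0_ext ?_
    rw [Submonoid.coe_mul, Units.val_mul, Submonoid.coe_mul, Units.val_mul, coe_s0Mk, coe_s0Mk,
      coe_s0Mk, Matrix.mul_fin_two, Matrix.mul_fin_two, ← hh]
    clear_value h
    ext i j
    fin_cases i <;> fin_cases j <;> simp <;> ring

/-- The value of a boundary symbol at `c ∈ C₀`, translated to `0`, is invariant under lower
unipotent matrices. -/
theorem exists_lower_unipotent_invariant (hN : N ≠ 0) {m : ℤ} {φ : CuspDiv →+ Distr p L}
    (hφ : φ ∈ BdInv p N L m) {c : ℚ} (hc : ‖(c : ℚ_[p])‖ ≤ 1) :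
    ∃ (γ : ℕ → S0 p) (h : ℕ → ℤ_[p]), (∀ j, h j ≠ 0) ∧ Tendsto h atTop (𝓝 0) ∧
      (∀ j, s0Entry (γ j) 0 0 = 1) ∧ (∀ j, s0Entry (γ j) 0 1 = 0) ∧
      (∀ j, s0Entry (γ j) 1 0 = h j) ∧ (∀ j, s0Entry (γ j) 1 1 = 1) ∧
      ∀ j, weightActDistr m (γ j) (weightActDistr m (s0Mk 1 c 0 1 (isS0_upper hc))
        (φ (Finsupp.single (c : OnePoint ℚ) 1))) = weightActDistr m (s0Mk 1 c 0 1 (isS0_upper hc))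
        (φ (Finsupp.single (c : OnePoint ℚ) 1)) := by
  have hp : (p : ℤ) ≠ 0 := by exact_mod_cast (Fact.out : p.Prime).ne_zero
  have hden : c * c.den = c.num := Rat.mul_den_eq_num c
  have hM : (N : ℤ) * p * c.den ^ 2 ≠ 0 := mul_ne_zero (mul_ne_zero (by exact_mod_cast hN) hp)
    (pow_ne_zero 2 (by exact_mod_cast c.den_ne_zero))
  have hlt : ∀ n : ℤ, ‖(((N * p * n : ℤ) : ℚ) : ℚ_[p])‖ < 1 := fun n => by
    rw [Rat.cast_intCast, Padic.norm_intCast_lt_one_iff]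
    exact ⟨N * n, by ring⟩
  have hlt' : ∀ j : ℕ, ‖(((N * p * c.den ^ 2 * (p : ℤ) ^ j : ℤ) : ℚ) : ℚ_[p])‖ < 1 := fun j => by
    rw [mul_assoc ((N : ℤ) * p)]; exact hlt _
  refine ⟨fun j => s0Mk 1 0 ((N * p * c.den ^ 2 * (p : ℤ) ^ j : ℤ) : ℚ) 1 (isS0_lower (hlt' j)),
    fun j => ((N * p * c.den ^ 2 * (p : ℤ) ^ j : ℤ) : ℤ_[p]), mul_pow_ne_zero hM,
    tendsto_const_mul_pow _, fun j => ?_, fun j => ?_, fun j => ?_, fun j => ?_, fun j => ?_⟩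
  iterate 4 · refine s0Entry_eq ?_; simp [coe_s0Mk]
  set q : ℤ := (p : ℤ) ^ j with hq
  -- The factor Np·den² makes h, ch and c²h integers divisible by Np. Hence (1 c; 0 1)(1 0; h 1)(1
  -- -c; 0 1) = (1+ch, -c²h; h, 1-ch) lies in Γ.
  set h : ℚ := ((N * p * c.den ^ 2 * q : ℤ) : ℚ) with hh
  have e1 : c * h = ((N * p * (c.num * c.den * q) : ℤ) : ℚ) := by
    rw [hh]; push_cast; rw [← hden]; ring
  have e2 : c ^ 2 * h = ((N * p * (c.num ^ 2 * q) : ℤ) : ℚ) := by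
    rw [hh]; push_cast; rw [← hden]; ring
  have hmat : IsS0 p (1 + c * h) (-(c ^ 2 * h)) h (1 - c * h) := by
    have h3 : ‖((c * h : ℚ) : ℚ_[p])‖ < 1 := by rw [e1]; exact hlt _
    refine ⟨ne_of_eq_of_ne (by ring) one_ne_zero, ?_, ?_, hlt' j, ?_⟩
    · rw [Rat.cast_add, Rat.cast_one, Padic.add_eq_max_of_ne
        (by rw [norm_one]; exact h3.ne'), norm_one]
      exact max_eq_left h3.le
    · rw [e2, Rat.cast_neg, norm_neg]; exact (hlt _).le
    · rw [e1]
      have := norm_ratCast_intCast_le_one (p := p) (1 - N * p * (c.num * c.den * q))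
      push_cast at this ⊢
      exact this
  refine weightActDistr_conj hφ (δ := s0Mk _ _ _ _ hmat) (mem_levelGroup_iff.mpr
    ⟨1 + N * p * (c.num * c.den * q), -(N * p * (c.num ^ 2 * q)), N * p * c.den ^ 2 * q,
      1 - N * p * (c.num * c.den * q), ?_, by ring, ?_, ?_, ?_, ?_⟩) ?_ ?_
  · rw [coe_s0Mk, e1, e2, hh]; push_cast; rfl
  · exact ⟨p * (c.num * c.den * q), by ring⟩
  · exact ⟨-(p * (c.num * c.den * q)), by ring⟩
  · exact ⟨p * c.den ^ 2 * q, by ring⟩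
  · exact ⟨N * c.den ^ 2 * q, by ring⟩
  · exact smul_coe_eq (coe_s0Mk _) (ne_of_eq_of_ne (by ring) one_ne_zero) (by ring)
  · refine s0_ext ?_
    rw [Submonoid.coe_mul, Units.val_mul, Submonoid.coe_mul, Units.val_mul, coe_s0Mk, coe_s0Mk,
      coe_s0Mk, Matrix.mul_fin_two, Matrix.mul_fin_two, ← hh]
    clear_value h
    ext i j
    fin_cases i <;> fin_cases j <;> simp <;> ring

theorem isS0_upper_neg {c : ℚ} (hc : ‖(c : ℚ_[p])‖ ≤ 1) : IsS0 p 1 (-c) 0 1 :=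
  isS0_upper (by rwa [Rat.cast_neg, norm_neg])

theorem s0Mk_upper_mul_neg {c : ℚ} (hc : ‖(c : ℚ_[p])‖ ≤ 1) :
    s0Mk 1 c 0 1 (isS0_upper hc) * s0Mk 1 (-c) 0 1 (isS0_upper_neg hc) = 1 := by
  refine s0_ext ?_
  rw [Submonoid.coe_mul, Units.val_mul, coe_s0Mk, coe_s0Mk, Matrix.mul_fin_two]
  simp [Matrix.one_fin_two]

theorem s0Denom_upper {c : ℚ} (hc : IsS0 p 1 c 0 1) (z : ℤ_[p]) :
    s0Denom (s0Mk 1 c 0 1 hc) z = 1 := by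
  refine Units.ext ?_
  rw [s0Denom_val, s0Entry_eq (x := 1) (by simp [coe_s0Mk]),
    s0Entry_eq (x := 0) (by simp [coe_s0Mk])]
  simp

theorem s0Moebius_upper_neg {c : ℚ} (hc : ‖(c : ℚ_[p])‖ ≤ 1) :
    s0Moebius (s0Mk 1 (-c) 0 1 (isS0_upper_neg hc)) 0 = ⟨(c : ℚ_[p]), hc⟩ := by
  have h01 : s0Entry (s0Mk 1 (-c) 0 1 (isS0_upper_neg hc)) 0 1 = -⟨(c : ℚ_[p]), hc⟩ :=
    Subtype.ext (Rat.cast_neg c)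
  rw [s0Moebius, s0Denom_upper, h01, mul_zero, zero_sub, inv_one, Units.val_one, mul_one]
  exact neg_neg _

theorem s0Det_upper {c : ℚ} (hc : IsS0 p 1 c 0 1) : s0Det (s0Mk 1 c 0 1 hc) = 1 := by
  refine Subtype.ext ?_
  rw [coe_s0Det, coe_s0Mk, Matrix.det_fin_two_of]
  simp

theorem weightActDistr_upper_dirac (m : ℤ) {c : ℚ} (hc : ‖(c : ℚ_[p])‖ ≤ 1) :
    weightActDistr m (s0Mk 1 (-c) 0 1 (isS0_upper_neg hc)) (dirac 0 : Distr p L) =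
      dirac ⟨(c : ℚ_[p]), hc⟩ := by
  rw [weightActDistr_dirac, s0Moebius_upper_neg, s0Denom_upper, one_zpow, Units.val_one, map_one,
    one_smul]

theorem weightActDistr_upper_diracDeriv (k : ℕ) {c : ℚ} (hc : ‖(c : ℚ_[p])‖ ≤ 1) :
    weightActDistr (k : ℤ) (s0Mk 1 (-c) 0 1 (isS0_upper_neg hc))
      (diracDeriv 0 (k + 1) : Distr p L) = diracDeriv ⟨(c : ℚ_[p]), hc⟩ (k + 1) := by
  rw [weightActDistr_diracDeriv, s0Moebius_upper_neg, s0Denom_upper, one_zpow, Units.val_one,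
    s0Det_upper, map_one, one_pow, one_mul, one_smul]

/-- The classification at 0 is carried back to c by the translation (1 -c; 0 1), which has
determinant and automorphy factor 1. -/
theorem exists_apply_eq_dirac_add (hN : N ≠ 0) {k : ℕ} {φ : CuspDiv →+ Distr p L}
    (hφ : φ ∈ BdInv p N L k) {c : ℚ} (hc : ‖(c : ℚ_[p])‖ ≤ 1) :
    ∃ a b : L, φ (Finsupp.single (c : OnePoint ℚ) 1) =
      a • dirac ⟨(c : ℚ_[p]), hc⟩ + b • diracDeriv ⟨(c : ℚ_[p]), hc⟩ (k + 1) := by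
  obtain ⟨γ, h, h0, hlim, h00, h01, h10, h11, hinv⟩ := exists_lower_unipotent_invariant hN hφ hc
  obtain ⟨a, b, hab⟩ := exists_eq_dirac_add_diracDeriv k γ h h0 hlim h00 h01 h10 h11 _ hinv
  refine ⟨a, b, ?_⟩
  rw [← eq_of_mul_eq_one (k : ℤ) (s0Mk_upper_mul_neg hc) (φ (Finsupp.single (c : OnePoint ℚ) 1)),
    hab, map_add, map_smul, map_smul, weightActDistr_upper_dirac, weightActDistr_upper_diracDeriv]

theorem exists_apply_eq_smul_dirac (hN : N ≠ 0) {m : ℤ} (hm : m < 0) {φ : CuspDiv →+ Distr p L}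
    (hφ : φ ∈ BdInv p N L m) {c : ℚ} (hc : ‖(c : ℚ_[p])‖ ≤ 1) :
    ∃ a : L, φ (Finsupp.single (c : OnePoint ℚ) 1) = a • dirac ⟨(c : ℚ_[p]), hc⟩ := by
  obtain ⟨γ, h, h0, hlim, h00, h01, h10, h11, hinv⟩ := exists_lower_unipotent_invariant hN hφ hc
  obtain ⟨a, ha⟩ := exists_eq_smul_dirac hm γ h h0 hlim h00 h01 h10 h11 _ hinv
  refine ⟨a, ?_⟩
  rw [← eq_of_mul_eq_one m (s0Mk_upper_mul_neg hc) (φ (Finsupp.single (c : OnePoint ℚ) 1)),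
    ha, map_smul, weightActDistr_upper_dirac]

end CuspValues

end OMS

namespace OMS

open Filter Topology
open scoped MatrixGroups

/-! ### Representatives of the cosets defining U_p. -/

section UpCosets
variable {p : ℕ} [Fact p.Prime]

variable (p) in
theorem isS0_up (i : ℕ) : IsS0 p 1 (i : ℚ) 0 (p : ℚ) :=
  ⟨by simp [(Fact.out : p.Prime).ne_zero], by simp,
    by rw [Rat.cast_natCast]; exact_mod_cast Padic.norm_int_le_one (i : ℤ), by simp,
    by rw [Rat.cast_natCast]; exact Padic.norm_p_lt_one.le⟩

variable (p) in
/-- The representatives `(1 i; 0 p)` of the cosets defining `U_p`. -/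
noncomputable def upRep (i : ℕ) : S0 p := s0Mk 1 i 0 p (isS0_up p i)

theorem coe_upRep (i : ℕ) : ((upRep p i : GL (Fin 2) ℚ) : Matrix (Fin 2) (Fin 2) ℚ) =
    !![1, (i : ℚ); 0, (p : ℚ)] := rfl

theorem coe_upMatrix : ((upMatrix p : GL (Fin 2) ℚ) : Matrix (Fin 2) (Fin 2) ℚ) =
    !![1, 0; 0, (p : ℚ)] := rfl

theorem s0Mk_upper_mem_levelGroup (N i : ℕ) : ((s0Mk 1 i 0 1 (isS0_upper (p := p)
    (norm_ratCast_intCast_le_one i)) : S0 p) : GL (Fin 2) ℚ) ∈ levelGroup p N :=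
  mem_levelGroup_iff.mpr ⟨1, i, 0, 1, by rw [coe_s0Mk]; simp, by simp, by simp, by simp, by simp,
    by simp⟩

theorem isCosetReps_upRep (N : ℕ) :
    IsCosetReps (levelGroup p N) (upMatrix p) (fun i : Fin p => upRep p i) where
  mem i := by
    refine DoubleCoset.mem_doubleCoset.mpr ⟨1, one_mem _, _, s0Mk_upper_mem_levelGroup N i, ?_⟩
    refine Units.ext ?_
    rw [one_mul, Units.val_mul, coe_upRep, coe_upMatrix, coe_s0Mk, Matrix.mul_fin_two]
    simp
  exists_mul_inv_mem g hg := by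
    obtain ⟨x, hx, y, hy, rfl⟩ := DoubleCoset.mem_doubleCoset.mp hg
    obtain ⟨A, B, C, D, hy, hdet, hA, hD, hC, hpC⟩ := mem_levelGroup_iff.mp hy
    have hp : (0 : ℤ) < p := by exact_mod_cast (Fact.out : p.Prime).pos
    -- The index i must satisfy iA ≡ B mod p. As p ∣ C, D is the inverse of A mod p, so i is the
    -- residue of BD.
    have h0 : 0 ≤ B * D % p := Int.emod_nonneg _ hp.ne'
    have hlt : B * D % p < p := Int.emod_lt_of_pos _ hp
    obtain ⟨i, hi⟩ := Int.eq_ofNat_of_zero_le h0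
    have hdvd : (p : ℤ) ∣ B - i * A := by
      obtain ⟨C', rfl⟩ := hpC
      have h1 := Int.emod_add_mul_ediv (B * D) p
      rw [hi] at h1
      refine ⟨B * D / p * A - B ^ 2 * C', ?_⟩
      linear_combination (-B) * hdet - A * h1
    obtain ⟨E, hE⟩ := hdvd
    have hE' : (B : ℚ) - i * A = p * E := by exact_mod_cast hE
    refine ⟨⟨i, by exact_mod_cast hi ▸ hlt⟩, ?_⟩
    have hz : (A : ℚ) * ((D - i * C : ℤ) : ℚ) - E * ((p * C : ℤ) : ℚ) = 1 := by
      have : (A : ℚ) * D - B * C = 1 := by exact_mod_cast hdet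
      push_cast
      linear_combination this + C * hE'
    -- z is (1 0; 0 p) y (1 i; 0 p)⁻¹, integral because p divides B - iA.
    set z : GL (Fin 2) ℚ := Matrix.GeneralLinearGroup.mkOfDetNeZero
      !![(A : ℚ), (E : ℚ); ((p * C : ℤ) : ℚ), ((D - i * C : ℤ) : ℚ)] (by
        rw [Matrix.det_fin_two_of, hz]; exact one_ne_zero) with hzdef
    have hzmem : z ∈ levelGroup p N := mem_levelGroup_iff.mpr ⟨A, E, p * C, D - i * C, rfl,
      by exact_mod_cast hz, hA, by
        rw [sub_right_comm]; exact dvd_sub hD (hC.mul_left _), hC.mul_left _, Dvd.intro _ rfl⟩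
    have hmul : (upMatrix p : GL (Fin 2) ℚ) * y = z * (upRep p i : GL (Fin 2) ℚ) := by
      refine Units.ext ?_
      rw [Units.val_mul, Units.val_mul, hy, coe_upMatrix, coe_upRep]
      change _ = !![(A : ℚ), (E : ℚ); ((p * C : ℤ) : ℚ), ((D - i * C : ℤ) : ℚ)] * _
      rw [Matrix.mul_fin_two, Matrix.mul_fin_two]
      push_cast
      congr! 3
      · ring
      · congr! 1
        linear_combination hE'
      · congr! 1
        · ring
        · congr! 1
          ring
    rw [mul_assoc x, hmul, ← mul_assoc, mul_inv_cancel_right]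
    exact mul_mem hx hzmem
  eq_of_mul_inv_mem i j h := by
    obtain ⟨A, B, C, D, hγ, -⟩ := mem_levelGroup_iff.mp h
    have h1 : (upRep p i : GL (Fin 2) ℚ) = (upRep p i * (upRep p j : GL (Fin 2) ℚ)⁻¹) * upRep p j := by
      rw [inv_mul_cancel_right]
    have h2 := congrArg (fun g : GL (Fin 2) ℚ => (g : Matrix (Fin 2) (Fin 2) ℚ)) h1
    rw [Units.val_mul, hγ, coe_upRep, coe_upRep, Matrix.mul_fin_two] at h2
    have h00 : (1 : ℚ) = A * 1 + B * 0 := congrFun (congrFun h2 0) 0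
    have h01 : ((i : ℕ) : ℚ) = A * (j : ℕ) + B * p := congrFun (congrFun h2 0) 1
    have hA : (A : ℚ) = 1 := by linear_combination -h00
    rw [hA, one_mul] at h01
    have h3 : ((i : ℕ) : ℤ) = (j : ℕ) + B * p := by exact_mod_cast h01
    have h4 : ((i : ℕ) : ℤ) % p = ((j : ℕ) : ℤ) % p := by rw [h3, Int.add_mul_emod_self_right]
    have h5 : (i : ℕ) % p = (j : ℕ) % p := by exact_mod_cast h4
    rw [Nat.mod_eq_of_lt i.2, Nat.mod_eq_of_lt j.2] at h5
    exact Fin.ext h5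

end UpCosets

/-! ### Iterates of U_p on boundary symbols. -/

section UpIterates
variable {p : ℕ} [Fact p.Prime] {N : ℕ} {L : Type*} [NormedField L] [NormedAlgebra ℚ_[p] L]
  [FiniteDimensional ℚ_[p] L]

theorem upRep_smul (i : ℕ) (c : ℚ) : (upRep p i : GL (Fin 2) ℚ) • (c : OnePoint ℚ) =
    (((c + i) / p : ℚ) : OnePoint ℚ) := by
  have hp : (p : ℚ) ≠ 0 := by exact_mod_cast (Fact.out : p.Prime).ne_zero
  refine smul_coe_eq (coe_upRep i) (by simpa using hp) ?_
  field_simp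
  ring

/-- Here (pz - i - c)^ν = p^ν (z - (c + i)/p)^ν, with trivial automorphy factor in every weight.
Shifted powers centred at the cusp thus read off the eigenvalues of U_p. -/
theorem weightActLocAn_upRep_shiftPow (m : ℤ) (i : ℕ) (c : ℚ) (ν : ℕ) :
    weightActLocAn m (upRep p i) (shiftPow L (c : ℚ_[p]) ν) =
      (p : L) ^ ν • shiftPow L (((c + i) / p : ℚ) : ℚ_[p]) ν := by
  have hp : (p : ℚ_[p]) ≠ 0 := by exact_mod_cast (Fact.out : p.Prime).ne_zero
  have h00 : s0Entry (upRep p i) 0 0 = 1 := s0Entry_eq (by rw [coe_upRep]; simp)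
  have h01 : s0Entry (upRep p i) 0 1 = i := s0Entry_eq (by rw [coe_upRep]; simp)
  have h10 : s0Entry (upRep p i) 1 0 = 0 := s0Entry_eq (by rw [coe_upRep]; simp)
  have h11 : s0Entry (upRep p i) 1 1 = p := s0Entry_eq (by rw [coe_upRep]; simp)
  refine Subtype.ext (funext fun z => ?_)
  have hd : s0Denom (upRep p i) z = 1 := Units.ext (by rw [s0Denom_val, h00, h10]; simp)
  have hm : s0Moebius (upRep p i) z = p * z - i := by rw [s0Moebius, hd, h01, h11]; simp
  rw [weightActLocAn_apply, hd, hm, shiftPow_apply, one_zpow, Units.val_one, PadicInt.coe_one,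
    one_smul]
  change _ = (p : L) ^ ν • (shiftPow L (((c + i) / p : ℚ) : ℚ_[p]) ν : ℤ_[p] → L) z
  rw [shiftPow_apply, ← map_natCast (algebraMap ℚ_[p] L), ← map_pow, algebraMap_smul, smul_smul,
    ← mul_pow]
  congr 2
  push_cast
  field_simp
  ring

/-- Exactly one residue i satisfies i ≡ -c mod p. It selects the only term of U_p at c whose cusp
stays in C₀. -/
theorem norm_add_div_le_one_or (c : ℚ) (hc : ‖(c : ℚ_[p])‖ ≤ 1) : ∃ i < p,
    ‖(((c + (i : ℕ)) / p : ℚ) : ℚ_[p])‖ ≤ 1 ∧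
      ∀ j < p, j ≠ i → 1 < ‖(((c + (j : ℕ)) / p : ℚ) : ℚ_[p])‖ := by
  have hp : (p : ℚ_[p]) ≠ 0 := by exact_mod_cast (Fact.out : p.Prime).ne_zero
  set x : ℤ_[p] := ⟨(c : ℚ_[p]), hc⟩ with hx
  have hcoe : ∀ j : ℕ, (((c + (j : ℕ)) / p : ℚ) : ℚ_[p]) = ((x + j : ℤ_[p]) : ℚ_[p]) / p :=
    fun j => by push_cast; rfl
  obtain ⟨i, hi, hmem⟩ := PadicInt.exists_mem_range (-x)
  have hmem' : (p : ℤ_[p]) ∣ x + i := by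
    rw [PadicInt.maximalIdeal_eq_span_p, Ideal.mem_span_singleton] at hmem
    have := (dvd_neg).mpr hmem
    rwa [neg_sub, sub_neg_eq_add, add_comm] at this
  refine ⟨i, hi, ?_, fun j hj hji => ?_⟩
  · obtain ⟨y, hy⟩ := hmem'
    rw [hcoe, hy, PadicInt.coe_mul, PadicInt.coe_natCast, mul_div_cancel_left₀ _ hp]
    exact y.2
  · by_contra! hle
    have hdvd : (p : ℤ_[p]) ∣ x + j := ⟨⟨_, hle⟩, Subtype.ext (by
      change ((x + j : ℤ_[p]) : ℚ_[p]) = (p : ℚ_[p]) * (((c + (j : ℕ)) / p : ℚ) : ℚ_[p])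
      rw [hcoe, mul_div_cancel₀ _ hp])⟩
    have h1 := dvd_sub hdvd hmem'
    rw [add_sub_add_left_eq_sub] at h1
    have h2 : ‖(((j : ℤ) - i : ℤ) : ℤ_[p])‖ < 1 := by
      push_cast
      exact (PadicInt.norm_lt_one_iff_dvd _).mpr h1
    rw [PadicInt.norm_int_lt_one_iff_dvd] at h2
    refine hji ?_
    have h4 : ((j : ℤ) % p) = (i : ℤ) % p := Int.emod_eq_emod_iff_emod_sub_eq_zero.mpr
      (Int.emod_eq_zero_of_dvd h2)
    have h5 : j % p = i % p := by exact_mod_cast h4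
    rwa [Nat.mod_eq_of_lt hj, Nat.mod_eq_of_lt hi] at h5

/-- The operator `U_p` on `Hom(Δ, 𝒟ₘ†)`. -/
noncomputable abbrev upDiv (p : ℕ) [Fact p.Prime] (N : ℕ) (L : Type*) [NormedField L]
    [NormedAlgebra ℚ_[p] L] [FiniteDimensional ℚ_[p] L] (m : ℤ) :
    Module.End L (CuspDiv →+ Distr p L) :=
  hecke (homRep divAct (distrRep (p := p) L m)) (levelGroup p N) (upMatrix p)

theorem upDiv_apply_single {m : ℤ} {φ : CuspDiv →+ Distr p L} (hφ : φ ∈ BdInv p N L m)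
    (x : OnePoint ℚ) : upDiv p N L m φ (Finsupp.single x 1) = ∑ i : Fin p, weightActDistr m (upRep p i)
      (φ (Finsupp.single ((upRep p i : GL (Fin 2) ℚ) • x) 1)) := by
  rw [upDiv, hecke_apply_eq_sum mem_S0_of_mem_levelGroup (isCosetReps_upRep N) hφ]
  rw [AddMonoidHom.finsetSum_apply]
  exact Finset.sum_congr rfl fun i _ => homRep_divAct_apply_single m _ φ x

theorem upDiv_mem (hN : N ≠ 0) {m : ℤ} {φ : CuspDiv →+ Distr p L} (hφ : φ ∈ BdInv p N L m) :
    upDiv p N L m φ ∈ BdInv p N L m :=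
  hecke_mem_invariants mem_S0_of_mem_levelGroup _ (finite_cosetReps hN _) hφ

theorem upDiv_pow_mem (hN : N ≠ 0) {m : ℤ} {φ : CuspDiv →+ Distr p L} (hφ : φ ∈ BdInv p N L m)
    (n : ℕ) : (upDiv p N L m ^ n) φ ∈ BdInv p N L m := by
  induction n with
  | zero => simpa using hφ
  | succ n ih => rw [pow_succ']; exact upDiv_mem hN ih

/-- At each step all terms but one sit at cusps outside C₀, where boundary symbols vanish. The
integer j depends only on n and c, so one j serves all test degrees ν and all φ at once. -/
theorem upDiv_pow_apply_shiftPow (hN : N ≠ 0) (n : ℕ) (c : ℚ) (hc : ‖(c : ℚ_[p])‖ ≤ 1) :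
    ∃ j : ℕ, ‖(((c + j) / (p : ℚ) ^ n : ℚ) : ℚ_[p])‖ ≤ 1 ∧
      ∀ (m : ℤ) (φ : CuspDiv →+ Distr p L), φ ∈ BdInv p N L m → ∀ ν : ℕ,
        ((((upDiv p N L m ^ n) φ) (Finsupp.single (c : OnePoint ℚ) 1) : Distr p L) :
          Module.Dual L (LocAn p L)) (shiftPow L (c : ℚ_[p]) ν) =
        (p : L) ^ (n * ν) * (((φ (Finsupp.single ((((c + j) / (p : ℚ) ^ n : ℚ)) : OnePoint ℚ) 1)) :
          Distr p L) : Module.Dual L (LocAn p L))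
            (shiftPow L (((c + j) / (p : ℚ) ^ n : ℚ) : ℚ_[p]) ν) := by
  have hp : (p : ℚ) ≠ 0 := by exact_mod_cast (Fact.out : p.Prime).ne_zero
  induction n generalizing c with
  | zero => exact ⟨0, by simpa using hc, fun m φ hφ ν => by simp⟩
  | succ n ih =>
    obtain ⟨i, hi, hle, hne⟩ := norm_add_div_le_one_or c hc
    obtain ⟨j, hj, hφj⟩ := ih _ hle
    have e : (c + (i + p * j : ℕ)) / (p : ℚ) ^ (n + 1) = ((c + i) / p + j) / (p : ℚ) ^ n := by
      push_cast
      field_simp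
      ring
    refine ⟨i + p * j, by rw [e]; exact hj, fun m φ hφ ν => ?_⟩
    rw [e, pow_succ']
    change (((upDiv p N L m ((upDiv p N L m ^ n) φ)) (Finsupp.single (c : OnePoint ℚ) 1) : Distr p L) :
      Module.Dual L (LocAn p L)) (shiftPow L (c : ℚ_[p]) ν) = _
    rw [upDiv_apply_single (upDiv_pow_mem hN hφ n), Finset.sum_eq_single ⟨i, hi⟩]
    · rw [upRep_smul, weightActDistr_apply, weightActLocAn_upRep_shiftPow, map_smul, hφj m φ hφ ν,
        smul_eq_mul, ← mul_assoc, ← pow_add]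
      congr 2
      ring
    · intro l _ hl
      rw [upRep_smul, apply_eq_zero_of_one_lt_norm hN (upDiv_pow_mem hN hφ n)
        (hne l l.2 fun h => hl (Fin.ext h)), map_zero]
    · exact fun h => absurd (Finset.mem_univ _) h

end UpIterates

/-! ### Γ-equivalence of c and (c + j)/pⁿ. -/

section CuspTransport

/-- With x = X - jv, the matrix is (1 j; 0 1)(x y; v w)(u -s; v t)⁻¹, where both completed columns
have determinant 1. It sends (u, v) to (X, v), and meets the congruences once w ≡ t mod Np, y ≡ -s
mod N and x ≡ u mod N. -/
theorem exists_matrix_moving_cusp {u v X j N p : ℤ} (huv : IsCoprime u v) (hXv : IsCoprime X v)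
    (hpv : IsCoprime p v) (hN : N ∣ X - j * v - u) : ∃ A B C D : ℤ, A * D - B * C = 1 ∧
      N ∣ A - 1 ∧ N ∣ D - 1 ∧ N ∣ C ∧ p ∣ C ∧ A * u + B * v = X ∧ C * u + D * v = v := by
  obtain ⟨t, s, hts⟩ := huv
  obtain ⟨e, he⟩ := hN
  have hcop : IsCoprime ((X - j * v) * p) v := by
    refine IsCoprime.mul_left ?_ hpv
    rw [sub_eq_add_neg, ← neg_mul]
    exact hXv.add_mul_right_left _
  obtain ⟨α, β, hαβ⟩ := hcop
  set x := X - j * v with hx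
  -- The corrections to t and -s come from αxp + βv = 1, scaled by et so that they absorb x - u = Ne
  -- in the determinant.
  set w := t - N * p * (e * t * α) with hw
  set y := -s + N * (e * t * β) with hy
  have h1 : x * w - y * v = 1 := by
    rw [hw, hy]
    linear_combination t * he + hts - N * e * t * hαβ
  refine ⟨x * t - y * v + j * (v * (t - w)), y * u + x * s + j * (w * u + v * s), v * (t - w),
    w * u + v * s, ?_, ?_, ?_, ?_, ?_, ?_, ?_⟩
  · linear_combination (u * t + v * s) * h1 + hts
  · refine ⟨e * t - e * t * β * v + j * (v * (p * (e * t * α))), ?_⟩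
    rw [hw, hy]
    linear_combination t * he + hts
  · refine ⟨-(p * (e * t * α)) * u, ?_⟩
    rw [hw]
    linear_combination hts
  · exact ⟨v * (p * (e * t * α)), by rw [hw]; ring⟩
  · exact ⟨v * (N * (e * t * α)), by rw [hw]; ring⟩
  · linear_combination (x + j * v) * hts + hx
  · linear_combination v * hts

variable {p : ℕ} [Fact p.Prime] {N : ℕ}

/-- Since c is p-integral, (c + j)/pⁿ can be written with the denominator v of c, and pⁿ ≡ 1 mod N
makes its numerator congruent to u + jv mod N. Keeping v unchanged forces automorphy factor 1, so
Dirac distributions are carried to each other without a scalar. -/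
theorem exists_mem_levelGroup_moving_cusp {n : ℕ} (hn : p ^ n ≡ 1 [MOD N]) {c : ℚ}
    (hc : ‖(c : ℚ_[p])‖ ≤ 1) {j : ℕ} {y : ℤ_[p]}
    (hy : (y : ℚ_[p]) = (((c + j) / (p : ℚ) ^ n : ℚ) : ℚ_[p])) :
    ∃ γ : S0 p, (γ : GL (Fin 2) ℚ) ∈ levelGroup p N ∧
      (γ : GL (Fin 2) ℚ) • (c : OnePoint ℚ) = (((c + j) / (p : ℚ) ^ n : ℚ) : OnePoint ℚ) ∧
      s0Denom γ y = 1 ∧ s0Moebius γ y = ⟨(c : ℚ_[p]), hc⟩ ∧ s0Det γ = 1 := by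
  have hp : (p : ℚ) ≠ 0 := by exact_mod_cast (Fact.out : p.Prime).ne_zero
  have hvunit : ‖((c.den : ℕ) : ℤ_[p])‖ = 1 := PadicInt.isUnit_iff.mp (PadicInt.isUnit_den c hc)
  have hv0 : (c.den : ℚ) ≠ 0 := by exact_mod_cast c.den_ne_zero
  have hcv : c * c.den = c.num := Rat.mul_den_eq_num c
  have hpv : IsCoprime (p : ℤ) (c.den : ℤ) :=
    Nat.isCoprime_iff_coprime.mpr (PadicInt.norm_natCast_eq_one_iff.mp hvunit)
  set x : ℚ := (c + j) / (p : ℚ) ^ n with hx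
  have hxv : (p : ℚ) ^ n * (x * c.den) = ((c.num + j * c.den : ℤ) : ℚ) := by
    rw [hx]; push_cast; rw [← hcv]; field_simp
  have hdvd : ((p : ℤ) ^ n) ∣ c.num + j * c.den := by
    rw [← PadicInt.norm_int_le_pow_iff_dvd (p := p)]
    have h1 : ((c.num + j * c.den : ℤ) : ℤ_[p]) = (p : ℤ_[p]) ^ n * (y * (c.den : ℤ_[p])) := by
      refine Subtype.ext ?_
      have h2 := congrArg (fun w : ℚ => (w : ℚ_[p])) hxv
      simp only [Rat.cast_mul, Rat.cast_pow, Rat.cast_natCast, Rat.cast_intCast, ← hy] at h2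
      rw [PadicInt.coe_intCast, ← h2, PadicInt.coe_mul, PadicInt.coe_mul, PadicInt.coe_pow,
        PadicInt.coe_natCast, PadicInt.coe_natCast]
    rw [h1, norm_mul, PadicInt.norm_p_pow]
    exact mul_le_of_le_one_right (by positivity) (PadicInt.norm_le_one _)
  obtain ⟨X, hX⟩ := hdvd
  have hxX : x * c.den = X := by
    rw [hX] at hxv
    push_cast at hxv
    exact mul_left_cancel₀ (pow_ne_zero n hp) hxv
  have huv : IsCoprime c.num (c.den : ℤ) := by
    rw [Int.isCoprime_iff_nat_coprime]
    exact c.reduced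
  have hXv : IsCoprime X (c.den : ℤ) := by
    have h1 : IsCoprime ((p : ℤ) ^ n * X) (c.den : ℤ) := by
      rw [← hX]; exact huv.add_mul_right_left _
    exact h1.of_mul_left_right
  have hNX : (N : ℤ) ∣ X - j * c.den - c.num := by
    have h1 : (N : ℤ) ∣ (1 : ℕ) - (p ^ n : ℕ) := Nat.modEq_iff_dvd.mp hn
    push_cast at h1
    have h2 := h1.mul_right X
    have h3 : X - j * c.den - c.num = (1 - (p : ℤ) ^ n) * X := by linear_combination -hX
    rw [h3]
    exact h2
  obtain ⟨A, B, C, D, hdet, hA, hD, hC, hpC, hAB, hCD⟩ :=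
    exists_matrix_moving_cusp huv hXv hpv hNX
  have hdet' : (A : ℚ) * D - B * C = 1 := by exact_mod_cast hdet
  have hAB' : (A : ℚ) * c.num + B * c.den = X := by exact_mod_cast hAB
  have hCD' : (C : ℚ) * c.num + D * c.den = c.den := by exact_mod_cast hCD
  have h1 : (C : ℚ) * c + D = 1 := by
    refine mul_right_cancel₀ hv0 ?_
    linear_combination hCD' + C * hcv
  have h2 : (A : ℚ) * c + B = x := by
    refine mul_right_cancel₀ hv0 ?_
    linear_combination hAB' + A * hcv - hxX
  -- The relation Cc + D = 1, dual to the invariance of the denominator v, becomes the statement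
  -- that the automorphy factor at the image cusp x is 1.
  have h3 : (A : ℚ) - C * x = 1 := by linear_combination hdet' + C * h2 - A * h1
  have h4 : (D : ℚ) * x - B = c := by linear_combination c * hdet' - D * h2 + B * h1
  let g : GL (Fin 2) ℚ := Matrix.GeneralLinearGroup.mkOfDetNeZero
    !![(A : ℚ), (B : ℚ); (C : ℚ), (D : ℚ)] (by
      rw [Matrix.det_fin_two_of, hdet']; exact one_ne_zero)
  have hg : g ∈ levelGroup p N :=
    mem_levelGroup_iff.mpr ⟨A, B, C, D, rfl, hdet, hA, hD, hC, hpC⟩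
  let γ : S0 p := ⟨g, mem_S0_of_mem_levelGroup g hg⟩
  have hden : s0Denom γ y = 1 := by
    refine Units.ext (Subtype.ext ?_)
    have := congrArg (fun w : ℚ => (w : ℚ_[p])) h3
    simp only [Rat.cast_mul, Rat.cast_sub, Rat.cast_one, ← hy] at this
    exact this
  refine ⟨γ, hg, smul_coe_eq (g := g) rfl (by rw [h1]; exact one_ne_zero) (by rw [h1, h2, mul_one]),
    hden, ?_, ?_⟩
  · rw [s0Moebius, hden, inv_one, Units.val_one, mul_one]
    refine Subtype.ext ?_
    have := congrArg (fun w : ℚ => (w : ℚ_[p])) h4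
    simp only [Rat.cast_mul, Rat.cast_sub, ← hy] at this
    exact this
  · refine Subtype.ext ?_
    rw [coe_s0Det, det_of_mem_levelGroup hg, Rat.cast_one, PadicInt.coe_one]

end CuspTransport

end OMS

namespace OMS

open Filter Topology Polynomial
open scoped MatrixGroups

/-! ### Action of U_pⁿ on the components of boundary symbols. -/

section BoundaryValues
variable {p : ℕ} [Fact p.Prime] {N : ℕ} {L : Type*} [NormedField L] [NormedAlgebra ℚ_[p] L]
  [FiniteDimensional ℚ_[p] L]

theorem dirac_shiftPow (y : ℤ_[p]) (ν : ℕ) :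
    ((dirac y : Distr p L) : Module.Dual L (LocAn p L)) (shiftPow L (y : ℚ_[p]) ν) = 0 ^ ν := by
  rw [dirac_apply, shiftPow_apply, sub_self]
  cases ν <;> simp

theorem diracDeriv_shiftPow_zero (y : ℤ_[p]) (k : ℕ) :
    ((diracDeriv y (k + 1) : Distr p L) : Module.Dual L (LocAn p L)) (shiftPow L (y : ℚ_[p]) 0) =
      0 := by
  rw [diracDeriv_apply, derivLocAn_pow_succ_shiftPow_zero]
  rfl

theorem diracDeriv_shiftPow (y : ℤ_[p]) (k : ℕ) :
    ((diracDeriv y k : Distr p L) : Module.Dual L (LocAn p L)) (shiftPow L (y : ℚ_[p]) k) =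
      (k.factorial : L) := by
  rw [diracDeriv_apply, derivLocAn_pow_shiftPow]
  change (k.factorial : L) • (shiftPow L (y : ℚ_[p]) 0 : ℤ_[p] → L) y = _
  rw [shiftPow_apply, pow_zero, one_smul, smul_eq_mul, mul_one]

/-- Together with its companion in degree k + 1: the test functions 1 and (z - y)^{k+1} are dual, up
to (k+1)!, to δ_y and δ_{y,k+1}, so they recover both coefficients. -/
theorem dirac_add_apply_zero (y : ℤ_[p]) (k : ℕ) (a b : L) :
    ((a • dirac y + b • diracDeriv y (k + 1) : Distr p L) : Module.Dual L (LocAn p L))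
      (shiftPow L (y : ℚ_[p]) 0) = a := by
  change a • ((dirac y : Distr p L) : Module.Dual L (LocAn p L)) _ +
    b • ((diracDeriv y (k + 1) : Distr p L) : Module.Dual L (LocAn p L)) _ = a
  rw [dirac_shiftPow, diracDeriv_shiftPow_zero, pow_zero, smul_zero, add_zero, smul_eq_mul, mul_one]

theorem dirac_add_apply_succ (y : ℤ_[p]) (k : ℕ) (a b : L) :
    ((a • dirac y + b • diracDeriv y (k + 1) : Distr p L) : Module.Dual L (LocAn p L))
      (shiftPow L (y : ℚ_[p]) (k + 1)) = b * ((k + 1).factorial : L) := by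
  change a • ((dirac y : Distr p L) : Module.Dual L (LocAn p L)) _ +
    b • ((diracDeriv y (k + 1) : Distr p L) : Module.Dual L (LocAn p L)) _ = _
  rw [dirac_shiftPow, diracDeriv_shiftPow, zero_pow (Nat.succ_ne_zero k), smul_zero, zero_add,
    smul_eq_mul]

theorem weightActDistr_dirac_of_denom_eq_one (m : ℤ) {γ : S0 p} {y z : ℤ_[p]}
    (hden : s0Denom γ y = 1) (hz : s0Moebius γ y = z) :
    weightActDistr m γ (dirac y : Distr p L) = dirac z := by
  rw [weightActDistr_dirac, hden, hz, one_zpow, Units.val_one, map_one, one_smul]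

theorem weightActDistr_diracDeriv_of_denom_eq_one (k : ℕ) {γ : S0 p} {y z : ℤ_[p]}
    (hden : s0Denom γ y = 1) (hz : s0Moebius γ y = z) (hdet : s0Det γ = 1) :
    weightActDistr (k : ℤ) γ (diracDeriv y (k + 1) : Distr p L) = diracDeriv z (k + 1) := by
  rw [weightActDistr_diracDeriv, hden, hz, hdet, one_zpow, Units.val_one, map_one, one_pow,
    one_mul, one_smul]

/-- U_pⁿ evaluates φ at a Γ-equivalent cusp, where φ has the same coefficients a and b. The test
functions of degrees 0 and k + 1 then pick up 1 and p^{n(k+1)}. -/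
theorem exists_upDiv_pow_apply_eq (hN : N ≠ 0) {n : ℕ} (hn : p ^ n ≡ 1 [MOD N]) {k : ℕ}
    {φ : CuspDiv →+ Distr p L} (hφ : φ ∈ BdInv p N L k) {c : ℚ} (hc : ‖(c : ℚ_[p])‖ ≤ 1) :
    ∃ a b : L, φ (Finsupp.single (c : OnePoint ℚ) 1) =
        a • dirac ⟨(c : ℚ_[p]), hc⟩ + b • diracDeriv ⟨(c : ℚ_[p]), hc⟩ (k + 1) ∧
      (upDiv p N L k ^ n) φ (Finsupp.single (c : OnePoint ℚ) 1) = a • dirac ⟨(c : ℚ_[p]), hc⟩ +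
        ((p : L) ^ (n * (k + 1)) * b) • diracDeriv ⟨(c : ℚ_[p]), hc⟩ (k + 1) := by
  have hchar := charZero_of_padic p L
  have hfac : ((k + 1).factorial : L) ≠ 0 := Nat.cast_ne_zero.mpr (Nat.factorial_ne_zero _)
  obtain ⟨j, hj, hU⟩ := upDiv_pow_apply_shiftPow (L := L) hN n c hc
  obtain ⟨γ, hγ, hγc, hden, hmoeb, hdet⟩ :=
    exists_mem_levelGroup_moving_cusp hn hc (j := j) (y := ⟨_, hj⟩) rfl
  obtain ⟨a, b, hab⟩ := exists_apply_eq_dirac_add hN hφ hj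
  have hinv := mem_bdInv_iff.mp hφ γ hγ c
  rw [hγc, hab, map_add, map_smul, map_smul,
    weightActDistr_dirac_of_denom_eq_one k hden hmoeb,
    weightActDistr_diracDeriv_of_denom_eq_one k hden hmoeb hdet] at hinv
  refine ⟨a, b, hinv.symm, ?_⟩
  obtain ⟨a', b', hab'⟩ := exists_apply_eq_dirac_add hN (upDiv_pow_mem hN hφ n) hc
  have h0 := hU k φ hφ 0
  have h1 := hU k φ hφ (k + 1)
  rw [hab', hab] at h0 h1
  have e0 := (dirac_add_apply_zero ⟨(c : ℚ_[p]), hc⟩ k a' b').symm.trans h0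
  have e1 := (dirac_add_apply_succ ⟨(c : ℚ_[p]), hc⟩ k a' b').symm.trans h1
  have f0 := dirac_add_apply_zero ⟨_, hj⟩ k a b
  have f1 := dirac_add_apply_succ ⟨_, hj⟩ k a b
  simp only at f0 f1
  rw [f0, mul_zero, pow_zero, one_mul] at e0
  rw [f1, ← mul_assoc] at e1
  rw [hab', e0, mul_right_cancel₀ hfac e1]

theorem bdInv_ext (hN : N ≠ 0) {m : ℤ} {φ ψ : CuspDiv →+ Distr p L} (hφ : φ ∈ BdInv p N L m)
    (hψ : ψ ∈ BdInv p N L m) (h : ∀ c : ℚ, ‖(c : ℚ_[p])‖ ≤ 1 →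
      φ (Finsupp.single (c : OnePoint ℚ) 1) = ψ (Finsupp.single (c : OnePoint ℚ) 1)) : φ = ψ := by
  refine Finsupp.addHom_ext' fun x => AddMonoidHom.ext_int ?_
  change φ (Finsupp.single x 1) = ψ (Finsupp.single x 1)
  induction x using OnePoint.rec with
  | infty => rw [apply_infty_eq_zero hφ, apply_infty_eq_zero hψ]
  | coe c =>
    rcases le_or_gt ‖(c : ℚ_[p])‖ 1 with hc | hc
    · exact h c hc
    · rw [apply_eq_zero_of_one_lt_norm hN hφ hc, apply_eq_zero_of_one_lt_norm hN hψ hc]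

/-- In negative weight only the δ_c-component exists, and U_pⁿ fixes it. -/
theorem upDiv_pow_eq_self (hN : N ≠ 0) {n : ℕ} (hn : p ^ n ≡ 1 [MOD N]) {m : ℤ} (hm : m < 0)
    {φ : CuspDiv →+ Distr p L} (hφ : φ ∈ BdInv p N L m) : (upDiv p N L m ^ n) φ = φ := by
  refine bdInv_ext hN (upDiv_pow_mem hN hφ n) hφ fun c hc => ?_
  obtain ⟨j, hj, hU⟩ := upDiv_pow_apply_shiftPow (L := L) hN n c hc
  obtain ⟨γ, hγ, hγc, hden, hmoeb, -⟩ :=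
    exists_mem_levelGroup_moving_cusp hn hc (j := j) (y := ⟨_, hj⟩) rfl
  obtain ⟨a, ha⟩ := exists_apply_eq_smul_dirac hN hm hφ hj
  have hinv := mem_bdInv_iff.mp hφ γ hγ c
  rw [hγc, ha, map_smul, weightActDistr_dirac_of_denom_eq_one m hden hmoeb] at hinv
  obtain ⟨a', ha'⟩ := exists_apply_eq_smul_dirac hN hm (upDiv_pow_mem hN hφ n) hc
  have h0 := hU m φ hφ 0
  rw [ha', ha] at h0
  have key : ∀ (y : ℤ_[p]) (t : L), ((t • dirac y : Distr p L) : Module.Dual L (LocAn p L))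
      (shiftPow L (y : ℚ_[p]) 0) = t := fun y t => by
    change t • ((dirac y : Distr p L) : Module.Dual L (LocAn p L)) _ = t
    rw [dirac_shiftPow, pow_zero, smul_eq_mul, mul_one]
  have e0 := (key ⟨(c : ℚ_[p]), hc⟩ a').symm.trans h0
  have f0 := key ⟨_, hj⟩ a
  simp only at f0
  rw [f0, mul_zero, pow_zero, one_mul] at e0
  rw [ha', e0, ← hinv]

variable (p N L) in
/-- The boundary symbols of weight `k` whose values at the cusps in `C₀` are multiples of
`δ_{c,k+1}`. -/
def critDiv (k : ℕ) : Submodule L (CuspDiv →+ Distr p L) where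
  carrier := {φ | φ ∈ BdInv p N L k ∧ ∀ (c : ℚ) (hc : ‖(c : ℚ_[p])‖ ≤ 1), ∃ τ : L,
    φ (Finsupp.single (c : OnePoint ℚ) 1) = τ • diracDeriv (⟨(c : ℚ_[p]), hc⟩ : ℤ_[p]) (k + 1)}
  zero_mem' := ⟨zero_mem _, fun c hc => ⟨0, by rw [zero_smul]; rfl⟩⟩
  add_mem' := by
    rintro φ ψ ⟨hφ, hφ'⟩ ⟨hψ, hψ'⟩
    refine ⟨add_mem hφ hψ, fun c hc => ?_⟩
    obtain ⟨s, hs⟩ := hφ' c hc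
    obtain ⟨t, ht⟩ := hψ' c hc
    exact ⟨s + t, by rw [AddMonoidHom.add_apply, hs, ht, add_smul]⟩
  smul_mem' := by
    rintro a φ ⟨hφ, hφ'⟩
    refine ⟨Submodule.smul_mem _ a hφ, fun c hc => ?_⟩
    obtain ⟨s, hs⟩ := hφ' c hc
    refine ⟨a * s, ?_⟩
    rw [mul_smul, ← hs]
    rfl

theorem mem_critDiv_of_apply_eq_zero (hN : N ≠ 0) {k : ℕ} {φ : CuspDiv →+ Distr p L}
    (hφ : φ ∈ BdInv p N L k) (h : ∀ c : ℚ, ‖(c : ℚ_[p])‖ ≤ 1 →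
      (φ (Finsupp.single (c : OnePoint ℚ) 1) : Module.Dual L (LocAn p L))
        (shiftPow L (c : ℚ_[p]) 0) = 0) : φ ∈ critDiv p N L k := by
  refine ⟨hφ, fun c hc => ?_⟩
  obtain ⟨a, b, hab⟩ := exists_apply_eq_dirac_add hN hφ hc
  have h1 := h c hc
  rw [hab] at h1
  have h2 := (dirac_add_apply_zero ⟨(c : ℚ_[p]), hc⟩ k a b).symm.trans h1
  exact ⟨b, by rw [hab, h2, zero_smul, zero_add]⟩

theorem upDiv_pow_eq_smul (hN : N ≠ 0) {n : ℕ} (hn : p ^ n ≡ 1 [MOD N]) {k : ℕ}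
    {φ : CuspDiv →+ Distr p L} (hφ : φ ∈ critDiv p N L k) :
    (upDiv p N L k ^ n) φ = (p : L) ^ (n * (k + 1)) • φ := by
  refine bdInv_ext hN (upDiv_pow_mem hN hφ.1 n) (Submodule.smul_mem _ _ hφ.1) fun c hc => ?_
  obtain ⟨a, b, hab, hU⟩ := exists_upDiv_pow_apply_eq hN hn hφ.1 hc
  obtain ⟨τ, hτ⟩ := hφ.2 c hc
  have h1 := dirac_add_apply_zero ⟨(c : ℚ_[p]), hc⟩ k a b
  have h2 := dirac_add_apply_zero (L := L) ⟨(c : ℚ_[p]), hc⟩ k 0 τ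
  rw [← hab, hτ] at h1
  rw [zero_smul, zero_add] at h2
  have ha : a = 0 := h1.symm.trans h2
  change _ = (p : L) ^ (n * (k + 1)) • φ (Finsupp.single (c : OnePoint ℚ) 1)
  rw [hU, hab, ha, zero_smul, zero_add, zero_add, mul_smul]

/-- The total mass of φ(c) is its δ_c-coefficient. Thus U_pⁿ - 1 maps all boundary symbols into
`critDiv`. -/
theorem upDiv_pow_apply_shiftPow_zero (hN : N ≠ 0) {n : ℕ} (hn : p ^ n ≡ 1 [MOD N]) {k : ℕ}
    {φ : CuspDiv →+ Distr p L} (hφ : φ ∈ BdInv p N L k) {c : ℚ} (hc : ‖(c : ℚ_[p])‖ ≤ 1) :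
    ((upDiv p N L k ^ n) φ (Finsupp.single (c : OnePoint ℚ) 1) : Module.Dual L (LocAn p L))
        (shiftPow L (c : ℚ_[p]) 0) =
      (φ (Finsupp.single (c : OnePoint ℚ) 1) : Module.Dual L (LocAn p L))
        (shiftPow L (c : ℚ_[p]) 0) := by
  obtain ⟨a, b, hab, hU⟩ := exists_upDiv_pow_apply_eq hN hn hφ hc
  rw [hab, hU]
  exact (dirac_add_apply_zero ⟨(c : ℚ_[p]), hc⟩ k a _).trans
    (dirac_add_apply_zero ⟨(c : ℚ_[p]), hc⟩ k a b).symm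

end BoundaryValues

/-! ### Polynomials in U_p and valuations of their roots. -/

section PolynomialOperators

theorem aeval_apply_comm {L W W' : Type*} [Field L] [AddCommGroup W] [Module L W] [AddCommGroup W']
    [Module L W'] {A : Module.End L W} {A' : Module.End L W'} (T : W →ₗ[L] W')
    {E : Submodule L W} (hE : ∀ w ∈ E, A w ∈ E) (h : ∀ w ∈ E, A' (T w) = T (A w)) (P : L[X]) :
    ∀ w ∈ E, aeval A P w ∈ E ∧ aeval A' P (T w) = T (aeval A P w) := by
  have hpow : ∀ n : ℕ, ∀ w ∈ E, (A ^ n) w ∈ E ∧ (A' ^ n) (T w) = T ((A ^ n) w) := fun n => by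
    induction n with
    | zero => exact fun w hw => ⟨by simpa using hw, by simp⟩
    | succ n ih =>
      intro w hw
      rw [pow_succ, pow_succ]
      change (A ^ n) (A w) ∈ E ∧ (A' ^ n) (A' (T w)) = T ((A ^ n) (A w))
      rw [h w hw]
      exact ih _ (hE w hw)
  induction P using Polynomial.induction_on' with
  | add P Q hP hQ =>
    intro w hw
    rw [map_add, map_add, LinearMap.add_apply, LinearMap.add_apply, (hP w hw).2, (hQ w hw).2,
      map_add]
    exact ⟨add_mem (hP w hw).1 (hQ w hw).1, rfl⟩
  | monomial n a =>
    intro w hw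
    rw [aeval_monomial, aeval_monomial, ← Algebra.smul_def, ← Algebra.smul_def,
      LinearMap.smul_apply, LinearMap.smul_apply, (hpow n w hw).2, map_smul]
    exact ⟨E.smul_mem a (hpow n w hw).1, rfl⟩

/-- Bézout's identity uP + v(Xⁿ - 1) = 1 evaluated at A and applied to w. -/
theorem exists_eq_pow_sub_of_isCoprime {L W : Type*} [Field L] [AddCommGroup W] [Module L W]
    {A : Module.End L W} {P : L[X]} {n : ℕ} (h : IsCoprime P (X ^ n - 1)) {w : W}
    (hw : aeval A P w = 0) : ∃ v : L[X], w = (A ^ n) (aeval A v w) - aeval A v w := by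
  obtain ⟨u, v, huv⟩ := h
  rw [mul_comm v] at huv
  have h1 := congrArg (fun Q => aeval A Q w) huv
  simp only [map_add, map_mul, map_one] at h1
  rw [LinearMap.add_apply, Module.End.mul_apply, Module.End.mul_apply, hw, map_zero, zero_add,
    map_sub, map_pow, aeval_X, map_one] at h1
  exact ⟨v, h1.symm⟩

variable {p : ℕ} [Fact p.Prime] {L : Type*} [NormedField L] [NormedAlgebra ℚ_[p] L]
  [FiniteDimensional ℚ_[p] L]

/-- The spectral norm is power-multiplicative and extends the norm of ℚ_p, and nonnegative reals
have unique n-th roots. -/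
theorem spectralNorm_eq_of_pow_eq {n ν : ℕ} (hn : n ≠ 0) {x : AlgebraicClosure L}
    (hx : x ^ n = (p : AlgebraicClosure L) ^ (n * ν)) :
    spectralNorm ℚ_[p] (AlgebraicClosure L) x = ((p : ℝ) ^ ν)⁻¹ := by
  have halg : Algebra.IsAlgebraic ℚ_[p] (AlgebraicClosure L) :=
    Algebra.IsAlgebraic.trans ℚ_[p] L (AlgebraicClosure L)
  have h1 := isPowMul_spectralNorm (K := ℚ_[p]) (L := AlgebraicClosure L) x
    (Nat.one_le_iff_ne_zero.mpr hn)
  have h2 : (p : AlgebraicClosure L) ^ (n * ν) =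
      algebraMap ℚ_[p] (AlgebraicClosure L) ((p : ℚ_[p]) ^ (n * ν)) := by
    rw [map_pow, map_natCast]
  rw [hx, h2, spectralNorm_extends, norm_pow, Padic.norm_p, mul_comm, pow_mul] at h1
  rw [← inv_pow]
  exact ((pow_left_inj₀ (by positivity) (spectralNorm_nonneg x) hn).mp h1).symm

/-- A common root would be a root of unity, of norm 1, while the roots of P have norm p^{-ν} < 1. -/
theorem isCoprime_X_pow_sub_one {n ν : ℕ} (hn : n ≠ 0) (hν : ν ≠ 0) {P : L[X]} (hP : P ≠ 0)
    (h : ∀ x ∈ P.aroots (AlgebraicClosure L),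
      spectralNorm ℚ_[p] (AlgebraicClosure L) x = ((p : ℝ) ^ ν)⁻¹) : IsCoprime P (X ^ n - 1) := by
  refine (Polynomial.isCoprime_iff_aeval_ne_zero_of_isAlgClosed L (AlgebraicClosure L) _ _).mpr
    fun x => ?_
  by_contra! hx
  have h1 := h x (mem_aroots.mpr ⟨hP, hx.1⟩)
  have h2 : x ^ n = 1 := by
    have := hx.2
    rw [map_sub, map_pow, aeval_X, map_one] at this
    exact sub_eq_zero.mp this
  rw [spectralNorm_eq_of_pow_eq (p := p) (ν := 0) hn (by rw [h2, mul_zero, pow_zero])] at h1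
  have h3 : (1 : ℝ) < (p : ℝ) ^ ν :=
    one_lt_pow₀ (by exact_mod_cast (Fact.out : p.Prime).one_lt) hν
  rw [pow_zero, inv_one] at h1
  exact (inv_lt_one_of_one_lt₀ h3).ne h1.symm

end PolynomialOperators

/-! ### Identification of the ordinary and critical parts. -/

section Slopes
variable {p : ℕ} [Fact p.Prime] {N : ℕ} {L : Type*} [NormedField L] [NormedAlgebra ℚ_[p] L]
  [FiniteDimensional ℚ_[p] L]

theorem heckeDistr_restrictDiv0 (hN : N ≠ 0) (m : ℤ) (s : S0 p) (φ : CuspDiv →+ Distr p L) :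
    heckeDistr p N L m s (restrictDiv0 L (Distr p L) φ) = restrictDiv0 L (Distr p L)
      (hecke (homRep divAct (distrRep (p := p) L m)) (levelGroup p N) s φ) := by
  have h := hecke_intertwine (σ := homRep divAct (distrRep (p := p) L m))
    (σ' := distrHomRep p L m) s (finite_cosetReps hN s) (restrictDiv0 L (Distr p L)) 1
    (fun r _ w => by rw [one_smul]; rfl) φ
  rwa [one_smul] at h

/-- As φ(∞) = 0, φ(x) is the value of the restriction at x - ∞. -/
theorem restrictDiv0_injOn {m : ℤ} {φ ψ : CuspDiv →+ Distr p L} (hφ : φ ∈ BdInv p N L m)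
    (hψ : ψ ∈ BdInv p N L m)
    (h : restrictDiv0 L (Distr p L) φ = restrictDiv0 L (Distr p L) ψ) : φ = ψ := by
  refine Finsupp.addHom_ext' fun x => AddMonoidHom.ext_int ?_
  change φ (Finsupp.single x 1) = ψ (Finsupp.single x 1)
  have hmem : (Finsupp.single x 1 - Finsupp.single OnePoint.infty 1 : CuspDiv) ∈ CuspDiv0 := by
    change Finsupp.degree _ = 0
    rw [map_sub, Finsupp.degree_single, Finsupp.degree_single, sub_self]
  have h1 : φ (Finsupp.single x 1 - Finsupp.single OnePoint.infty 1) =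
      ψ (Finsupp.single x 1 - Finsupp.single OnePoint.infty 1) := DFunLike.congr_fun h ⟨_, hmem⟩
  rw [map_sub, map_sub, apply_infty_eq_zero hφ, apply_infty_eq_zero hψ] at h1
  exact sub_left_injective h1

theorem heckeDistr_mem_BSymb (hN : N ≠ 0) (m : ℤ) (s : S0 p) {Φ : CuspDiv0 →+ Distr p L}
    (hΦ : Φ ∈ BSymb (distrRep (p := p) L m) (levelGroup p N)) :
    heckeDistr p N L m s Φ ∈ BSymb (distrRep (p := p) L m) (levelGroup p N) := by
  obtain ⟨φ, hφ, rfl⟩ := hΦ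
  rw [heckeDistr_restrictDiv0 hN]
  exact ⟨_, hecke_mem_invariants mem_S0_of_mem_levelGroup s (finite_cosetReps hN s) hφ, rfl⟩

theorem aeval_upMatrix_restrictDiv0 (hN : N ≠ 0) {m : ℤ} (P : L[X]) {φ : CuspDiv →+ Distr p L}
    (hφ : φ ∈ BdInv p N L m) : aeval (upDiv p N L m) P φ ∈ BdInv p N L m ∧
      aeval (heckeDistr p N L m (upMatrix p)) P (restrictDiv0 L (Distr p L) φ) =
        restrictDiv0 L (Distr p L) (aeval (upDiv p N L m) P φ) :=
  aeval_apply_comm (restrictDiv0 L (Distr p L)) (fun _ hw => upDiv_mem hN hw)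
    (fun w _ => heckeDistr_restrictDiv0 hN m _ w) P φ hφ

/-- The polynomial Xⁿ - p^{nν} is the witness: all its roots have valuation ν. -/
theorem restrictDiv0_mem_BSymbSlope (hN : N ≠ 0) {m : ℤ} {n ν : ℕ} (hn : n ≠ 0)
    {φ : CuspDiv →+ Distr p L} (hφ : φ ∈ BdInv p N L m)
    (h : (upDiv p N L m ^ n) φ = (p : L) ^ (n * ν) • φ) :
    restrictDiv0 L (Distr p L) φ ∈ BSymbSlope p N L m ν := by
  refine Submodule.subset_span ⟨⟨φ, hφ, rfl⟩, X ^ n - C ((p : L) ^ (n * ν)),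
    X_pow_sub_C_ne_zero (Nat.pos_of_ne_zero hn) _, fun x hx => ?_, ?_⟩
  · have h1 := (mem_aroots.mp hx).2
    rw [map_sub, map_pow, aeval_X, aeval_C, map_pow, map_natCast] at h1
    exact spectralNorm_eq_of_pow_eq hn (sub_eq_zero.mp h1)
  · rw [(aeval_upMatrix_restrictDiv0 hN _ hφ).2, map_sub, map_pow, aeval_X, aeval_C,
      LinearMap.sub_apply, h, Module.algebraMap_end_apply, sub_self, map_zero]

theorem exists_pow_modEq_one (hN : ¬ p ∣ N) : ∃ n ≠ 0, p ^ n ≡ 1 [MOD N] := by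
  have hN0 : N ≠ 0 := by rintro rfl; exact hN (dvd_zero p)
  exact ⟨N.totient, (Nat.totient_pos.mpr (Nat.pos_of_ne_zero hN0)).ne',
    Nat.ModEq.pow_totient ((Nat.Prime.coprime_iff_not_dvd Fact.out).mpr hN)⟩

theorem BSymbOrd_eq (hN : ¬ p ∣ N) {m : ℤ} (hm : m < 0) :
    BSymbOrd p N L m = BSymb (distrRep (p := p) L m) (levelGroup p N) := by
  have hN0 : N ≠ 0 := by rintro rfl; exact hN (dvd_zero p)
  obtain ⟨n, hn0, hn⟩ := exists_pow_modEq_one hN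
  refine le_antisymm (Submodule.span_le.mpr fun Φ hΦ => hΦ.1) ?_
  rintro _ ⟨φ, hφ, rfl⟩
  refine restrictDiv0_mem_BSymbSlope hN0 hn0 hφ ?_
  rw [upDiv_pow_eq_self hN0 hn hm hφ, mul_zero, pow_zero, one_smul]

/-- On `critDiv` the operator U_pⁿ is the scalar p^{n(k+1)}, which gives one inclusion; the other is
that slope k + 1 excludes δ_c-components. -/
theorem BSymbCrit_eq (hN : ¬ p ∣ N) (k : ℕ) :
    BSymbCrit p N L k = (critDiv p N L k).map (restrictDiv0 L (Distr p L)) := by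
  have hN0 : N ≠ 0 := by rintro rfl; exact hN (dvd_zero p)
  obtain ⟨n, hn0, hn⟩ := exists_pow_modEq_one hN
  refine le_antisymm (Submodule.span_le.mpr ?_) ?_
  · rintro _ ⟨⟨φ, hφ, rfl⟩, P, hP0, hroots, hP⟩
    refine ⟨φ, mem_critDiv_of_apply_eq_zero hN0 hφ fun c hc => ?_, rfl⟩
    obtain ⟨hmem, hres⟩ := aeval_upMatrix_restrictDiv0 hN0 P hφ
    have hPφ : aeval (upDiv p N L k) P φ = 0 := by
      refine restrictDiv0_injOn hmem (zero_mem _) ?_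
      rw [map_zero, ← hres]
      exact hP
    -- φ is now (U_pⁿ - 1) applied to a boundary symbol, so its values have no δ_c-component.
    obtain ⟨v, hv⟩ := exists_eq_pow_sub_of_isCoprime
      (isCoprime_X_pow_sub_one hn0 (Nat.succ_ne_zero k) hP0 hroots) hPφ
    have hψ := (aeval_upMatrix_restrictDiv0 hN0 v hφ).1
    have h2 := upDiv_pow_apply_shiftPow_zero hN0 hn hψ hc
    rw [hv]
    exact sub_eq_zero.mpr h2
  · rintro _ ⟨φ, hφ, rfl⟩
    exact restrictDiv0_mem_BSymbSlope hN0 hn0 hφ.1 (upDiv_pow_eq_smul hN0 hn hφ)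

end Slopes

/-! ### The isomorphism Θ_k. -/

section Theta
variable {p : ℕ} [Fact p.Prime] {N : ℕ} {L : Type*} [NormedField L] [NormedAlgebra ℚ_[p] L]
  [FiniteDimensional ℚ_[p] L]

theorem theta_injective (k : ℕ) : Function.Injective (theta p L k) := fun _ _ h =>
  AddMonoidHom.ext fun D => derivDistr_pow_injective (k + 1) (DFunLike.congr_fun h D)

/-- Bol's identity for each representative; all of them have the determinant of s, since Γ has
determinant 1. -/
theorem heckeDistr_theta (hN : N ≠ 0) (k : ℕ) (s : S0 p) (Φ : CuspDiv0 →+ Distr p L) :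
    heckeDistr p N L k s (theta p L k Φ) =
      ((Matrix.det ((s : GL (Fin 2) ℚ) : Matrix (Fin 2) (Fin 2) ℚ) : ℚ) : L) ^ (k + 1) •
        theta p L k (heckeDistr p N L (-2 - (k : ℤ)) s Φ) := by
  refine hecke_intertwine (σ := distrHomRep p L (-2 - (k : ℤ))) (σ' := distrHomRep p L k) s
    (finite_cosetReps hN s) (theta p L k) _ (fun r hr Ψ => AddMonoidHom.ext fun D => ?_) Φ
  have h := weightActDistr_derivDistr_pow k r (Ψ (div0Act (r : GL (Fin 2) ℚ) D))
  rw [scal_s0Det, det_of_mem_cosetReps hr] at h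
  exact h

theorem weightActDistr_derivDistr_pow_of_mem (k : ℕ) {γ : S0 p}
    (hγ : (γ : GL (Fin 2) ℚ) ∈ levelGroup p N) (μ : Distr p L) :
    weightActDistr (k : ℤ) γ ((derivDistr ^ (k + 1) : Module.End L (Distr p L)) μ) =
      (derivDistr ^ (k + 1) : Module.End L (Distr p L)) (weightActDistr (-2 - (k : ℤ)) γ μ) := by
  rw [weightActDistr_derivDistr_pow, scal_s0Det, det_of_mem_levelGroup hγ, Rat.cast_one, one_pow,
    one_smul]

theorem derivDistr_pow_comp_mem_critDiv (hN : N ≠ 0) {k : ℕ} {φ : CuspDiv →+ Distr p L}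
    (hφ : φ ∈ BdInv p N L (-2 - (k : ℤ))) :
    (derivDistr ^ (k + 1) : Module.End L (Distr p L)).toAddMonoidHom.comp φ ∈ critDiv p N L k := by
  refine ⟨mem_bdInv_iff.mpr fun γ hγ x => ?_, fun c hc => ?_⟩
  · have h := mem_bdInv_iff.mp hφ γ hγ x
    have h1 := weightActDistr_derivDistr_pow_of_mem k hγ
      (φ (Finsupp.single ((γ : GL (Fin 2) ℚ) • x) 1))
    rw [h] at h1
    exact h1
  · obtain ⟨a, ha⟩ := exists_apply_eq_smul_dirac hN (by lia) hφ hc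
    refine ⟨a, ?_⟩
    change (derivDistr ^ (k + 1) : Module.End L (Distr p L)) (φ _) = _
    rw [ha, map_smul]
    rfl

/-- A preimage is chosen independently at each cusp, a multiple of δ_c or 0. Its Γ-invariance is
automatic: it holds after applying the injective, Γ-equivariant Θ_k. -/
theorem exists_derivDistr_pow_comp_eq (hN : N ≠ 0) {k : ℕ} {ψ : CuspDiv →+ Distr p L}
    (hψ : ψ ∈ critDiv p N L k) : ∃ φ ∈ BdInv p N L (-2 - (k : ℤ)),
      (derivDistr ^ (k + 1) : Module.End L (Distr p L)).toAddMonoidHom.comp φ = ψ := by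
  have hex : ∀ x : OnePoint ℚ, ∃ μ : Distr p L,
      (derivDistr ^ (k + 1) : Module.End L (Distr p L)) μ = ψ (Finsupp.single x 1) := fun x => by
    induction x using OnePoint.rec with
    | infty => exact ⟨0, by rw [map_zero, apply_infty_eq_zero hψ.1]⟩
    | coe c =>
      rcases le_or_gt ‖(c : ℚ_[p])‖ 1 with hc | hc
      · obtain ⟨τ, hτ⟩ := hψ.2 c hc
        exact ⟨τ • dirac ⟨(c : ℚ_[p]), hc⟩, by rw [hτ, map_smul]; rfl⟩
      · exact ⟨0, by rw [map_zero, apply_eq_zero_of_one_lt_norm hN hψ.1 hc]⟩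
  choose v hv using hex
  let φ : CuspDiv →+ Distr p L := Finsupp.liftAddHom fun x => zmultiplesHom (Distr p L) (v x)
  have hφ : ∀ x, φ (Finsupp.single x 1) = v x := fun x => by
    simp [φ]
  refine ⟨φ, mem_bdInv_iff.mpr fun γ hγ x => derivDistr_pow_injective (k + 1) ?_,
    Finsupp.addHom_ext' fun x => AddMonoidHom.ext_int ?_⟩
  · rw [← weightActDistr_derivDistr_pow_of_mem k hγ, hφ, hφ, hv, hv]
    exact mem_bdInv_iff.mp hψ.1 γ hγ x
  · change (derivDistr ^ (k + 1) : Module.End L (Distr p L)) (φ (Finsupp.single x 1)) =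
      ψ (Finsupp.single x 1)
    rw [hφ, hv]

theorem map_theta_BSymbOrd (hN : ¬ p ∣ N) (k : ℕ) :
    (BSymbOrd p N L (-2 - (k : ℤ))).map (theta p L k) = BSymbCrit p N L k := by
  have hN0 : N ≠ 0 := by rintro rfl; exact hN (dvd_zero p)
  rw [BSymbOrd_eq hN (by lia), BSymbCrit_eq hN]
  refine le_antisymm ?_ ?_
  · rintro _ ⟨_, ⟨φ, hφ, rfl⟩, rfl⟩
    exact ⟨_, derivDistr_pow_comp_mem_critDiv hN0 hφ, rfl⟩
  · rintro _ ⟨ψ, hψ, rfl⟩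
    obtain ⟨φ, hφ, rfl⟩ := exists_derivDistr_pow_comp_eq hN0 hψ
    exact ⟨_, ⟨φ, hφ, rfl⟩, rfl⟩

theorem heckeDistr_mem_BSymbOrd (hN : ¬ p ∣ N) {m : ℤ} (hm : m < 0) (s : S0 p)
    {Φ : CuspDiv0 →+ Distr p L} (hΦ : Φ ∈ BSymbOrd p N L m) :
    heckeDistr p N L m s Φ ∈ BSymbOrd p N L m := by
  rw [BSymbOrd_eq hN hm] at hΦ ⊢
  exact heckeDistr_mem_BSymb (by rintro rfl; exact hN (dvd_zero p)) m s hΦ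

/-- Stability is transported through Θ_k from the ordinary part, which is the whole of BSymb in
weight -2-k. -/
theorem heckeDistr_mem_BSymbCrit (hN : ¬ p ∣ N) (k : ℕ) (s : S0 p)
    {Φ : CuspDiv0 →+ Distr p L} (hΦ : Φ ∈ BSymbCrit p N L k) :
    heckeDistr p N L k s Φ ∈ BSymbCrit p N L k := by
  rw [← map_theta_BSymbOrd hN] at hΦ ⊢
  obtain ⟨Ψ, hΨ, rfl⟩ := hΦ
  rw [heckeDistr_theta (by rintro rfl; exact hN (dvd_zero p))]
  exact Submodule.smul_mem _ _ ⟨_, heckeDistr_mem_BSymbOrd hN (by lia) s hΨ, rfl⟩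

variable (p N L) in
/-- The isomorphism `Θₖ` from the ordinary part onto the critical part. -/
noncomputable def thetaEquiv (hN : ¬ p ∣ N) (k : ℕ) :
    BSymbOrd p N L (-2 - (k : ℤ)) ≃ₗ[L] BSymbCrit p N L k :=
  (Submodule.equivMapOfInjective (theta p L k) (theta_injective k) _).trans
    (LinearEquiv.ofEq _ _ (map_theta_BSymbOrd hN k))

theorem coe_thetaEquiv (hN : ¬ p ∣ N) (k : ℕ) (Φ : BSymbOrd p N L (-2 - (k : ℤ))) :
    (thetaEquiv p N L hN k Φ : CuspDiv0 →+ Distr p L) = theta p L k Φ := rfl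

theorem mem_critDiv_of_restrictDiv0_mem (hN : ¬ p ∣ N) {k : ℕ} {φ : CuspDiv →+ Distr p L}
    (hφ : φ ∈ BdInv p N L k) (h : restrictDiv0 L (Distr p L) φ ∈ BSymbCrit p N L k) :
    φ ∈ critDiv p N L k := by
  rw [BSymbCrit_eq hN] at h
  obtain ⟨ψ, hψ, hψφ⟩ := h
  rwa [restrictDiv0_injOn hφ hψ.1 hψφ.symm]

end Theta

end OMS

/-! ### The main theorem. -/

theorem theorem5p4 (p : ℕ) [Fact p.Prime] (N : ℕ) (hN : ¬ p ∣ N)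
    (L : Type*) [NormedField L] [NormedAlgebra ℚ_[p] L] [FiniteDimensional ℚ_[p] L] (k : ℕ) :
    -- `Θₖ` restricts to a linear isomorphism from the ordinary part onto the critical part
    (∃ e : OMS.BSymbOrd p N L (-2 - (k : ℤ)) ≃ₗ[L] OMS.BSymbCrit p N L k,
      (∀ Φ : OMS.BSymbOrd p N L (-2 - (k : ℤ)),
        (e Φ : OMS.CuspDiv0 →+ OMS.Distr p L) = OMS.theta p L k Φ) ∧
      -- which is equivariant, up to the twist by `det ^ (k + 1)`, for the operators `[Γ s Γ]`
      (∀ (s : OMS.S0 p) (Φ : OMS.BSymbOrd p N L (-2 - (k : ℤ))),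
        OMS.heckeDistr p N L k s (e Φ) =
          ((Matrix.det ((s : GL (Fin 2) ℚ) : Matrix (Fin 2) (Fin 2) ℚ) : ℚ) : L) ^ (k + 1) •
            OMS.theta p L k (OMS.heckeDistr p N L (-2 - (k : ℤ)) s Φ))) ∧
    -- both spaces are modules over the Hecke algebra
    (∀ s : OMS.S0 p, OMS.IsStandardHecke p N s →
      (∀ Φ ∈ OMS.BSymbOrd p N L (-2 - (k : ℤ)),
        OMS.heckeDistr p N L (-2 - (k : ℤ)) s Φ ∈ OMS.BSymbOrd p N L (-2 - (k : ℤ))) ∧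
      (∀ Φ ∈ OMS.BSymbCrit p N L k, OMS.heckeDistr p N L k s Φ ∈ OMS.BSymbCrit p N L k)) ∧
    -- values of critical boundary symbols at the cusps outside and inside `C₀ = ℚ ∩ ℤ_p`
    (∀ φ ∈ OMS.invariants (OMS.homRep OMS.divAct (OMS.distrRep (p := p) L k))
        (OMS.levelGroup p N),
      OMS.restrictDiv0 L (OMS.Distr p L) φ ∈ OMS.BSymbCrit p N L k →
      (φ (Finsupp.single OnePoint.infty 1) = 0) ∧
      (∀ c : ℚ, 1 < ‖(c : ℚ_[p])‖ → φ (Finsupp.single (OnePoint.some c) 1) = 0) ∧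
      (∀ (c : ℚ) (hc : ‖(c : ℚ_[p])‖ ≤ 1), ∃ τ : L,
        φ (Finsupp.single (OnePoint.some c) 1) =
          τ • OMS.diracDeriv (⟨(c : ℚ_[p]), hc⟩ : ℤ_[p]) (k + 1))) := by
  have hN0 : N ≠ 0 := by rintro rfl; exact hN (dvd_zero p)
  refine ⟨⟨OMS.thetaEquiv p N L hN k, OMS.coe_thetaEquiv hN k, fun s Φ => ?_⟩, fun s _ =>
    ⟨fun Φ hΦ => ?_, fun Φ hΦ => ?_⟩, fun φ hφ hcrit => ⟨?_, fun c hc => ?_, ?_⟩⟩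
  · rw [OMS.coe_thetaEquiv]
    exact OMS.heckeDistr_theta hN0 k s (Φ : OMS.CuspDiv0 →+ OMS.Distr p L)
  · exact OMS.heckeDistr_mem_BSymbOrd hN (by lia) s hΦ
  · exact OMS.heckeDistr_mem_BSymbCrit hN k s hΦ
  · exact OMS.apply_infty_eq_zero hφ
  · exact OMS.apply_eq_zero_of_one_lt_norm hN0 hφ hc
  · exact (OMS.mem_critDiv_of_restrictDiv0_mem hN hφ hcrit).2
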